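/- Fix an infinite set $D$ of data values and a finite alphabet $A$; let $B=\{0,1\}$. A *renaming* is a permutation of $D$. A *data monoid* is a monoid $M$ on which renamings act by monoid automorphisms and in which every element has finite memory, i.e. is fixed by all renamings that fix some finite subset of $D$ pointwise. It is *orbit-finite* if this action has finitely many orbits, and *aperiodic* if every $s\in M$ satisfies $s^{n+1}=s^n$ for some $n$. For an alphabet $\Sigma$, the finite words over $D\times\Sigma$ (*data words*) form the free data monoid $(D\times \Sigma)^*$, on which renamings act through the data values. Morphisms of data monoids are the equivariant monoid homomorphisms. A language $L\subseteq(D\times\Sigma)^*$ is *recognized* by $M$ via a morphism $h:(D\times \Sigma)^*\to M$ if $L=h^{-1}(F)$ for some $F\subseteq M$ closed under renamings. MSO$^\sim$ formulas are built from the atoms $a(x)$ ($a\in A$), $x<y$, $x\in Y$, $x\sim y$ (positions $x,y$ carry the same data value) with $\neg$, $\wedge$, $\exists x$ and $\exists Y$, and are interpreted over data words in $(D\times A)^*$. A formula $\varphi(x,y)$, with free variables among the distinct first-order variables $x,y$, is *rigid* if in every data word each position $x$ has at most one position $y$ with $\varphi(x,y)$, and each $y$ at most one such $x$. *Rigidly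 guarded* MSO$^\sim$ is given by the grammar $$\varphi::=\exists x\,\varphi\mid\exists Y\,\varphi\mid a(x)\mid x<y\mid x\in Y\mid\neg\varphi\mid\varphi\wedge\varphi\mid \varphi_{\rm rigid}(x,y)\wedge x\sim y,$$ where $\varphi_{\rm rigid}(x,y)$ is a rigid formula generated by the same grammar; rigidly guarded FO$^\sim$ is its fragment without second-order variables. Let $X_1,\dots,X_m$ be distinct (first- or second-order) variables. For $w\in(D\times A)^*$ and sets $U_1,\dots,U_m$ of positions of $w$, let $\langle w,U_1,\dots,U_m\rangle\in(D\times A\times B^m)^*$ be the word $w$ annotated at each position with the $m$ bits telling which of the $U_j$ contain it. For a formula $\varphi$ with free variables among $X_1,\dots,X_m$ put $$[\![\varphi]\!]=\{\langle w,U_1,\dots,U_m\rangle : w\models\varphi(U_1,\dots,U_m)\},$$ where a first-order variable is regarded as a set variable whose value is a singleton. A morphism $h$ from $(D\times A\times B^m)^*$ to a data monoid is *projectable* if, for all $w,\bar U,\bar V$, whenever $h(\langle w,\bar U\rangle)$ and $h(\langle w,\bar V\rangle)$ are in the same orbit, they are equal. A triple $(M,h,F)$ as above with $M$ orbit-finite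 is *finitely represented* by its restriction to a finite nonempty $C\subseteq D$ such that $|C|\ge 2|S|$ holds, for each $s\in M$, for some set $S\subseteq D$ supporting $s$: the finite set of elements of $M$ supported by $C$, with the tables of the product, of the action of the renamings of $C$, of the values of $h$ on the one-letter words with data value in $C$, and of membership in $F$. *Effectively recognized* means that some algorithm, given the formula (and, for $[\![\varphi]\!]$, the list $X_1,\dots,X_m$), outputs a finite representation of such a triple recognizing the language. **Theorem.** (1) For all rigidly guarded MSO$^\sim$ formulas $\varphi(X_1,\dots,X_m)$, the language $[\![\varphi]\!]$ is effectively recognized by an orbit-finite data monoid via a projectable morphism. (2) For every rigidly guarded MSO$^\sim$ sentence, the data language it defines is effectively recognized by an orbit-finite data monoid. (3) For every rigidly guarded FO$^\sim$ sentence, the data language it defines is effectively recognized by an aperiodic orbit-finite data monoid. -/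

import Mathlib

universe u v w

/-! ## Data monoids over a set `D` of data values

Renamings are the permutations of `D`. -/

/-- A data monoid over `D`: a monoid on which the renamings of `D` act by monoid automorphisms
and all of whose elements have finite memory (that is, are supported by a finite set of data
values). -/
structure DataMonoid (D : Type u) where
  carrier : Type w
  [monoid : Monoid carrier]
  [action : MulDistribMulAction (Equiv.Perm D) carrier]
  finite_memory : ∀ s : carrier, ∃ C : Finset D,
    MulAction.Supports (Equiv.Perm D) (C : Set D) s

namespace DataMonoid

instance (D : Type u) : CoeSort (DataMonoid.{u, w} D) (Type w) := ⟨DataMonoid.carrier⟩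

attribute [instance] DataMonoid.monoid DataMonoid.action

/-- `s` and `t` lie in the same orbit. -/
def OrbitEq {D : Type u} (M : DataMonoid.{u, w} D) (s t : M) : Prop :=
  ∃ g : Equiv.Perm D, g • s = t

/-- The data monoid has finitely many orbits. -/
def OrbitFinite {D : Type u} (M : DataMonoid.{u, w} D) : Prop :=
  Finite (MulAction.orbitRel.Quotient (Equiv.Perm D) M)

/-- The underlying monoid is aperiodic. -/
def Aperiodic {D : Type u} (M : DataMonoid.{u, w} D) : Prop :=
  ∀ s : M, ∃ n : ℕ, s ^ (n + 1) = s ^ n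

/-- A subset that is closed under renamings. -/
def Equivariant {D : Type u} (M : DataMonoid.{u, w} D) (F : Set M) : Prop :=
  ∀ (g : Equiv.Perm D) (s : M), s ∈ F → g • s ∈ F

/-- Morphisms of data monoids: equivariant monoid homomorphisms. -/
structure Hom {D : Type u} (M : DataMonoid.{u, v} D) (N : DataMonoid.{u, w} D)
    extends M.carrier →* N.carrier where
  map_smul' : ∀ (g : Equiv.Perm D) (s : M), toFun (g • s) = g • toFun s

end DataMonoid

/-- Renamings act on data words letter by letter, on the data values only. -/
instance renamingAction (D : Type u) (B : Type v) :
    MulDistribMulAction (Equiv.Perm D) (FreeMonoid (D × B)) where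
  smul g z := FreeMonoid.map (fun p => (g p.1, p.2)) z
  one_smul z := List.map_id z
  mul_smul g h z := (List.map_map (l := FreeMonoid.toList z)
    (g := fun p : D × B => (g p.1, p.2)) (f := fun p : D × B => (h p.1, p.2))).symm
  smul_mul g y z := map_mul (FreeMonoid.map (fun p : D × B => (g p.1, p.2))) y z
  smul_one g := map_one (FreeMonoid.map (fun p : D × B => (g p.1, p.2)))

/-- The free data monoid `(D × B)*` of all data words over the alphabet `D × B`. -/
def freeDataMonoid (D : Type u) (B : Type v) : DataMonoid.{u, max u v} D where
  carrier := FreeMonoid (D × B)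
  finite_memory z := by
    classical
    refine ⟨((FreeMonoid.toList z).map Prod.fst).toFinset, fun g hg => ?_⟩
    change List.map (fun p : D × B => (g p.1, p.2)) (FreeMonoid.toList z) = FreeMonoid.toList z
    conv_rhs => rw [← List.map_id (FreeMonoid.toList z)]
    refine List.map_congr_left fun p hp => ?_
    have h : g p.1 = p.1 := hg (by
      simp only [List.coe_toFinset, Set.mem_ofPred_eq]
      exact List.mem_map_of_mem hp)
    simp [h]

namespace DataMonoid.Hom

/-- The value of a morphism on a data word. -/
def onWord {D : Type u} {B : Type v} {M : DataMonoid.{u, w} D}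
    (h : (freeDataMonoid D B).Hom M) (z : List (D × B)) : M :=
  h.toFun (FreeMonoid.ofList z)

/-- The language `L` is recognized by `M` via `h`, with the equivariant accepting set `F`. -/
def Recognizes {D : Type u} {B : Type v} {M : DataMonoid.{u, w} D}
    (h : (freeDataMonoid D B).Hom M) (F : Set M) (L : Set (List (D × B))) : Prop :=
  M.Equivariant F ∧ ∀ z, z ∈ L ↔ h.onWord z ∈ F

end DataMonoid.Hom

/-! ## Annotated data words and projectable morphisms -/

/-- The data word `⟨w, U₁, …, Uₘ⟩` over `D × (A × {0,1}ᵐ)`; the positions of `w` are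
`0, …, w.length - 1`. -/
def annotate {D : Type u} {A : Type v} {m : ℕ} (w : List (D × A)) (U : Fin m → Finset ℕ) :
    List (D × (A × (Fin m → Bool))) :=
  w.mapIdx fun i p => (p.1, (p.2, fun j => decide (i ∈ U j)))

/-- A morphism is projectable over `{0,1}ᵐ` if two annotations of the same data word whose images
lie in the same orbit have the same image. -/
def DataMonoid.Hom.Projectable {D : Type u} {A : Type v} {m : ℕ} {M : DataMonoid.{u, w} D}
    (h : (freeDataMonoid D (A × (Fin m → Bool))).Hom M) : Prop :=
  ∀ (w : List (D × A)) (U V : Fin m → Finset ℕ),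
    (∀ j, U j ⊆ Finset.range w.length) → (∀ j, V j ⊆ Finset.range w.length) →
    M.OrbitEq (h.onWord (annotate w U)) (h.onWord (annotate w V)) →
    h.onWord (annotate w U) = h.onWord (annotate w V)

/-! ## Monadic second-order logic with data equality tests -/

/-- Formulas of MSO with data equality tests over the finite alphabet `A`. First-order and
second-order variables are named by natural numbers. -/
inductive MSO (A : Type v) : Type v
  | exFO (x : ℕ) (φ : MSO A) : MSO A
  | exSO (X : ℕ) (φ : MSO A) : MSO A
  | letter (a : A) (x : ℕ) : MSO A
  | lt (x y : ℕ) : MSO A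
  | mem (x X : ℕ) : MSO A
  | sim (x y : ℕ) : MSO A
  | neg (φ : MSO A) : MSO A
  | conj (φ ψ : MSO A) : MSO A

/-- A variable of either kind: `inl x` is the first-order variable `x`, `inr X` the second-order
variable `X`. -/
abbrev MSOVar := ℕ ⊕ ℕ

namespace MSO

/-- The free variables. -/
def freeVars {A : Type v} : MSO A → Finset MSOVar
  | exFO x φ => φ.freeVars.erase (Sum.inl x)
  | exSO X φ => φ.freeVars.erase (Sum.inr X)
  | letter _ x => {Sum.inl x}
  | lt x y => {Sum.inl x, Sum.inl y}
  | mem x X => {Sum.inl x, Sum.inr X}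
  | sim x y => {Sum.inl x, Sum.inl y}
  | neg φ => φ.freeVars
  | conj φ ψ => φ.freeVars ∪ ψ.freeVars

/-- Satisfaction in the data word `w`, where `ν` and `μ` are the values of the first-order and of
the second-order variables. -/
def Sat {D : Type u} {A : Type v} (w : List (D × A)) :
    MSO A → (ℕ → ℕ) → (ℕ → Finset ℕ) → Prop
  | exFO x φ, ν, μ => ∃ p, p < w.length ∧ Sat w φ (Function.update ν x p) μ
  | exSO X φ, ν, μ => ∃ U, U ⊆ Finset.range w.length ∧ Sat w φ ν (Function.update μ X U)
  | letter a x, ν, _ => ∃ d, w[ν x]? = some (d, a)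
  | lt x y, ν, _ => ν x < ν y
  | mem x X, ν, μ => ν x ∈ μ X
  | sim x y, ν, _ => ∃ d a b, w[ν x]? = some (d, a) ∧ w[ν y]? = some (d, b)
  | neg φ, ν, μ => ¬ Sat w φ ν μ
  | conj φ ψ, ν, μ => Sat w φ ν μ ∧ Sat w ψ ν μ

/-- `w ⊨ φ(p, q)` for a formula `φ(x, y)` whose free variables are among the distinct first-order
variables `x`, `y`. -/
def SatPair {D : Type u} {A : Type v} (w : List (D × A)) (φ : MSO A) (x y p q : ℕ) : Prop :=
  Sat w φ (Function.update (Function.update (fun _ => 0) x p) y q) (fun _ => ∅)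

/-- `φ(x, y)` defines a partial bijection between the positions of each data word. -/
def Rigid (D : Type u) {A : Type v} (φ : MSO A) (x y : ℕ) : Prop :=
  ∀ w : List (D × A),
    (∀ p q q', p < w.length → q < w.length → q' < w.length →
      SatPair w φ x y p q → SatPair w φ x y p q' → q = q') ∧
    (∀ p p' q, p < w.length → p' < w.length → q < w.length →
      SatPair w φ x y p q → SatPair w φ x y p' q → p = p')

/-- The formulas of rigidly guarded MSO with data equality tests. -/
inductive RigidlyGuarded (D : Type u) {A : Type v} : MSO A → Prop
  | exFO (x : ℕ) {φ : MSO A} : RigidlyGuarded D φ → RigidlyGuarded D (exFO x φ)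
  | exSO (X : ℕ) {φ : MSO A} : RigidlyGuarded D φ → RigidlyGuarded D (exSO X φ)
  | letter (a : A) (x : ℕ) : RigidlyGuarded D (letter a x)
  | lt (x y : ℕ) : RigidlyGuarded D (lt x y)
  | mem (x X : ℕ) : RigidlyGuarded D (mem x X)
  | neg {φ : MSO A} : RigidlyGuarded D φ → RigidlyGuarded D (neg φ)
  | conj {φ ψ : MSO A} : RigidlyGuarded D φ → RigidlyGuarded D ψ → RigidlyGuarded D (conj φ ψ)
  | guardedSim {φ : MSO A} {x y : ℕ} : RigidlyGuarded D φ → x ≠ y →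
      φ.freeVars ⊆ {Sum.inl x, Sum.inl y} → Rigid D φ x y →
      RigidlyGuarded D (conj φ (sim x y))

/-- The first-order formulas: no second-order variable occurs. -/
def IsFO {A : Type v} : MSO A → Prop
  | exFO _ φ => φ.IsFO
  | exSO _ _ => False
  | letter _ _ => True
  | lt _ _ => True
  | mem _ _ => False
  | sim _ _ => True
  | neg φ => φ.IsFO
  | conj φ ψ => φ.IsFO ∧ ψ.IsFO

/-- The language `⟦φ(X₁, …, Xₘ)⟧` of annotated data words, for a list `X₁, …, Xₘ` of variables of
either kind that contains the free variables of `φ`. A first-order variable is read as a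
second-order variable whose value is a singleton. -/
def annotatedLanguage (D : Type u) {A : Type v} (φ : MSO A) (X : List MSOVar) :
    Set (List (D × (A × (Fin X.length → Bool)))) :=
  {z | ∃ (w : List (D × A)) (U : Fin X.length → Finset ℕ) (ν : ℕ → ℕ) (μ : ℕ → Finset ℕ),
    z = annotate w U ∧ (∀ j, U j ⊆ Finset.range w.length) ∧
    (∀ j, U j = Sum.elim (fun x => {ν x}) μ (X.get j)) ∧ Sat w φ ν μ}

/-- The data language defined by a sentence `φ`. (The values given to the variables are
immaterial as no variable is free in `φ`.) -/
def language (D : Type u) {A : Type v} (φ : MSO A) : Set (List (D × A)) :=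
  {w | Sat w φ (fun _ => 0) (fun _ => ∅)}

/-- A formula as a natural number, the input of algorithms. -/
def code {A : Type v} [Encodable A] : MSO A → ℕ
  | exFO x φ => Nat.pair 0 (Nat.pair x φ.code)
  | exSO X φ => Nat.pair 1 (Nat.pair X φ.code)
  | letter a x => Nat.pair 2 (Nat.pair (Encodable.encode a) x)
  | lt x y => Nat.pair 3 (Nat.pair x y)
  | mem x X => Nat.pair 4 (Nat.pair x X)
  | sim x y => Nat.pair 5 (Nat.pair x y)
  | neg φ => Nat.pair 6 φ.code
  | conj φ ψ => Nat.pair 7 (Nat.pair φ.code ψ.code)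

end MSO

/-! ## Finite representations

An orbit-finite data monoid `M`, a morphism `h : (D × B)* → M` and an equivariant set `F ⊆ M` are
represented, up to isomorphism, by their restriction to a finite nonempty set `C` of data values
that has at least twice as many elements as the memory of any element of `M`. -/

/-- `(k, n, mul, act, img, acc)`: the number `k` of data values in `C`, the number `n` of elements
of the restriction of `M` to `C`, and the tables of the product, of the action of the
renamings of `C`, of the images of the one-letter words, and of the accepting elements. -/
abbrev FiniteRep : Type :=
  ℕ × ℕ × List (ℕ × ℕ × ℕ) × List (List ℕ × ℕ × ℕ) × List (ℕ × ℕ × ℕ) × List ℕ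

/-- A letter with `m` bits as a natural number, the input and output of algorithms. -/
def annotatedLetterCode {A : Type v} [Encodable A] {m : ℕ} (b : A × (Fin m → Bool)) : ℕ :=
  Nat.pair (Encodable.encode b.1) (Encodable.encode (List.ofFn b.2))

/-- The tuple represents `M`, `h` and `F`, where letters are coded as numbers by `c`: `ι` enumerates
`C`, and `e` enumerates the restriction of `M` to `C`, that is, the elements with memory included
in `C`. A renaming `g` of `C` is written as the list of its values and acts on `M` after extension by the identity outside `C`. -/
def FiniteRep.Represents {D : Type u} {B : Type v} (c : B → ℕ) {M : DataMonoid.{u, w} D}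
    (h : (freeDataMonoid D B).Hom M) (F : Set M) : FiniteRep → Prop
  | (k, n, mul, act, img, acc) =>
    ∃ (ι : Fin k ↪ D)
      (e : Fin n ≃ {s : M // MulAction.Supports (Equiv.Perm D) (Set.range ι) s}),
      1 ≤ k ∧
      (∀ s : M, ∃ S : Finset D, MulAction.Supports (Equiv.Perm D) (S : Set D) s ∧
        2 * S.card ≤ k) ∧
      (∀ i j l : Fin n, ((i : ℕ), (j : ℕ), (l : ℕ)) ∈ mul ↔
        (e i : M) * (e j : M) = (e l : M)) ∧
      (∀ (g : Equiv.Perm (Fin k)) (i j : Fin n),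
        (List.ofFn (fun d => (g d : ℕ)), (i : ℕ), (j : ℕ)) ∈ act ↔
          g.viaEmbedding ι • (e i : M) = (e j : M)) ∧
      (∀ (d : Fin k) (b : B) (i : Fin n),
        ((d : ℕ), c b, (i : ℕ)) ∈ img ↔ h.onWord [(ι d, b)] = (e i : M)) ∧
      (∀ i : Fin n, (i : ℕ) ∈ acc ↔ (e i : M) ∈ F)

/-! A position of an annotated word carries the set of variables whose values contain it, so a
formula becomes a renaming-invariant property of words (`MSO.Holds`). By recursion on the formula,
`MSO.Cong` defines a relation on annotated words, and the recognizing data monoid is the quotient of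
the free one by it. What has to be shown is that this relation is an equivariant monoid congruence
which preserves satisfaction and is projectable (`MSO.RigidlyGuarded.cong`), and that it has
finitely many orbits of classes, with a computable bound (`MSO.RigidlyGuarded.memCode`).

Projectability is what makes quantifiers work. A class for `∃ x, φ` is the set of `φ`-classes of all
ways to mark `x` in a word, and the finite subsets of an orbit-finite set need not be orbit-finite.
But the markings of one word that yield classes in the same orbit yield equal classes, so each orbit
contributes at most one class. The set is therefore described by the list of orbits that occur, with
one memory for each (`Word.MemCode.lift`). Comparing words by a back-and-forth over their markings
(`Word.Lift`) is again projectable (`Word.Nice.lift`), which closes the induction.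

Rigidity is what makes guarded equality tests projectable. For `φ ∧ x ∼ y`, a factor that contains
`x` but not `y` must remember the data value of `x`; remembered unconditionally, it would
distinguish markings of one word that lie in one orbit. `MSO.Guard` remembers it only for factors of
words that satisfy `φ`. Put two `φ`-congruent markings of the same factor into the same context: `φ`
holds for both or for neither. If it holds, `y` sits at the same position of the context for both,
so rigidity puts `x` at the same position too, and its data value is the same (`MSO.nice_guard`).

For first-order formulas, a marking of a high power `zⁿ` touches a single copy of `z`, and on one
side of it enough unmarked copies remain to add or drop one; guards do not see high powers of a word
with a marked variable, as these are not factors of words where the variable is a single position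
(`MSO.RigidlyGuarded.cong_rep`).

For effectivity, the pigeonhole principle on prefixes gives every class a representative of bounded
length (`Word.Nice.exists_short`), and contexts of bounded size decide whether a factor is useful
(`MSO.useful_ren_iff_small`). Satisfaction and the congruence on bounded words over initial segments
of `ℕ` are therefore computed by a primitive recursion over codes of formulas (`mem_tab_holds`,
`mem_tab_cong`). The elements supported by the first `k` data values are the classes of short words
that are unchanged when all other data values are replaced by fresh ones
(`Word.Nice.supports_of_rel_shift`), and this yields the finite representation
(`represents_tableRep`). -/

/-! ## Annotated words and a set-based semantics

The variables are numbered: the first-order variable `x` is `2 * x`, the second-order variable `X`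
is `2 * X + 1`. A position of an annotated word carries the finite set of the variables whose
values contain it. -/

/-- Annotated data words. -/
abbrev Word (D : Type u) (A : Type v) := List (D × A × Finset ℕ)

/-- Renaming of the data values of a word. -/
def ren {D D' : Type*} {B : Type*} (g : D → D') (z : List (D × B)) : List (D' × B) :=
  z.map fun p => (g p.1, p.2)

namespace Word

variable {D : Type u} {A : Type v}

/-- The number of positions in the value of the variable `x`. -/
def cnt (x : ℕ) (z : Word D A) : ℕ := z.countP fun p => x ∈ p.2.2

/-- The word with the variable `x` erased from its annotation. -/
def er (x : ℕ) (z : Word D A) : Word D A := z.map fun p => (p.1, p.2.1, p.2.2.erase x)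

/-- The underlying data word. -/
def base (z : Word D A) : List (D × A) := z.map fun p => (p.1, p.2.1)

/-- The word where the value of the variable `x` is changed to the positions in `P`. -/
noncomputable def setAt (x : ℕ) (P : Finset ℕ) (z : Word D A) : Word D A :=
  z.mapIdx fun i p => (p.1, p.2.1, if i ∈ P then insert x p.2.2 else p.2.2.erase x)

@[simp] theorem ren_nil {D' B : Type*} (g : D → D') : ren g ([] : List (D × B)) = [] := rfl

@[simp] theorem ren_append {D' B : Type*} (g : D → D') (y z : List (D × B)) :
    ren g (y ++ z) = ren g y ++ ren g z := List.map_append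

@[simp] theorem length_ren {D' B : Type*} (g : D → D') (z : List (D × B)) :
    (ren g z).length = z.length := List.length_map _

theorem ren_ren {D' D'' B : Type*} (g : D → D') (h : D' → D'') (z : List (D × B)) :
    ren h (ren g z) = ren (h ∘ g) z := by simp [ren, Function.comp_def]

theorem ren_id {B : Type*} (z : List (D × B)) : ren id z = z := by simp [ren]

theorem ren_congr {D' B : Type*} {g h : D → D'} {z : List (D × B)} (H : ∀ p ∈ z, g p.1 = h p.1) :
    ren g z = ren h z := List.map_congr_left fun p hp => by rw [H p hp]

theorem exists_mem_ren {D' B : Type*} {g : D → D'} {z : List (D × B)} {P : D' × B → Prop} :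
    (∃ p ∈ ren g z, P p) ↔ ∃ p ∈ z, P (g p.1, p.2) := by
  simp only [ren, List.mem_map, exists_exists_and_eq_and]

@[simp] theorem cnt_nil (x : ℕ) : cnt x ([] : Word D A) = 0 := rfl

@[simp] theorem cnt_append (x : ℕ) (y z : Word D A) : cnt x (y ++ z) = cnt x y + cnt x z :=
  List.countP_append

theorem cnt_eq_zero {x : ℕ} {z : Word D A} : cnt x z = 0 ↔ ∀ p ∈ z, x ∉ p.2.2 := by
  simp [cnt, List.countP_eq_zero]

theorem cnt_pos {x : ℕ} {z : Word D A} : 0 < cnt x z ↔ ∃ p ∈ z, x ∈ p.2.2 := by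
  simp [cnt, List.countP_pos_iff]

@[simp] theorem er_append (x : ℕ) (y z : Word D A) : er x (y ++ z) = er x y ++ er x z :=
  List.map_append

@[simp] theorem base_append (y z : Word D A) : base (y ++ z) = base y ++ base z :=
  List.map_append

@[simp] theorem length_er (x : ℕ) (z : Word D A) : (er x z).length = z.length :=
  List.length_map _

@[simp] theorem length_base (z : Word D A) : (base z).length = z.length := List.length_map _

theorem er_er (x : ℕ) (z : Word D A) : er x (er x z) = er x z := by
  simp [er]

theorem cnt_er_self (x : ℕ) (z : Word D A) : cnt x (er x z) = 0 := by
  rw [cnt_eq_zero]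
  intro p hp
  obtain ⟨q, -, rfl⟩ := List.mem_map.1 hp
  simp

theorem cnt_er_of_ne {x y : ℕ} (h : y ≠ x) (z : Word D A) : cnt y (er x z) = cnt y z := by
  simp [cnt, er, List.countP_map, Function.comp_def, h]

theorem base_er (x : ℕ) (z : Word D A) : base (er x z) = base z := by
  simp [base, er]

theorem er_eq_self {x : ℕ} {z : Word D A} (h : cnt x z = 0) : er x z = z := by
  rw [cnt_eq_zero] at h
  conv_rhs => rw [← List.map_id z]
  exact List.map_congr_left fun p hp => by simp [Finset.erase_eq_of_notMem (h p hp)]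

theorem base_eq_of_er {x : ℕ} {y z : Word D A} (h : er x y = er x z) : base y = base z := by
  rw [← base_er x, h, base_er]

theorem length_eq_of_er {x : ℕ} {y z : Word D A} (h : er x y = er x z) : y.length = z.length := by
  rw [← length_er x, h, length_er]

theorem cnt_eq_of_er {x v : ℕ} {y z : Word D A} (h : er x y = er x z) (hv : v ≠ x) :
    cnt v y = cnt v z := by
  rw [← cnt_er_of_ne hv, h, cnt_er_of_ne hv]

theorem cnt_ren {D' : Type*} (g : D → D') (x : ℕ) (z : Word D A) : cnt x (ren g z) = cnt x z := by
  simp [cnt, ren, List.countP_map, Function.comp_def]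

theorem er_ren {D' : Type*} (g : D → D') (x : ℕ) (z : Word D A) :
    er x (ren g z) = ren g (er x z) := by
  simp [er, ren, Function.comp_def]

/-- The variants of a renamed word are renamed variants. -/
theorem exists_of_er_ren {D' : Type*} {g : D → D'} (x : ℕ) {z : Word D A} :
    ∀ {y : Word D' A}, er x y = er x (ren g z) → ∃ y', y = ren g y' ∧ (er x y' = er x z) := by
  induction z with
  | nil =>
    intro y h
    simp [er, ren] at h
    exact ⟨[], by simp [h], rfl⟩
  | cons p z ih =>
    intro y h
    cases y with
    | nil => simp [er, ren] at h
    | cons q y =>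
      simp only [er, ren, List.map_cons, List.cons.injEq, Prod.mk.injEq] at h
      obtain ⟨y', rfl, hy'⟩ := ih (y := y) h.2
      refine ⟨(p.1, q.2) :: y', ?_, ?_⟩
      · simp [ren, ← h.1.1]
      · simp only [er, List.map_cons, List.cons.injEq, Prod.mk.injEq]
        exact ⟨⟨trivial, h.1.2⟩, hy'⟩

theorem er_eq_append {x : ℕ} {y z₁ z₂ : Word D A} (h : er x y = er x (z₁ ++ z₂)) :
    ∃ y₁ y₂, y = y₁ ++ y₂ ∧ er x y₁ = er x z₁ ∧ er x y₂ = er x z₂ := by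
  rw [er_append] at h
  obtain ⟨y₁, y₂, rfl, h₁, h₂⟩ := List.map_eq_append_iff.1 h
  exact ⟨y₁, y₂, rfl, h₁, h₂⟩

theorem er_setAt (x : ℕ) (P : Finset ℕ) (z : Word D A) : er x (setAt x P z) = er x z := by
  apply List.ext_getElem?
  intro i
  simp only [er, setAt, List.getElem?_map, List.getElem?_mapIdx]
  cases z[i]? with
  | none => rfl
  | some p => by_cases h : i ∈ P <;> simp [h]

theorem getElem?_of_er {x : ℕ} {y z : Word D A} (h : er x y = er x z) {i : ℕ}
    {q : D × A × Finset ℕ} (hq : y[i]? = some q) :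
    ∃ p, z[i]? = some p ∧ ∀ v, v ≠ x → (v ∈ q.2.2 ↔ v ∈ p.2.2) := by
  have h' := congrArg (fun l : Word D A => l[i]?) h
  simp only [er, List.getElem?_map, hq, Option.map_some] at h'
  cases hz : z[i]? with
  | none => simp [hz] at h'
  | some p =>
    simp only [hz, Option.map_some, Option.some.injEq, Prod.mk.injEq] at h'
    refine ⟨p, rfl, fun v hv => ?_⟩
    have := congrArg (v ∈ ·) h'.2.2
    simpa [hv] using this

theorem exists_position {B : Type*} {P : B → Bool} :
    ∀ {l : List B}, l.countP P = 1 → ∃ i < l.length, ∀ j q, l[j]? = some q → (P q ↔ j = i)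
  | [], h => by simp at h
  | b :: l, h => by
    rw [List.countP_cons] at h
    by_cases hb : P b
    · have h0 : l.countP P = 0 := by simpa [hb] using h
      rw [List.countP_eq_zero] at h0
      refine ⟨0, by simp, fun j q hj => ?_⟩
      cases j with
      | zero => simp at hj; simp [← hj, hb]
      | succ j =>
        rw [List.getElem?_cons_succ] at hj
        simp [h0 q (List.mem_of_getElem? hj)]
    · obtain ⟨i, hi, H⟩ := exists_position (l := l) (P := P) (by simpa [hb] using h)
      refine ⟨i + 1, by simpa using hi, fun j q hj => ?_⟩
      cases j with
      | zero => simp at hj; simp [← hj, hb]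
      | succ j =>
        rw [List.getElem?_cons_succ] at hj
        simp [H j q hj]

theorem countP_eq_one {B : Type*} {P : B → Bool} {l : List B} {i : ℕ} (hi : i < l.length)
    (H : ∀ j q, l[j]? = some q → (P q ↔ j = i)) : l.countP P = 1 := by
  induction l generalizing i with
  | nil => simp at hi
  | cons b l ih =>
    rw [List.countP_cons]
    cases i with
    | zero =>
      have hb : P b := (H 0 b (by simp)).2 rfl
      have h0 : l.countP P = 0 := by
        rw [List.countP_eq_zero]
        intro a ha hPa
        obtain ⟨j, hj⟩ := List.mem_iff_getElem?.1 ha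
        have := (H (j + 1) a (by simpa using hj)).1 hPa
        omega
      simp [hb, h0]
    | succ i =>
      have hb : ¬ P b := fun hb => by have := (H 0 b (by simp)).1 hb; omega
      have := ih (i := i) (by simpa using hi) fun j q hj => by
        have := H (j + 1) q (by simpa using hj)
        simpa using this
      simp [hb, this]

end Word

open Word

/-! ### Satisfaction in annotated words. -/

namespace MSO

variable {D : Type u} {A : Type v}

/-- Satisfaction in an annotated word. -/
def Holds : MSO A → Word D A → Prop
  | exFO x φ, z => ∃ y, er (2 * x) y = er (2 * x) z ∧ cnt (2 * x) y = 1 ∧ Holds φ y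
  | exSO X φ, z => ∃ y, er (2 * X + 1) y = er (2 * X + 1) z ∧ Holds φ y
  | letter a x, z => ∃ p ∈ z, 2 * x ∈ p.2.2 ∧ p.2.1 = a
  | lt x y, z => ∃ z₁ z₂, z = z₁ ++ z₂ ∧ 0 < cnt (2 * x) z₁ ∧ 0 < cnt (2 * y) z₂
  | mem x X, z => ∃ p ∈ z, 2 * x ∈ p.2.2 ∧ 2 * X + 1 ∈ p.2.2
  | sim x y, z => ∃ p ∈ z, ∃ q ∈ z, 2 * x ∈ p.2.2 ∧ 2 * y ∈ q.2.2 ∧ p.1 = q.1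
  | neg φ, z => ¬ Holds φ z
  | conj φ ψ, z => Holds φ z ∧ Holds ψ z

/-- A quantifier over values corresponds to a change of the annotation at one variable, which leaves
the marks of all others in place. The hypotheses concern free variables only, because a bound
variable may carry arbitrary marks before its quantifier overwrites them. -/
theorem sat_iff_holds (φ : MSO A) : ∀ (z : Word D A) (ν : ℕ → ℕ) (μ : ℕ → Finset ℕ),
    (∀ x, Sum.inl x ∈ φ.freeVars → ν x < z.length ∧
      ∀ i p, z[i]? = some p → (2 * x ∈ p.2.2 ↔ i = ν x)) →
    (∀ X, Sum.inr X ∈ φ.freeVars → ∀ i p, z[i]? = some p → (2 * X + 1 ∈ p.2.2 ↔ i ∈ μ X)) →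
    (Sat (base z) φ ν μ ↔ Holds φ z) := by
  induction φ with
  | exFO x φ ih =>
    intro z ν μ hν hμ
    simp only [freeVars, Finset.mem_erase] at hν hμ
    constructor
    · rintro ⟨p, hp, hs⟩
      rw [length_base] at hp
      have he := er_setAt (2 * x) {p} z
      have hpos : ∀ i q, (setAt (2 * x) {p} z)[i]? = some q → (2 * x ∈ q.2.2 ↔ i = p) := by
        intro i q hq
        simp only [setAt, List.getElem?_mapIdx, Option.map_eq_some_iff] at hq
        obtain ⟨r, -, rfl⟩ := hq
        by_cases h : i = p <;> simp [h]
      refine ⟨setAt (2 * x) {p} z, he, ?_, ?_⟩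
      · refine countP_eq_one (i := p) (by rw [length_eq_of_er he]; exact hp) fun j q hj => ?_
        simpa using hpos j q hj
      · rw [← base_eq_of_er he] at hs
        refine (ih _ _ _ ?_ ?_).1 hs
        · intro x' hx'
          by_cases h : x' = x
          · subst h
            simp only [Function.update_self]
            exact ⟨by rw [length_eq_of_er he]; exact hp, hpos⟩
          · simp only [Function.update_of_ne h]
            obtain ⟨h1, h2⟩ := hν x' ⟨by simpa using h, hx'⟩
            refine ⟨by rw [length_eq_of_er he]; exact h1, fun i q hq => ?_⟩
            obtain ⟨r, hr, H⟩ := getElem?_of_er he hq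
            rw [H _ (by omega), h2 i r hr]
        · intro X hX i q hq
          obtain ⟨r, hr, H⟩ := getElem?_of_er he hq
          rw [H _ (by omega), hμ X ⟨by simp, hX⟩ i r hr]
    · rintro ⟨y, he, hc, hs⟩
      obtain ⟨p, hp, H⟩ := exists_position hc
      rw [length_eq_of_er he] at hp
      refine ⟨p, by simpa using hp, ?_⟩
      rw [← base_eq_of_er he]
      refine (ih y _ _ ?_ ?_).2 hs
      · intro x' hx'
        by_cases h : x' = x
        · subst h
          simp only [Function.update_self]
          exact ⟨by rw [length_eq_of_er he]; exact hp, fun i q hq => by simpa using H i q hq⟩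
        · simp only [Function.update_of_ne h]
          obtain ⟨h1, h2⟩ := hν x' ⟨by simpa using h, hx'⟩
          refine ⟨by rw [length_eq_of_er he]; exact h1, fun i q hq => ?_⟩
          obtain ⟨r, hr, H⟩ := getElem?_of_er he hq
          rw [H _ (by omega), h2 i r hr]
      · intro X hX i q hq
        obtain ⟨r, hr, H⟩ := getElem?_of_er he hq
        rw [H _ (by omega), hμ X ⟨by simp, hX⟩ i r hr]
  | exSO X φ ih =>
    intro z ν μ hν hμ
    simp only [freeVars, Finset.mem_erase] at hν hμ
    have key : ∀ (U : Finset ℕ) (y : Word D A), er (2 * X + 1) y = er (2 * X + 1) z →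
        (∀ i q, y[i]? = some q → (2 * X + 1 ∈ q.2.2 ↔ i ∈ U)) →
        (Sat (base z) φ ν (Function.update μ X U) ↔ Holds φ y) := by
      intro U y he hU
      rw [← base_eq_of_er he]
      refine ih y _ _ ?_ ?_
      · intro x hx
        obtain ⟨h1, h2⟩ := hν x ⟨by simp, hx⟩
        refine ⟨by rw [length_eq_of_er he]; exact h1, fun i q hq => ?_⟩
        obtain ⟨r, hr, H⟩ := getElem?_of_er he hq
        rw [H _ (by omega), h2 i r hr]
      · intro X' hX'
        by_cases h : X' = X
        · subst h
          simpa only [Function.update_self] using hU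
        · simp only [Function.update_of_ne h]
          intro i q hq
          obtain ⟨r, hr, H⟩ := getElem?_of_er he hq
          rw [H _ (by omega), hμ X' ⟨by simpa using h, hX'⟩ i r hr]
    constructor
    · rintro ⟨U, -, hs⟩
      refine ⟨setAt (2 * X + 1) U z, er_setAt _ _ _, (key U _ (er_setAt _ _ _) ?_).1 hs⟩
      intro i q hq
      simp only [setAt, List.getElem?_mapIdx, Option.map_eq_some_iff] at hq
      obtain ⟨r, -, rfl⟩ := hq
      by_cases h : i ∈ U <;> simp [h]
    -- The value of the set variable is read off from the marks in `y`.
    · rintro ⟨y, he, hs⟩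
      classical
      refine ⟨(Finset.range z.length).filter fun i => ∃ q, y[i]? = some q ∧ 2 * X + 1 ∈ q.2.2,
        by simp [length_base], (key _ y he ?_).2 hs⟩
      intro i q hq
      have : i < z.length := by
        rw [← length_eq_of_er he]; exact (List.getElem?_eq_some_iff.1 hq).1
      simp only [Finset.mem_filter, Finset.mem_range, this, hq, Option.some.injEq, true_and,
        exists_eq_left']
  | letter a x =>
    intro z ν μ hν hμ
    obtain ⟨h1, h2⟩ := hν x (by simp [freeVars])
    simp only [Sat, Holds, base, List.getElem?_map]
    constructor
    · rintro ⟨d, hd⟩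
      obtain ⟨p, hp, he⟩ := Option.map_eq_some_iff.1 hd
      exact ⟨p, List.mem_of_getElem? hp, (h2 _ p hp).2 rfl, by simpa using congrArg Prod.snd he⟩
    · rintro ⟨p, hp, hx, ha⟩
      obtain ⟨i, hi⟩ := List.mem_iff_getElem?.1 hp
      obtain rfl := (h2 i p hi).1 hx
      exact ⟨p.1, by simp [hi, ha]⟩
  | lt x y =>
    intro z ν μ hν hμ
    obtain ⟨h1, h2⟩ := hν x (by simp [freeVars])
    obtain ⟨h3, h4⟩ := hν y (by simp [freeVars])
    simp only [Sat, Holds, cnt_pos]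
    constructor
    · intro h
      -- The cut is made just before the position of `y`, which becomes the head of the second part.
      refine ⟨z.take (ν y), z.drop (ν y), by simp, ⟨z[ν x], ?_, ?_⟩, z[ν y], ?_, ?_⟩
      · exact List.mem_iff_getElem?.2 ⟨ν x, by simp [h]⟩
      · exact (h2 (ν x) _ (by simp)).2 rfl
      · exact List.mem_iff_getElem?.2 ⟨0, by simp⟩
      · exact (h4 (ν y) _ (by simp)).2 rfl
    · rintro ⟨z₁, z₂, rfl, ⟨p, hp, hxp⟩, q, hq, hyq⟩
      obtain ⟨i, hi⟩ := List.mem_iff_getElem?.1 hp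
      obtain ⟨j, hj⟩ := List.mem_iff_getElem?.1 hq
      have hil := (List.getElem?_eq_some_iff.1 hi).1
      have e1 := (h2 i p (by rw [List.getElem?_append_left hil]; exact hi)).1 hxp
      have e2 := (h4 (z₁.length + j) q (by simpa [List.getElem?_append_right] using hj)).1 hyq
      omega
  | mem x X =>
    intro z ν μ hν hμ
    obtain ⟨h1, h2⟩ := hν x (by simp [freeVars])
    have h3 := hμ X (by simp [freeVars])
    simp only [Sat, Holds]
    constructor
    · intro h
      exact ⟨z[ν x], by simp, (h2 (ν x) _ (by simp)).2 rfl, (h3 (ν x) _ (by simp)).2 h⟩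
    · rintro ⟨p, hp, hx, hX⟩
      obtain ⟨i, hi⟩ := List.mem_iff_getElem?.1 hp
      obtain rfl := (h2 i p hi).1 hx
      exact (h3 _ p hi).1 hX
  | sim x y =>
    intro z ν μ hν hμ
    obtain ⟨h1, h2⟩ := hν x (by simp [freeVars])
    obtain ⟨h3, h4⟩ := hν y (by simp [freeVars])
    simp only [Sat, Holds, base, List.getElem?_map]
    constructor
    · rintro ⟨d, a, b, hx, hy⟩
      obtain ⟨p, hp, he⟩ := Option.map_eq_some_iff.1 hx
      obtain ⟨q, hq, hf⟩ := Option.map_eq_some_iff.1 hy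
      refine ⟨p, List.mem_of_getElem? hp, q, List.mem_of_getElem? hq, (h2 _ p hp).2 rfl,
        (h4 _ q hq).2 rfl, ?_⟩
      rw [congrArg Prod.fst he, congrArg Prod.fst hf]
    · rintro ⟨p, hp, q, hq, hx, hy, he⟩
      obtain ⟨i, hi⟩ := List.mem_iff_getElem?.1 hp
      obtain ⟨j, hj⟩ := List.mem_iff_getElem?.1 hq
      obtain rfl := (h2 i p hi).1 hx
      obtain rfl := (h4 j q hj).1 hy
      exact ⟨p.1, p.2.1, q.2.1, by simp [hi], by simp [hj, he]⟩
  | neg φ ih =>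
    intro z ν μ hν hμ
    simp only [Sat, Holds]
    exact not_congr (ih z ν μ hν hμ)
  | conj φ ψ ih₁ ih₂ =>
    intro z ν μ hν hμ
    simp only [freeVars, Finset.mem_union] at hν hμ
    simp only [Sat, Holds]
    exact and_congr (ih₁ z ν μ (fun x h => hν x (Or.inl h)) fun X h => hμ X (Or.inl h))
      (ih₂ z ν μ (fun x h => hν x (Or.inr h)) fun X h => hμ X (Or.inr h))

/-- Satisfaction is invariant under injective renamings. -/
theorem holds_ren {D' : Type*} {g : D → D'} (hg : Function.Injective g) (φ : MSO A) :
    ∀ z : Word D A, Holds φ (ren g z) ↔ Holds φ z := by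
  induction φ with
  | exFO x φ ih =>
    intro z
    constructor
    · rintro ⟨y, he, hc, hs⟩
      obtain ⟨y', rfl, he'⟩ := exists_of_er_ren _ he
      exact ⟨y', he', by rwa [cnt_ren] at hc, (ih y').1 hs⟩
    · rintro ⟨y, he, hc, hs⟩
      exact ⟨ren g y, by rw [er_ren, er_ren, he], by rwa [cnt_ren], (ih y).2 hs⟩
  | exSO X φ ih =>
    intro z
    constructor
    · rintro ⟨y, he, hs⟩
      obtain ⟨y', rfl, he'⟩ := exists_of_er_ren _ he
      exact ⟨y', he', (ih y').1 hs⟩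
    · rintro ⟨y, he, hs⟩
      exact ⟨ren g y, by rw [er_ren, er_ren, he], (ih y).2 hs⟩
  | letter a x => intro z; simp only [Holds, exists_mem_ren]
  | lt x y =>
    intro z
    constructor
    · rintro ⟨z₁, z₂, he, h1, h2⟩
      obtain ⟨y₁, y₂, rfl, rfl, rfl⟩ := List.map_eq_append_iff.1 he
      exact ⟨y₁, y₂, rfl, by rwa [← cnt_ren g], by rwa [← cnt_ren g]⟩
    · rintro ⟨z₁, z₂, rfl, h1, h2⟩
      exact ⟨ren g z₁, ren g z₂, by simp, by rwa [cnt_ren], by rwa [cnt_ren]⟩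
  | mem x X => intro z; simp only [Holds, exists_mem_ren]
  | sim x y => intro z; simp only [Holds, exists_mem_ren, hg.eq_iff]
  | neg φ ih => intro z; exact not_congr (ih z)
  | conj φ ψ ih₁ ih₂ => intro z; exact and_congr (ih₁ z) (ih₂ z)

end MSO

/-! ## The congruence of a formula -/

namespace Word

variable {D : Type u} {A : Type v}

/-- The values of the variables below `V` have the same cardinality, up to the threshold two. -/
def CountEq (V : ℕ) (z z' : Word D A) : Prop :=
  ∀ x < V, min 2 (cnt x z) = min 2 (cnt x z')

/-- The data values of the positions in the value of the variable `x`. -/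
def data (x : ℕ) (z : Word D A) : Set D := {d | ∃ p ∈ z, x ∈ p.2.2 ∧ p.1 = d}

/-- `y` is a variant of `z` at the variable `x`, whose value in `y` has at most one element if `b`
is set. -/
def Variant (b : Bool) (x : ℕ) (z y : Word D A) : Prop :=
  er x y = er x z ∧ (b = true → cnt x y ≤ 1)

/-- The variants of `z` and those of `z'` are the same up to `E`. -/
def Lift (b : Bool) (x : ℕ) (E : Word D A → Word D A → Prop) (z z' : Word D A) : Prop :=
  (∀ y, Variant b x z y → ∃ y', Variant b x z' y' ∧ E y y') ∧
  (∀ y', Variant b x z' y' → ∃ y, Variant b x z y ∧ E y y')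

/-- Projectable equivariant monoid congruences that preserve the cardinalities of the values of the
variables below `V`. -/
structure Nice (V : ℕ) (E : Word D A → Word D A → Prop) : Prop where
  refl : ∀ z, E z z
  symm : ∀ {z z'}, E z z' → E z' z
  trans : ∀ {z z' z''}, E z z' → E z' z'' → E z z''
  append : ∀ {y y' z z'}, E y y' → E z z' → E (y ++ z) (y' ++ z')
  ren : ∀ (g : Equiv.Perm D) {z z'}, E z z' → E (ren g z) (ren g z')
  count : ∀ {z z'}, E z z' → CountEq V z z'
  proj : ∀ (g : Equiv.Perm D) {z y}, base z = base y → E (_root_.ren g z) y → E z y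

/-- Truncation at two is compatible with addition, and renamings do not change cardinalities.
Threshold two is the least one that recognizes singletons, the values of first-order variables. -/
theorem CountEq.nice (V : ℕ) : Nice V (CountEq V : Word D A → Word D A → Prop) where
  refl _ _ _ := rfl
  symm h x hx := (h x hx).symm
  trans h h' x hx := (h x hx).trans (h' x hx)
  append h h' x hx := by
    have h1 := h x hx
    have h2 := h' x hx
    simp only [cnt_append]
    omega
  ren g _ _ h x hx := by simpa only [cnt_ren] using h x hx
  count h := h
  proj g z y _ h x hx := by simpa only [cnt_ren] using h x hx

theorem CountEq.eq_one {V x : ℕ} {z z' : Word D A} (h : CountEq V z z') (hx : x < V)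
    (hz : cnt x z = 1) : cnt x z' = 1 := by
  have := h x hx
  omega

theorem CountEq.eq_zero {V x : ℕ} {z z' : Word D A} (h : CountEq V z z') (hx : x < V)
    (hz : cnt x z = 0) : cnt x z' = 0 := by
  have := h x hx
  omega

theorem Nice.and {V : ℕ} {E E' : Word D A → Word D A → Prop} (h : Nice V E) (h' : Nice V E') :
    Nice V fun z z' => E z z' ∧ E' z z' where
  refl z := ⟨h.refl z, h'.refl z⟩
  symm H := ⟨h.symm H.1, h'.symm H.2⟩
  trans H H' := ⟨h.trans H.1 H'.1, h'.trans H.2 H'.2⟩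
  append H H' := ⟨h.append H.1 H'.1, h'.append H.2 H'.2⟩
  ren g _ _ H := ⟨h.ren g H.1, h'.ren g H.2⟩
  count H := h.count H.1
  proj g _ _ hb H := ⟨h.proj g hb H.1, h'.proj g hb H.2⟩

theorem variant_self_ren {D' : Type*} {b : Bool} {x : ℕ} {z y : Word D A} (g : D → D') (h : Variant b x z y) :
    Variant b x (ren g z) (ren g y) :=
  ⟨by rw [er_ren, er_ren, h.1], by rw [cnt_ren]; exact h.2⟩

theorem variant_of_ren {D' : Type*} {b : Bool} {x : ℕ} {z : Word D A} {y : Word D' A} {g : D → D'}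
    (h : Variant b x (ren g z) y) : ∃ y', y = ren g y' ∧ Variant b x z y' := by
  obtain ⟨y', rfl, he⟩ := exists_of_er_ren _ h.1
  exact ⟨y', rfl, he, by have := h.2; rwa [cnt_ren] at this⟩

theorem variant_of_append {b : Bool} {x : ℕ} {y z₁ z₂ : Word D A}
    (h : Variant b x (z₁ ++ z₂) y) :
    ∃ y₁ y₂, y = y₁ ++ y₂ ∧ Variant b x z₁ y₁ ∧ Variant b x z₂ y₂ := by
  obtain ⟨y₁, y₂, rfl, h₁, h₂⟩ := er_eq_append h.1
  have := h.2
  rw [cnt_append] at this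
  exact ⟨y₁, y₂, rfl, ⟨h₁, fun hb => by have := this hb; omega⟩,
    ⟨h₂, fun hb => by have := this hb; omega⟩⟩

theorem Lift.symm {V b x} {E : Word D A → Word D A → Prop} (h : Nice V E) {z z' : Word D A}
    (H : Lift b x E z z') : Lift b x E z' z :=
  ⟨fun y hy => (H.2 y hy).imp fun _ h' => ⟨h'.1, h.symm h'.2⟩,
    fun y hy => (H.1 y hy).imp fun _ h' => ⟨h'.1, h.symm h'.2⟩⟩

/-- The variants of a product are the products of variants of its factors, so matching can be done
factor by factor. For projectability, a variant of `ren g z` is the renaming of a variant of `z`,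
and the variants of `z` and of `y` have the same underlying data word; projectability of `E` removes
`g` from each matched pair. -/
theorem Nice.lift {V x : ℕ} {E : Word D A → Word D A → Prop} (h : Nice V E) (b : Bool)
    (hx : x < V) : Nice V fun z z' => CountEq V z z' ∧ Lift b x E z z' := by
  have tr : ∀ {z z' z''}, Lift b x E z z' → Lift b x E z' z'' →
      ∀ y, Variant b x z y → ∃ y', Variant b x z'' y' ∧ E y y' := by
    intro z z' z'' H H' y hy
    obtain ⟨y', hy', he⟩ := H.1 y hy
    obtain ⟨y'', hy'', he'⟩ := H'.1 y' hy'
    exact ⟨y'', hy'', h.trans he he'⟩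
  have ap : ∀ {y y' z z'}, Lift b x E y y' → Lift b x E z z' →
      ∀ t, Variant b x (y ++ z) t → ∃ t', Variant b x (y' ++ z') t' ∧ E t t' := by
    intro y y' z z' H H' t ht
    obtain ⟨t₁, t₂, rfl, h₁, h₂⟩ := variant_of_append ht
    obtain ⟨t₁', h₁', e₁⟩ := H.1 _ h₁
    obtain ⟨t₂', h₂', e₂⟩ := H'.1 _ h₂
    refine ⟨t₁' ++ t₂', ⟨by rw [er_append, er_append, h₁'.1, h₂'.1], fun hb => ?_⟩,
      h.append e₁ e₂⟩
    -- The bound by one concerns both factors together; it transfers because `E` preserves the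
    -- cardinality in each factor up to two.
    have c := ht.2 hb
    have c₁ := h.count e₁ x hx
    have c₂ := h.count e₂ x hx
    rw [cnt_append] at c ⊢
    omega
  have pr : ∀ (g : Equiv.Perm D) {z y}, base z = base y → Lift b x E (_root_.ren g z) y →
      Lift b x E z y := by
    intro g z y hb H
    refine ⟨fun t ht => ?_, fun t' ht' => ?_⟩
    · obtain ⟨t', ht', e⟩ := H.1 _ (variant_self_ren g ht)
      exact ⟨t', ht', h.proj g (by rw [base_eq_of_er ht.1, base_eq_of_er ht'.1, hb]) e⟩
    · obtain ⟨t, ht, e⟩ := H.2 _ ht'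
      obtain ⟨t, rfl, hv⟩ := variant_of_ren ht
      exact ⟨t, hv, h.proj g (by rw [base_eq_of_er hv.1, base_eq_of_er ht'.1, hb]) e⟩
  have c := CountEq.nice (D := D) (A := A) V
  refine ⟨fun z => ⟨c.refl z, fun y hy => ⟨y, hy, h.refl y⟩, fun y hy => ⟨y, hy, h.refl y⟩⟩,
    fun H => ⟨c.symm H.1, H.2.symm h⟩, fun H H' => ⟨c.trans H.1 H'.1, tr H.2 H'.2, ?_⟩,
    fun H H' => ⟨c.append H.1 H'.1, ap H.2 H'.2, ?_⟩, fun g z z' H => ⟨c.ren g H.1, ?_, ?_⟩,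
    And.left, fun g _ _ hb H => ⟨c.proj g hb H.1, pr g hb H.2⟩⟩
  · intro y hy
    obtain ⟨t, ht, e⟩ := tr (H'.2.symm h) (H.2.symm h) y hy
    exact ⟨t, ht, h.symm e⟩
  · intro y hy
    obtain ⟨t, ht, e⟩ := ap (H.2.symm h) (H'.2.symm h) y hy
    exact ⟨t, ht, h.symm e⟩
  · intro y hy
    obtain ⟨y, rfl, hv⟩ := variant_of_ren hy
    obtain ⟨t, ht, e⟩ := H.2.1 y hv
    exact ⟨_, variant_self_ren g ht, h.ren g e⟩
  · intro y hy
    obtain ⟨y, rfl, hv⟩ := variant_of_ren hy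
    obtain ⟨t, ht, e⟩ := H.2.2 y hv
    exact ⟨_, variant_self_ren g ht, h.ren g e⟩

/-- A renaming-invariant property of words whose value on a product is determined by the values on
the factors and the cardinalities of variables yields a congruence. -/
theorem nice_of_test {V : ℕ} {P : Word D A → Prop}
    (hr : ∀ (g : Equiv.Perm D) z, P (_root_.ren g z) ↔ P z)
    (ha : ∀ {y y' z z' : Word D A}, CountEq V y y' → CountEq V z z' → (P y ↔ P y') →
      (P z ↔ P z') → (P (y ++ z) → P (y' ++ z'))) :
    Nice V fun z z' => CountEq V z z' ∧ (P z ↔ P z') := by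
  have c := CountEq.nice (D := D) (A := A) V
  exact ⟨fun z => ⟨c.refl z, Iff.rfl⟩, fun H => ⟨c.symm H.1, H.2.symm⟩,
    fun H H' => ⟨c.trans H.1 H'.1, H.2.trans H'.2⟩,
    fun H H' => ⟨c.append H.1 H'.1, ha H.1 H'.1 H.2 H'.2,
      ha (c.symm H.1) (c.symm H'.1) H.2.symm H'.2.symm⟩,
    fun g _ _ H => ⟨c.ren g H.1, by rw [hr, hr]; exact H.2⟩, And.left,
    fun g _ _ hb H => ⟨c.proj g hb H.1, by rw [← hr g]; exact H.2⟩⟩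

end Word

open Word

/-! ### The recursive definition of the congruence, and its ingredients. -/

namespace MSO

variable {D : Type u} {A : Type v}

/-- `z` is a factor of a word that satisfies `φ`, where `x` and `y` are single positions. -/
def Useful (φ : MSO A) (x y : ℕ) (z : Word D A) : Prop :=
  ∃ u v, Holds φ (u ++ z ++ v) ∧ cnt (2 * x) (u ++ z ++ v) = 1 ∧ cnt (2 * y) (u ++ z ++ v) = 1

/-- The data values of `x` and `y` agree as far as these are needed for `φ ∧ x ∼ y`. -/
def Guard (φ : MSO A) (x y : ℕ) (z z' : Word D A) : Prop :=
  Useful φ x y z →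
    (cnt (2 * y) z = 0 → data (2 * x) z = data (2 * x) z') ∧
    (cnt (2 * x) z = 0 → data (2 * y) z = data (2 * y) z') ∧
    (Holds (sim x y) z ↔ Holds (sim x y) z')

/-- The congruence of a formula whose variables are below `V`. -/
def Cong (V : ℕ) : MSO A → Word D A → Word D A → Prop
  | exFO x φ, z, z' => CountEq V z z' ∧ Lift true (2 * x) (Cong V φ) z z'
  | exSO X φ, z, z' => CountEq V z z' ∧ Lift false (2 * X + 1) (Cong V φ) z z'
  | letter a x, z, z' => CountEq V z z' ∧ (Holds (letter a x) z ↔ Holds (letter a x) z')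
  | lt x y, z, z' => CountEq V z z' ∧ (Holds (lt x y) z ↔ Holds (lt x y) z')
  | mem x X, z, z' => CountEq V z z' ∧ (Holds (mem x X) z ↔ Holds (mem x X) z')
  | sim _ _, z, z' => CountEq V z z'
  | neg φ, z, z' => Cong V φ z z'
  | conj φ ψ, z, z' => (Cong V φ z z' ∧ Cong V ψ z z') ∧
      ∀ x y, ψ = sim x y → Guard φ x y z z'

/-- All variables, free or bound, are below `V`. -/
def Below (V : ℕ) : MSO A → Prop
  | exFO x φ => 2 * x < V ∧ φ.Below V
  | exSO X φ => 2 * X + 1 < V ∧ φ.Below V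
  | letter _ x => 2 * x < V
  | lt x y => 2 * x < V ∧ 2 * y < V
  | mem x X => 2 * x < V ∧ 2 * X + 1 < V
  | sim x y => 2 * x < V ∧ 2 * y < V
  | neg φ => φ.Below V
  | conj φ ψ => φ.Below V ∧ ψ.Below V

theorem Below.lt_of_free {V : ℕ} {φ : MSO A} (h : φ.Below V) :
    ∀ x, Sum.inl x ∈ φ.freeVars → 2 * x < V := by
  induction φ with
  | exFO y φ ih => intro x hx; exact ih h.2 x (Finset.mem_of_mem_erase hx)
  | exSO y φ ih => intro x hx; exact ih h.2 x (Finset.mem_of_mem_erase hx)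
  | letter a y => intro x hx; simp [freeVars] at hx; subst hx; exact h
  | lt y y' => intro x hx; simp [freeVars] at hx; rcases hx with rfl | rfl; exacts [h.1, h.2]
  | mem y Y => intro x hx; simp [freeVars] at hx; subst hx; exact h.1
  | sim y y' => intro x hx; simp [freeVars] at hx; rcases hx with rfl | rfl; exacts [h.1, h.2]
  | neg φ ih => exact ih h
  | conj φ ψ ih₁ ih₂ =>
    intro x hx
    exact (Finset.mem_union.1 hx).elim (ih₁ h.1 x) (ih₂ h.2 x)

/-- The free first-order variables are single positions. -/
def Valid (φ : MSO A) (z : Word D A) : Prop := ∀ x, Sum.inl x ∈ φ.freeVars → cnt (2 * x) z = 1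

/-- A relation on words preserves satisfaction of `φ` in words with single positions for the free
first-order variables. -/
def Preserves (φ : MSO A) (E : Word D A → Word D A → Prop) : Prop :=
  ∀ z z', E z z' → Valid φ z → Holds φ z → Holds φ z'

theorem holds_letter_append {a : A} {x : ℕ} {y z : Word D A} :
    Holds (letter a x) (y ++ z) ↔ Holds (letter a x) y ∨ Holds (letter a x) z := by
  simp only [Holds, List.mem_append, or_and_right, exists_or]

theorem holds_mem_append {x X : ℕ} {y z : Word D A} :
    Holds (mem x X) (y ++ z) ↔ Holds (mem x X) y ∨ Holds (mem x X) z := by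
  simp only [Holds, List.mem_append, or_and_right, exists_or]

/-- The cut between the two positions falls into one of the factors, or else can be moved to their
boundary; hence the truth value on a product depends only on the factors and on cardinalities. -/
theorem holds_lt_append {i j : ℕ} {y z : Word D A} :
    Holds (lt i j) (y ++ z) ↔ Holds (lt i j) y ∨ Holds (lt i j) z ∨
      (0 < cnt (2 * i) y ∧ 0 < cnt (2 * j) z) := by
  constructor
  · rintro ⟨z₁, z₂, he, h₁, h₂⟩
    obtain ⟨a, rfl, rfl⟩ | ⟨a, rfl, rfl⟩ := List.append_eq_append_iff.1 he
    · rw [cnt_append] at h₁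
      by_cases h : 0 < cnt (2 * i) y
      · exact Or.inr (Or.inr ⟨h, by rw [cnt_append]; omega⟩)
      · exact Or.inr (Or.inl ⟨a, z₂, rfl, by omega, h₂⟩)
    · rw [cnt_append] at h₂
      by_cases h : 0 < cnt (2 * j) z
      · exact Or.inr (Or.inr ⟨by rw [cnt_append]; omega, h⟩)
      · exact Or.inl ⟨z₁, a, rfl, h₁, by omega⟩
  · rintro (⟨z₁, z₂, rfl, h₁, h₂⟩ | ⟨z₁, z₂, rfl, h₁, h₂⟩ | ⟨h₁, h₂⟩)
    · exact ⟨z₁, z₂ ++ z, by simp, h₁, by rw [cnt_append]; omega⟩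
    · exact ⟨y ++ z₁, z₂, by simp, by rw [cnt_append]; omega, h₂⟩
    · exact ⟨y, z, rfl, h₁, h₂⟩

theorem data_append (x : ℕ) (y z : Word D A) : data x (y ++ z) = data x y ∪ data x z := by
  ext d
  simp only [data, List.mem_append, or_and_right, exists_or, Set.mem_union, Set.mem_ofPred_eq]

theorem data_eq_empty {x : ℕ} {z : Word D A} (h : cnt x z = 0) : data x z = ∅ := by
  rw [cnt_eq_zero] at h
  ext d
  simp only [data, Set.mem_ofPred_eq, Set.mem_empty_iff_false, iff_false]
  rintro ⟨p, hp, hx, -⟩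
  exact h p hp hx

theorem data_ren {D' : Type*} (g : D → D') (x : ℕ) (z : Word D A) : data x (ren g z) = g '' data x z := by
  ext d
  simp only [data, Set.mem_ofPred_eq, Set.mem_image]
  rw [exists_mem_ren (B := A × Finset ℕ) (P := fun p => x ∈ p.2.2 ∧ p.1 = d)]
  constructor
  · rintro ⟨p, hp, hx, rfl⟩; exact ⟨p.1, ⟨p, hp, hx, rfl⟩, rfl⟩
  · rintro ⟨_, ⟨p, hp, hx, rfl⟩, rfl⟩; exact ⟨p, hp, hx, rfl⟩

theorem holds_sim_iff {x y : ℕ} {z : Word D A} :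
    Holds (sim x y) z ↔ (data (2 * x) z ∩ data (2 * y) z).Nonempty := by
  constructor
  · rintro ⟨p, hp, q, hq, hx, hy, he⟩
    exact ⟨p.1, ⟨p, hp, hx, rfl⟩, q, hq, hy, he.symm⟩
  · rintro ⟨d, ⟨p, hp, hx, rfl⟩, q, hq, hy, he⟩
    exact ⟨p, hp, q, hq, hx, hy, he.symm⟩

/-- The other factor is absorbed into the context. -/
theorem Useful.of_append {φ : MSO A} {x y : ℕ} {z₁ z₂ : Word D A} (h : Useful φ x y (z₁ ++ z₂)) :
    Useful φ x y z₁ ∧ Useful φ x y z₂ := by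
  obtain ⟨u, v, h⟩ := h
  refine ⟨⟨u, z₂ ++ v, ?_⟩, ⟨u ++ z₁, v, ?_⟩⟩ <;> simpa only [List.append_assoc] using h

theorem useful_ren {φ : MSO A} {x y : ℕ} {z : Word D A} (g : Equiv.Perm D)
    (h : Useful φ x y z) : Useful φ x y (ren g z) := by
  obtain ⟨u, v, h⟩ := h
  refine ⟨ren g u, ren g v, ?_⟩
  rw [← ren_append, ← ren_append, holds_ren g.injective, cnt_ren, cnt_ren]
  exact h

theorem useful_ren_iff {φ : MSO A} {x y : ℕ} {z : Word D A} (g : Equiv.Perm D) :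
    Useful φ x y (ren g z) ↔ Useful φ x y z := by
  refine ⟨fun h => ?_, useful_ren g⟩
  have := useful_ren g⁻¹ h
  rw [ren_ren] at this
  rwa [← ren_id z, show (id : D → D) = ⇑g⁻¹ ∘ ⇑g by funext d; simp]

/-- The same context works, since a congruence that preserves `φ` and cardinalities may be applied
in the middle of a word. -/
theorem useful_congr {V : ℕ} {E : Word D A → Word D A → Prop} (hE : Nice V E) {φ : MSO A}
    (hφ : Preserves φ E) {x y : ℕ} (hf : φ.freeVars ⊆ {Sum.inl x, Sum.inl y}) (hx : 2 * x < V)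
    (hy : 2 * y < V) {z z' : Word D A} (he : E z z') (h : Useful φ x y z) : Useful φ x y z' := by
  obtain ⟨u, v, h, h1, h2⟩ := h
  have he' : E (u ++ z ++ v) (u ++ z' ++ v) := hE.append (hE.append (hE.refl u) he) (hE.refl v)
  refine ⟨u, v, hφ _ _ he' ?_ h, (hE.count he').eq_one hx h1, (hE.count he').eq_one hy h2⟩
  intro t ht
  have := hf ht
  simp only [Finset.mem_insert, Finset.mem_singleton, Sum.inl.injEq] at this
  rcases this with rfl | rfl
  exacts [h1, h2]

/-- In a useful product each of the two variables marks at most one position. If both marks lie in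
one factor, its third clause decides the equality test; if they lie in different factors, each
factor lacks one variable, so its data clause fixes the value of the other. -/
theorem Guard.append {V : ℕ} {φ : MSO A} {i j : ℕ} (hi : 2 * i < V) (hj : 2 * j < V)
    {y y' z z' : Word D A} (cy : CountEq V y y') (cz : CountEq V z z')
    (H : Guard φ i j y y') (H' : Guard φ i j z z') : Guard φ i j (y ++ z) (y' ++ z') := by
  intro hu
  obtain ⟨uy, uz⟩ := hu.of_append
  obtain ⟨a, b, c⟩ := H uy
  obtain ⟨a', b', c'⟩ := H' uz
  refine ⟨fun h => ?_, fun h => ?_, ?_⟩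
  · rw [cnt_append] at h
    rw [data_append, data_append, a (by omega), a' (by omega)]
  · rw [cnt_append] at h
    rw [data_append, data_append, b (by omega), b' (by omega)]
  -- The context shows that a variable marked in one factor is not marked in the other.
  · obtain ⟨u, v, -, h1, h2⟩ := hu
    simp only [cnt_append] at h1 h2
    have c1 := cy _ hi
    have c2 := cy _ hj
    have c3 := cz _ hi
    have c4 := cz _ hj
    simp only [holds_sim_iff, data_append] at c c' ⊢
    by_cases hyi : cnt (2 * i) y = 0
    · rw [data_eq_empty hyi, data_eq_empty (show cnt (2 * i) y' = 0 by omega), Set.empty_union,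
        Set.empty_union]
      by_cases hyj : cnt (2 * j) y = 0
      · rw [data_eq_empty hyj, data_eq_empty (show cnt (2 * j) y' = 0 by omega), Set.empty_union,
          Set.empty_union]
        exact c'
      · rw [data_eq_empty (show cnt (2 * j) z = 0 by omega),
          data_eq_empty (show cnt (2 * j) z' = 0 by omega), a' (by omega), b hyi]
    · rw [data_eq_empty (show cnt (2 * i) z = 0 by omega),
        data_eq_empty (show cnt (2 * i) z' = 0 by omega), Set.union_empty, Set.union_empty]
      by_cases hyj : cnt (2 * j) y = 0
      · rw [data_eq_empty hyj, data_eq_empty (show cnt (2 * j) y' = 0 by omega), Set.empty_union,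
          Set.empty_union, a hyj, b' (by omega)]
      · rw [data_eq_empty (show cnt (2 * j) z = 0 by omega),
          data_eq_empty (show cnt (2 * j) z' = 0 by omega), Set.union_empty, Set.union_empty]
        exact c

/-- Rigidity in terms of annotated words: each of the positions `x` and `y` determines the
other. -/
theorem rigid_iff_position {φ : MSO A} {x y : ℕ} (hxy : x ≠ y)
    (hf : φ.freeVars ⊆ {Sum.inl x, Sum.inl y}) (hr : Rigid D φ x y) {z z' : Word D A}
    (hb : base z = base z') (hz : Holds φ z) (hz' : Holds φ z') {p q p' q' : ℕ}
    (hp : p < z.length) (hq : q < z.length) (hp' : p' < z'.length) (hq' : q' < z'.length)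
    (Hp : ∀ i t, z[i]? = some t → (2 * x ∈ t.2.2 ↔ i = p))
    (Hq : ∀ i t, z[i]? = some t → (2 * y ∈ t.2.2 ↔ i = q))
    (Hp' : ∀ i t, z'[i]? = some t → (2 * x ∈ t.2.2 ↔ i = p'))
    (Hq' : ∀ i t, z'[i]? = some t → (2 * y ∈ t.2.2 ↔ i = q')) : p = p' ↔ q = q' := by
  have key : ∀ (z : Word D A) (p q : ℕ), p < z.length → q < z.length → Holds φ z →
      (∀ i t, z[i]? = some t → (2 * x ∈ t.2.2 ↔ i = p)) →
      (∀ i t, z[i]? = some t → (2 * y ∈ t.2.2 ↔ i = q)) → SatPair (base z) φ x y p q := by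
    intro z p q hp hq hz Hp Hq
    refine (sat_iff_holds φ z _ _ ?_ ?_).2 hz
    · intro t ht
      have := hf ht
      simp only [Finset.mem_insert, Finset.mem_singleton, Sum.inl.injEq] at this
      rcases this with rfl | rfl
      · rw [Function.update_of_ne hxy, Function.update_self]
        exact ⟨hp, Hp⟩
      · rw [Function.update_self]
        exact ⟨hq, Hq⟩
    · intro X hX
      have := hf hX
      simp at this
  have hl : z'.length = z.length := by rw [← length_base, ← hb, length_base]
  have s := key z p q hp hq hz Hp Hq
  have s' := key z' p' q' (by omega) (by omega) hz' Hp' Hq'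
  rw [← hb] at s'
  have hw : (base z).length = z.length := length_base z
  constructor
  · rintro rfl
    exact (hr (base z)).1 p q q' (by omega) (by omega) (by omega) s s'
  · rintro rfl
    exact (hr (base z)).2 p p' q (by omega) (by omega) (by omega) s s'

theorem data_eq_of_position {x : ℕ} {z : Word D A} {p : ℕ}
    (Hp : ∀ i t, z[i]? = some t → (x ∈ t.2.2 ↔ i = p)) :
    data x z = {d | (base z)[p]?.map Prod.fst = some d} := by
  ext d
  simp only [data, Set.mem_ofPred_eq, base, List.getElem?_map, Option.map_map]
  constructor
  · rintro ⟨t, ht, hx, rfl⟩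
    obtain ⟨i, hi⟩ := List.mem_iff_getElem?.1 ht
    obtain rfl := (Hp i t hi).1 hx
    simp [hi]
  · intro h
    obtain ⟨t, ht, rfl⟩ := Option.map_eq_some_iff.1 h
    exact ⟨t, List.mem_of_getElem? ht, (Hp p t ht).2 rfl, rfl⟩

end MSO

/-! ### Rigidity makes guarded equality projectable. -/

namespace MSO

variable {D : Type u} {A : Type v}

/-- The variable `y` is marked in the common context, hence at the same position of both words; by
`key` so is `x`, and the underlying data words agree. The hypothesis `key` is one half of rigidity,
stated so that the roles of the two variables can be exchanged. -/
theorem data_eq_of_count {x y : ℕ} {u v z t : Word D A} (hb : base z = base t)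
    (hx : cnt x (u ++ z ++ v) = 1) (hx' : cnt x (u ++ t ++ v) = 1)
    (hy : cnt y (u ++ z ++ v) = 1) (hy' : cnt y (u ++ t ++ v) = 1)
    (hc : cnt x z = 0 ↔ cnt x t = 0)
    (key : ∀ p q p' q' : ℕ, p < (u ++ z ++ v).length → q < (u ++ z ++ v).length →
      p' < (u ++ t ++ v).length → q' < (u ++ t ++ v).length →
      (∀ i s, (u ++ z ++ v)[i]? = some s → (x ∈ s.2.2 ↔ i = p)) →
      (∀ i s, (u ++ z ++ v)[i]? = some s → (y ∈ s.2.2 ↔ i = q)) →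
      (∀ i s, (u ++ t ++ v)[i]? = some s → (x ∈ s.2.2 ↔ i = p')) →
      (∀ i s, (u ++ t ++ v)[i]? = some s → (y ∈ s.2.2 ↔ i = q')) → q = q' → p = p')
    (h0 : cnt y z = 0) : data x z = data x t := by
  by_cases hxz : cnt x z = 0
  · rw [data_eq_empty hxz, data_eq_empty (hc.1 hxz)]
  obtain ⟨p, hp, Hp⟩ := exists_position hx
  obtain ⟨q, hq, Hq⟩ := exists_position hy
  obtain ⟨p', hp', Hp'⟩ := exists_position hx'
  obtain ⟨q', hq', Hq'⟩ := exists_position hy'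
  simp only [decide_eq_true_eq] at Hp Hq Hp' Hq'
  have hl : t.length = z.length := by rw [← length_base, ← hb, length_base]
  -- Outside the middle factor the two words coincide, as `z` and `t` have equal length; the middle
  -- factor is excluded by `h0`.
  have hqq : q = q' := by
    obtain ⟨s, hs⟩ : ∃ s, (u ++ z ++ v)[q]? = some s := ⟨_, List.getElem?_eq_getElem hq⟩
    have hys := (Hq q _ hs).2 rfl
    refine (Hq' q _ ?_).1 hys
    rw [← hs]
    by_cases h1 : q < u.length
    · simp [List.append_assoc, List.getElem?_append_left h1]
    · by_cases h2 : q < u.length + z.length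
      · exfalso
        have : s ∈ z := by
          rw [List.append_assoc, List.getElem?_append_right (by omega),
            List.getElem?_append_left (by omega)] at hs
          exact List.mem_of_getElem? hs
        exact cnt_eq_zero.1 h0 _ this hys
      · rw [List.append_assoc, List.append_assoc, List.getElem?_append_right (by omega),
          List.getElem?_append_right (by omega), List.getElem?_append_right (by omega),
          List.getElem?_append_right (by omega), hl]
  obtain rfl := key p q p' q' hp hq hp' hq' Hp Hq Hp' Hq' hqq
  -- The data values agree for the whole words; below, the contexts are removed, since the only mark
  -- of `x` lies in `z`, respectively in `t`.
  have e := (data_eq_of_position Hp).trans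
    (by rw [base_append, base_append, hb, ← base_append, ← base_append] :
      _ = {d | (base (u ++ t ++ v))[p]?.map Prod.fst = some d}) |>.trans
    (data_eq_of_position Hp').symm
  simp only [cnt_append] at hx hx'
  have hxt : cnt x t ≠ 0 := fun h => hxz (hc.2 h)
  simpa only [data_append, data_eq_empty (show cnt x u = 0 by omega),
    data_eq_empty (show cnt x v = 0 by omega), Set.empty_union, Set.union_empty] using e

/-- Usefulness is invariant under `E`, which gives symmetry and transitivity. Projectability is
where rigidity enters: the data clauses follow from `data_eq_of_count`, whatever the renaming was,
and the equality test is invariant under renamings. -/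
theorem nice_guard {V : ℕ} {E : Word D A → Word D A → Prop} (hE : Nice V E) {φ : MSO A}
    (hφ : Preserves φ E) {x y : ℕ} (hf : φ.freeVars ⊆ {Sum.inl x, Sum.inl y}) (hx : 2 * x < V)
    (hy : 2 * y < V) (hxy : x ≠ y) (hr : Rigid D φ x y) :
    Nice V fun z z' => E z z' ∧ Guard φ x y z z' where
  refl z := ⟨hE.refl z, fun _ => ⟨fun _ => rfl, fun _ => rfl, Iff.rfl⟩⟩
  symm {z z'} H := by
    refine ⟨hE.symm H.1, fun hu => ?_⟩
    obtain ⟨a, b, c⟩ := H.2 (useful_congr hE hφ hf hx hy (hE.symm H.1) hu)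
    have hc := hE.count (hE.symm H.1)
    exact ⟨fun h => (a (hc.eq_zero hy h)).symm, fun h => (b (hc.eq_zero hx h)).symm, c.symm⟩
  trans {z z' z''} H H' := by
    refine ⟨hE.trans H.1 H'.1, fun hu => ?_⟩
    obtain ⟨a, b, c⟩ := H.2 hu
    obtain ⟨a', b', c'⟩ := H'.2 (useful_congr hE hφ hf hx hy H.1 hu)
    have hc := hE.count H.1
    exact ⟨fun h => (a h).trans (a' (hc.eq_zero hy h)),
      fun h => (b h).trans (b' (hc.eq_zero hx h)), c.trans c'⟩
  append H H' := ⟨hE.append H.1 H'.1,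
    Guard.append hx hy (hE.count H.1) (hE.count H'.1) H.2 H'.2⟩
  ren g z z' H := by
    refine ⟨hE.ren g H.1, fun hu => ?_⟩
    obtain ⟨a, b, c⟩ := H.2 ((useful_ren_iff g).1 hu)
    simp only [cnt_ren, data_ren, holds_ren g.injective]
    exact ⟨fun h => by rw [a h], fun h => by rw [b h], c⟩
  count H := hE.count H.1
  proj g z t hb H := by
    have he := hE.proj g hb H.1
    refine ⟨he, fun hu => ?_⟩
    -- The data clauses compare with the renamed word and are of no use here; only the equality test
    -- is kept.
    obtain ⟨-, -, c⟩ := H.2 (useful_ren g hu)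
    rw [holds_ren g.injective] at c
    obtain ⟨u, v, hz, h1, h2⟩ := hu
    have he' : E (u ++ z ++ v) (u ++ t ++ v) :=
      hE.append (hE.append (hE.refl u) he) (hE.refl v)
    have h1' := (hE.count he').eq_one hx h1
    have h2' := (hE.count he').eq_one hy h2
    have ht : Holds φ (u ++ t ++ v) := by
      refine hφ _ _ he' (fun s hs => ?_) hz
      have := hf hs
      simp only [Finset.mem_insert, Finset.mem_singleton, Sum.inl.injEq] at this
      rcases this with rfl | rfl
      exacts [h1, h2]
    have hb' : base (u ++ z ++ v) = base (u ++ t ++ v) := by simp only [base_append, hb]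
    have hcx := hE.count he _ hx
    have hcy := hE.count he _ hy
    refine ⟨data_eq_of_count hb h1 h1' h2 h2' (by omega) ?_,
      data_eq_of_count hb h2 h2' h1 h1' (by omega) ?_, c⟩
    · intro p q p' q' hp hq hp' hq' Hp Hq Hp' Hq'
      exact (rigid_iff_position hxy hf hr hb' hz ht hp hq hp' hq' Hp Hq Hp' Hq').2
    · intro q p q' p' hq hp hq' hp' Hq Hp Hq' Hp'
      exact (rigid_iff_position hxy hf hr hb' hz ht hp hq hp' hq' Hp Hq Hp' Hq').1

/-- The guard clause of `Cong` concerns only an equality test as second conjunct, and in the grammar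
such a test never stands alone. This separates ordinary conjunctions from guarded tests. -/
theorem cong_conj_of_ne {V : ℕ} {φ ψ : MSO A} (h : ∀ x y, ψ ≠ sim x y) (z z' : Word D A) :
    Cong V (conj φ ψ) z z' ↔ Cong V φ z z' ∧ Cong V ψ z z' :=
  ⟨fun H => H.1, fun H => ⟨H, fun x y hxy => (h x y hxy).elim⟩⟩

theorem cong_conj_sim {V : ℕ} {φ : MSO A} (h : Nice V (Cong V φ : Word D A → Word D A → Prop))
    {x y : ℕ} {z z' : Word D A} :
    Cong V (conj φ (sim x y)) z z' ↔ Cong V φ z z' ∧ Guard φ x y z z' := by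
  refine ⟨fun H => ⟨H.1.1, H.2 x y rfl⟩, fun H => ⟨⟨H.1, h.count H.1⟩, ?_⟩⟩
  rintro x' y' he
  cases he
  exact H.2

/-- The congruence of a rigidly guarded formula is a projectable equivariant monoid congruence, and
it preserves satisfaction. -/
theorem RigidlyGuarded.cong {V : ℕ} {φ : MSO A} (h : RigidlyGuarded D φ) (hV : φ.Below V) :
    Nice V (Cong V φ : Word D A → Word D A → Prop) ∧
      Preserves φ (Cong V φ : Word D A → Word D A → Prop) := by
  induction h with
  | @exFO x φ _ ih =>
    obtain ⟨h1, h2⟩ := ih hV.2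
    refine ⟨h1.lift true hV.1, ?_⟩
    rintro z z' ⟨-, H, -⟩ hv ⟨y, he, hc, hy⟩
    obtain ⟨y', hy', e⟩ := H y ⟨he, fun _ => hc.le⟩
    refine ⟨y', hy'.1, (h1.count e).eq_one hV.1 hc, h2 _ _ e (fun x' hx' => ?_) hy⟩
    by_cases hx : x' = x
    · subst hx; exact hc
    · rw [cnt_eq_of_er he (by omega)]
      exact hv x' (by simp [freeVars, hx, hx'])
  | @exSO X φ _ ih =>
    obtain ⟨h1, h2⟩ := ih hV.2
    refine ⟨h1.lift false hV.1, ?_⟩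
    rintro z z' ⟨-, H, -⟩ hv ⟨y, he, hy⟩
    obtain ⟨y', hy', e⟩ := H y ⟨he, by simp⟩
    refine ⟨y', hy'.1, h2 _ _ e (fun x' hx' => ?_) hy⟩
    rw [cnt_eq_of_er he (by omega)]
    exact hv x' (by simp [freeVars, hx'])
  | letter a x =>
    refine ⟨nice_of_test (fun g z => holds_ren g.injective _ z) ?_, fun z z' H _ => H.2.1⟩
    intro y y' z z' _ _ h h'
    rw [holds_letter_append, holds_letter_append, h, h']
    exact id
  | lt x y =>
    refine ⟨nice_of_test (fun g z => holds_ren g.injective _ z) ?_, fun z z' H _ => H.2.1⟩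
    intro s s' z z' c c' h h'
    have h1 := c _ hV.1
    have h2 := c' _ hV.2
    rw [holds_lt_append, holds_lt_append, h, h',
      show (0 < cnt (2 * x) s ↔ 0 < cnt (2 * x) s') by omega,
      show (0 < cnt (2 * y) z ↔ 0 < cnt (2 * y) z') by omega]
    exact id
  | mem x X =>
    refine ⟨nice_of_test (fun g z => holds_ren g.injective _ z) ?_, fun z z' H _ => H.2.1⟩
    intro y y' z z' _ _ h h'
    rw [holds_mem_append, holds_mem_append, h, h']
    exact id
  | @neg φ _ ih =>
    obtain ⟨h1, h2⟩ := ih hV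
    -- Preservation is one-directional, so negation uses the symmetric relation, with validity
    -- carried over by the cardinalities.
    refine ⟨h1, fun z z' H hv hn hz' => hn (h2 _ _ (h1.symm H) (fun x hx => ?_) hz')⟩
    exact (h1.count H).eq_one (Below.lt_of_free (φ := φ) hV x hx) (hv x hx)
  | @conj φ ψ _ hψ ih₁ ih₂ =>
    obtain ⟨h1, h2⟩ := ih₁ hV.1
    obtain ⟨h3, h4⟩ := ih₂ hV.2
    have hne : ∀ x y, ψ ≠ sim x y := by rintro x y rfl; cases hψ
    have e : (Cong V (MSO.conj φ ψ) : Word D A → Word D A → Prop) =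
        fun z z' => Cong V φ z z' ∧ Cong V ψ z z' :=
      funext fun z => funext fun z' => propext (cong_conj_of_ne hne z z')
    rw [e]
    refine ⟨h1.and h3, fun z z' H hv hz => ⟨h2 _ _ H.1 (fun x hx => hv x ?_) hz.1,
      h4 _ _ H.2 (fun x hx => hv x ?_) hz.2⟩⟩
    · exact Finset.mem_union_left _ hx
    · exact Finset.mem_union_right _ hx
  | @guardedSim φ x y _ hxy hf hr ih =>
    obtain ⟨h1, h2⟩ := ih hV.1
    have e : (Cong V (MSO.conj φ (sim x y)) : Word D A → Word D A → Prop) =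
        fun z z' => Cong V φ z z' ∧ Guard φ x y z z' :=
      funext fun z => funext fun z' => propext (cong_conj_sim h1)
    rw [e]
    have h3 := nice_guard h1 h2 hf hV.2.1 hV.2.2 hxy hr
    refine ⟨h3, fun z z' H hv hz => ?_⟩
    have hx : cnt (2 * x) z = 1 := hv x (by simp [freeVars])
    have hy : cnt (2 * y) z = 1 := hv y (by simp [freeVars])
    -- A word that satisfies `φ` with single positions is useful with empty contexts, so its guard
    -- applies.
    refine ⟨h2 _ _ H.1 (fun t ht => hv t (Finset.mem_union_left _ ht)) hz.1,
      (H.2 ⟨[], [], ?_⟩).2.2.1 hz.2⟩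
    simpa using ⟨hz.1, hx, hy⟩

end MSO

/-! ## Aperiodicity for first-order formulas -/

namespace Word

variable {D : Type u} {A : Type v}

/-- The power of a word. -/
def rep {B : Type*} (n : ℕ) (z : List B) : List B := (List.replicate n z).flatten

@[simp] theorem rep_zero {B : Type*} (z : List B) : rep 0 z = [] := rfl

theorem rep_succ {B : Type*} (n : ℕ) (z : List B) : rep (n + 1) z = z ++ rep n z := by
  simp [rep, List.replicate_succ]

theorem rep_add {B : Type*} (m n : ℕ) (z : List B) : rep (m + n) z = rep m z ++ rep n z := by
  rw [rep, List.replicate_add, List.flatten_append, rep, rep]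

theorem cnt_rep (x n : ℕ) (z : Word D A) : cnt x (rep n z) = n * cnt x z := by
  induction n with
  | zero => simp
  | succ n ih => rw [rep_succ, cnt_append, ih]; ring

theorem er_rep (x n : ℕ) (z : Word D A) : er x (rep n z) = rep n (er x z) := by
  induction n with
  | zero => rfl
  | succ n ih => rw [rep_succ, rep_succ, er_append, ih]

/-- A variable that is marked in `z` is marked at least twice in both powers. -/
theorem countEq_rep (V : ℕ) {n : ℕ} (hn : 2 ≤ n) (z : Word D A) :
    CountEq V (rep (n + 1) z) (rep n z) := by
  intro x _
  rw [cnt_rep, cnt_rep]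
  rcases Nat.eq_zero_or_pos (cnt x z) with h | h
  · simp [h]
  · have h1 : n * 1 ≤ n * cnt x z := Nat.mul_le_mul_left n h
    have h2 : (n + 1) * 1 ≤ (n + 1) * cnt x z := Nat.mul_le_mul_left (n + 1) h
    omega

/-- At most one position is marked, so all copies but at most one are copies of `z` with the mark
erased. -/
theorem variant_rep {x m : ℕ} {z y : Word D A} (h : Variant true x (rep m z) y) :
    y = rep m (er x z) ∨ ∃ i j z₁, i + j + 1 = m ∧ er x z₁ = er x z ∧ cnt x z₁ ≤ 1 ∧
      y = rep i (er x z) ++ z₁ ++ rep j (er x z) := by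
  induction m generalizing y with
  | zero =>
    left
    have := length_eq_of_er h.1
    simpa using this
  | succ m ih =>
    rw [rep_succ] at h
    obtain ⟨y₁, y₂, rfl, h₁, h₂⟩ := variant_of_append h
    have hc := h.2 rfl
    rw [cnt_append] at hc
    by_cases h0 : cnt x y₁ = 0
    · rw [← er_eq_self h0, h₁.1]
      rcases ih h₂ with rfl | ⟨i, j, z₁, hm, he, hz, rfl⟩
      · exact Or.inl (rep_succ _ _).symm
      · exact Or.inr ⟨i + 1, j, z₁, by omega, he, hz, by simp [rep_succ]⟩
    · right
      refine ⟨0, m, y₁, by omega, h₁.1, by omega, ?_⟩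
      rw [rep_zero, List.nil_append, ← er_rep, ← h₂.1, er_eq_self (by omega)]

theorem variant_rep_er (x m : ℕ) (z : Word D A) :
    Variant true x (rep m z) (rep m (er x z)) := by
  refine ⟨by rw [er_rep, er_rep, er_er], fun _ => ?_⟩
  rw [cnt_rep, cnt_er_self]
  omega

theorem variant_rep_mid {x i j m : ℕ} {z z₁ : Word D A} (hm : i + j + 1 = m)
    (he : er x z₁ = er x z) (hz : cnt x z₁ ≤ 1) :
    Variant true x (rep m z) (rep i (er x z) ++ z₁ ++ rep j (er x z)) := by
  refine ⟨?_, fun _ => ?_⟩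
  · rw [← hm, show i + j + 1 = i + 1 + j by omega, rep_add, rep_add]
    simp only [er_append, er_rep, er_er, he, rep_succ, rep_zero, List.append_nil]
  · simpa [cnt_rep, cnt_er_self] using hz

end Word

namespace MSO

variable {D : Type u} {A : Type v}

/-- Two copies suffice: `x` is taken from the first and `y` from the second, whatever their order in
`z`. -/
theorem holds_lt_rep {x y n : ℕ} (hn : 2 ≤ n) (z : Word D A) :
    Holds (lt x y) (rep n z) ↔ 0 < cnt (2 * x) z ∧ 0 < cnt (2 * y) z := by
  obtain ⟨k, rfl⟩ : ∃ k, n = k + 2 := ⟨n - 2, by omega⟩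
  constructor
  · rintro ⟨z₁, z₂, he, h₁, h₂⟩
    have hx := cnt_rep (2 * x) (k + 2) z
    have hy := cnt_rep (2 * y) (k + 2) z
    rw [he, cnt_append] at hx hy
    constructor
    · by_contra h
      rw [show cnt (2 * x) z = 0 by omega] at hx
      omega
    · by_contra h
      rw [show cnt (2 * y) z = 0 by omega] at hy
      omega
  · rintro ⟨h₁, h₂⟩
    rw [rep_succ, holds_lt_append]
    refine Or.inr (Or.inr ⟨h₁, ?_⟩)
    rw [rep_succ, cnt_append]
    omega

theorem holds_letter_rep {a : A} {x n : ℕ} (hn : 1 ≤ n) (z : Word D A) :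
    Holds (letter a x) (rep n z) ↔ Holds (letter a x) z := by
  induction n, hn using Nat.le_induction with
  | base => simp [rep_succ]
  | succ n _ ih => rw [rep_succ, holds_letter_append, ih, or_self]

theorem not_useful_rep {φ : MSO A} {x y n : ℕ} (hn : 2 ≤ n) {z : Word D A}
    (h : cnt (2 * x) z ≠ 0 ∨ cnt (2 * y) z ≠ 0) : ¬ Useful φ x y (rep n z) := by
  rintro ⟨u, v, -, h1, h2⟩
  simp only [cnt_append, cnt_rep] at h1 h2
  rcases h with h | h
  · have := Nat.mul_le_mul hn (Nat.one_le_iff_ne_zero.2 h)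
    omega
  · have := Nat.mul_le_mul hn (Nat.one_le_iff_ne_zero.2 h)
    omega

/-- The congruence of a rigidly guarded first-order formula is aperiodic. -/
theorem RigidlyGuarded.cong_rep {V : ℕ} {φ : MSO A} (h : RigidlyGuarded D φ) (hV : φ.Below V)
    (hF : φ.IsFO) (z : Word D A) : ∃ N, ∀ n ≥ N, Cong V φ (rep (n + 1) z) (rep n z) := by
  induction h generalizing z with
  | @exFO x φ hφ ih =>
    have hE := (hφ.cong hV.2).1
    obtain ⟨N, hN⟩ := ih hV.2 hF (er (2 * x) z)
    -- With `i` and `j` unmarked copies on the two sides of the marked one, this threshold makes one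
    -- side long enough for the induction hypothesis to remove a copy, or, in the other direction,
    -- to add one.
    refine ⟨2 * N + 2, fun n hn => ⟨countEq_rep V (by omega) z, fun y hy => ?_, fun y hy => ?_⟩⟩
    · rcases variant_rep hy with rfl | ⟨i, j, z₁, hm, he, hz, rfl⟩
      · exact ⟨_, variant_rep_er _ _ _, hN n (by omega)⟩
      · by_cases hi : N < i
        · obtain ⟨i, rfl⟩ : ∃ k, i = k + 1 := ⟨i - 1, by omega⟩
          exact ⟨_, variant_rep_mid (i := i) (j := j) (by omega) he hz,
            hE.append (hE.append (hN i (by omega)) (hE.refl _)) (hE.refl _)⟩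
        · obtain ⟨j, rfl⟩ : ∃ k, j = k + 1 := ⟨j - 1, by omega⟩
          exact ⟨_, variant_rep_mid (i := i) (j := j) (by omega) he hz,
            hE.append (hE.refl _) (hN j (by omega))⟩
    · rcases variant_rep hy with rfl | ⟨i, j, z₁, hm, he, hz, rfl⟩
      · exact ⟨_, variant_rep_er _ _ _, hN n (by omega)⟩
      · by_cases hi : N ≤ i
        · exact ⟨_, variant_rep_mid (i := i + 1) (j := j) (by omega) he hz,
            hE.append (hE.append (hN i hi) (hE.refl _)) (hE.refl _)⟩
        · exact ⟨_, variant_rep_mid (i := i) (j := j + 1) (by omega) he hz,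
            hE.append (hE.refl _) (hN j (by omega))⟩
  | exSO => exact hF.elim
  | letter a x =>
    refine ⟨2, fun n hn => ⟨countEq_rep V hn z, ?_⟩⟩
    rw [holds_letter_rep (by omega), holds_letter_rep (by omega)]
  | lt x y =>
    refine ⟨2, fun n hn => ⟨countEq_rep V hn z, ?_⟩⟩
    rw [holds_lt_rep (by omega), holds_lt_rep (by omega)]
  | mem => exact hF.elim
  | neg _ ih => exact ih hV hF z
  | @conj φ ψ _ hψ ih₁ ih₂ =>
    obtain ⟨N₁, h₁⟩ := ih₁ hV.1 hF.1 z
    obtain ⟨N₂, h₂⟩ := ih₂ hV.2 hF.2 z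
    refine ⟨max N₁ N₂, fun n hn => (cong_conj_of_ne ?_ _ _).2
      ⟨h₁ n (le_trans (le_max_left _ _) hn), h₂ n (le_trans (le_max_right _ _) hn)⟩⟩
    rintro x y rfl
    cases hψ
  | @guardedSim φ x y _ hxy hf hr ih =>
    obtain ⟨N, hN⟩ := ih hV.1 hF.1 z
    refine ⟨N + 2, fun n hn => ⟨⟨hN n (by omega), countEq_rep V (by omega) z⟩, ?_⟩⟩
    intro x' y' he hu
    cases he
    by_cases h : cnt (2 * x) z ≠ 0 ∨ cnt (2 * y) z ≠ 0
    · exact (not_useful_rep (by omega) h hu).elim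
    -- Neither variable occurs in `z`, so all data sets are empty and the guard is trivial.
    · push Not at h
      have hx : ∀ m, data (2 * x) (rep m z) = ∅ := fun m =>
        data_eq_empty (by rw [cnt_rep, h.1, mul_zero])
      have hy : ∀ m, data (2 * y) (rep m z) = ∅ := fun m =>
        data_eq_empty (by rw [cnt_rep, h.2, mul_zero])
      simp only [holds_sim_iff, hx, hy, implies_true, and_self]

end MSO

/-! ## Orbits are described by finitely many data values -/

/-- An injection of a finite set extends to a permutation. -/
theorem exists_perm_of_injOn {D : Type*} {s : Set D} (hs : s.Finite) {f : D → D}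
    (hf : Set.InjOn f s) : ∃ g : Equiv.Perm D, ∀ d ∈ s, g d = f d := by
  obtain ⟨n, ⟨e⟩⟩ : ∃ n, Nonempty (s ≃ Fin n) := by
    have := hs.to_subtype
    exact Finite.exists_equiv_fin s
  have h := Equiv.Perm.isMultiplyPretransitive D n
  obtain ⟨g, hg⟩ := h.exists_smul_eq
    (⟨fun i => (e.symm i : D), Subtype.val_injective.comp e.symm.injective⟩ : Fin n ↪ D)
    (⟨fun i => f (e.symm i), fun i j hij => e.symm.injective
      (Subtype.ext (hf (e.symm i).2 (e.symm j).2 hij))⟩ : Fin n ↪ D)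
  refine ⟨g, fun d hd => ?_⟩
  have := DFunLike.congr_fun hg (e ⟨d, hd⟩)
  change g (e.symm (e ⟨d, hd⟩) : D) = f (e.symm (e ⟨d, hd⟩)) at this
  rwa [e.symm_apply_apply] at this

/-- Equal patterns of equalities make the assignment of the values of `f'` to those of `f` well
defined and injective on a finite set, and it extends to a permutation. -/
theorem exists_perm_of_options {D ι : Type*} [Finite ι] {f f' : ι → Option D}
    (h : ∀ i j, f i = f j ↔ f' i = f' j) (hs : ∀ i, (f i).isSome = (f' i).isSome) :
    ∃ g : Equiv.Perm D, ∀ i, (f i).map g = f' i := by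
  classical
  let s : Set D := {d | ∃ i, f i = some d}
  have hsf : s.Finite := by
    refine ((Set.finite_range f).preimage (Option.some_injective D).injOn).subset ?_
    rintro d ⟨i, hi⟩
    exact ⟨i, hi⟩
  -- By the equality pattern the choice of the index is immaterial; the default values are never met
  -- on `s`.
  let F : D → D := fun d => if hd : ∃ i, f i = some d then (f' hd.choose).getD d else d
  have hF : ∀ i d, f i = some d → f' i = some (F d) := by
    intro i d hi
    have hd : ∃ i, f i = some d := ⟨i, hi⟩
    have e : f' hd.choose = f' i := (h _ _).1 (hd.choose_spec.trans hi.symm)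
    simp only [F, dif_pos hd, e]
    have := hs i
    rw [hi] at this
    obtain ⟨d', hd'⟩ := Option.isSome_iff_exists.1 this.symm
    simp [hd']
  obtain ⟨g, hg⟩ := exists_perm_of_injOn (f := F) hsf (by
    rintro d ⟨i, hi⟩ d' ⟨j, hj⟩ he
    have : f i = f j := (h i j).2 (by rw [hF i d hi, hF j d' hj, he])
    rw [hi, hj] at this
    exact Option.some_injective _ this)
  refine ⟨g, fun i => ?_⟩
  cases hi : f i with
  | none =>
    have := hs i
    rw [hi, Option.isSome_none] at this
    exact (Option.not_isSome_iff_eq_none.1 (by simp [← this])).symm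
  | some d => rw [Option.map_some, hg d ⟨i, hi⟩, hF i d hi]

/-! ### Types with finitely many data values, and short representatives. -/

namespace Word

variable {D : Type u} {A : Type v}

/-- Up to `E`, a word is determined by one of `n` types and by at most `n` data values. -/
def MemCode (E : Word D A → Word D A → Prop) (n : ℕ) : Prop :=
  ∃ (t : Word D A → Fin n) (δ : Word D A → Fin n → Option D), ∀ z z' (g : Equiv.Perm D),
    t z = t z' → (∀ i, (δ z i).map g = δ z' i) → E (ren g z) z'

theorem MemCode.of_fintype {E : Word D A → Word D A → Prop} {n : ℕ} {κ ι : Type*} [Fintype κ]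
    [Fintype ι] (hκ : Fintype.card κ ≤ n) (hι : Fintype.card ι ≤ n) (t : Word D A → κ)
    (δ : Word D A → ι → Option D) (H : ∀ z z' (g : Equiv.Perm D),
      t z = t z' → (∀ i, (δ z i).map g = δ z' i) → E (ren g z) z') : MemCode E n := by
  obtain ⟨a⟩ : Nonempty (κ ↪ Fin n) := Function.Embedding.nonempty_of_card_le (by simpa using hκ)
  obtain ⟨b⟩ : Nonempty (ι ↪ Fin n) := Function.Embedding.nonempty_of_card_le (by simpa using hι)
  refine ⟨fun z => a (t z), fun z => Function.extend b (δ z) fun _ => none,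
    fun z z' g ht hδ => H z z' g (a.injective ht) fun i => ?_⟩
  simpa [b.injective.extend_apply] using hδ (b i)

/-- The orbit types of a type and `n` data values. -/
abbrev Prof (n : ℕ) := Fin n × (Fin n → Fin n → Bool) × (Fin n → Bool)

/-- The number of orbit types. -/
def profCard (n : ℕ) : ℕ := n * ((2 ^ n) ^ n * 2 ^ n)

theorem card_prof (n : ℕ) : Fintype.card (Prof n) = profCard n := by
  simp [Prof, profCard]

/-- The type, the equality pattern of the data values and the places where they are defined decide
whether some renaming relates two words. The code itself is retained alongside, because
`MemCode.lift` has to match words by a renaming given in advance. -/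
theorem MemCode.exists_prof {E : Word D A → Word D A → Prop} {n : ℕ} (h : MemCode E n) :
    ∃ (t : Word D A → Fin n) (δ : Word D A → Fin n → Option D) (π : Word D A → Prof n),
      (∀ z z' (g : Equiv.Perm D), t z = t z' → (∀ i, (δ z i).map g = δ z' i) → E (ren g z) z') ∧
      (∀ z z', π z = π z' →
        t z = t z' ∧ ∃ g : Equiv.Perm D, ∀ i, (δ z i).map g = δ z' i) := by
  classical
  obtain ⟨t, δ, H⟩ := h
  refine ⟨t, δ, fun z => (t z, fun i j => decide (δ z i = δ z j), fun i => (δ z i).isSome), H, ?_⟩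
  intro z z' he
  simp only [Prod.mk.injEq] at he
  obtain ⟨h1, h2, h3⟩ := he
  refine ⟨h1, exists_perm_of_options (fun i j => ?_) fun i => congrFun h3 i⟩
  simpa using congrFun (congrFun h2 i) j

theorem MemCode.orbit {E : Word D A → Word D A → Prop} {n : ℕ} (h : MemCode E n) :
    ∃ π : Word D A → Prof n, ∀ z z', π z = π z' → ∃ g : Equiv.Perm D, E (ren g z) z' := by
  obtain ⟨t, δ, π, H, hπ⟩ := h.exists_prof
  refine ⟨π, fun z z' he => ?_⟩
  obtain ⟨h1, g, hg⟩ := hπ z z' he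
  exact ⟨g, H z z' g h1 hg⟩

/-- Every word is congruent to a short word over the same letters. -/
theorem Nice.exists_short {V : ℕ} {E : Word D A → Word D A → Prop} (hE : Nice V E) {n : ℕ}
    (h : MemCode E n) (z : Word D A) :
    ∃ z', E z z' ∧ z'.length ≤ profCard n ∧ ∀ p' ∈ z', ∃ p ∈ z, p.2 = p'.2 := by
  obtain ⟨π, hπ⟩ := h.orbit
  induction hl : z.length using Nat.strong_induction_on generalizing z with
  | _ l ih =>
  by_cases hle : z.length ≤ profCard n
  · exact ⟨z, hE.refl z, hle, fun p hp => ⟨p, hp, rfl⟩⟩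
  -- Among `profCard n + 1` prefixes two have the same profile; the longer one is replaced by a
  -- renaming of the shorter one, which shortens the word and adds no letters.
  obtain ⟨i, j, hij, he⟩ : ∃ i j : Fin (profCard n + 1), i < j ∧ π (z.take i) = π (z.take j) := by
    obtain ⟨i, j, hne, he⟩ := Fintype.exists_ne_map_eq_of_card_lt
      (fun i : Fin (profCard n + 1) => π (z.take i)) (by rw [card_prof]; simp)
    rcases lt_or_gt_of_ne hne with h | h
    exacts [⟨i, j, h, he⟩, ⟨j, i, h, he.symm⟩]
  obtain ⟨g, hg⟩ := hπ _ _ he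
  have hij' : (i : ℕ) < j := hij
  have hj := j.2
  have h1 : E z (_root_.ren g (z.take i) ++ z.drop j) := by
    conv_lhs => rw [← List.take_append_drop j z]
    exact hE.append (hE.symm hg) (hE.refl _)
  obtain ⟨z', h2, h3, h4⟩ := ih (_root_.ren g (z.take i) ++ z.drop j).length
    (by simp only [List.length_append, length_ren, List.length_take, List.length_drop]; omega)
    (_root_.ren g (z.take i) ++ z.drop j) rfl
  refine ⟨z', hE.trans h1 h2, h3, fun p' hp' => ?_⟩
  obtain ⟨p, hp, he⟩ := h4 p' hp'
  rcases List.mem_append.1 hp with hp | hp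
  · obtain ⟨q, hq, rfl⟩ := List.mem_map.1 hp
    exact ⟨q, List.mem_of_mem_take hq, he⟩
  · exact ⟨p, List.mem_of_mem_drop hp, he⟩

/-- The cardinalities of the values of the variables below `V`, up to the threshold two. -/
def counts (V : ℕ) (z : Word D A) : Fin V → Fin 3 := fun x => ⟨min 2 (cnt x z), by omega⟩

theorem countEq_of_counts {V : ℕ} {z z' : Word D A} (h : counts V z = counts V z') :
    CountEq V z z' := fun x hx => by
  simpa [counts] using congrFun h ⟨x, hx⟩

theorem countEq_ren {V : ℕ} {z z' : Word D A} (g : D → D) (h : counts V z = counts V z') :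
    CountEq V (ren g z) z' := fun x hx => by
  rw [cnt_ren]
  exact countEq_of_counts h x hx

theorem memCode_test {V n : ℕ} {P : Word D A → Prop} (hn : 3 ^ V * 2 ≤ n)
    (hr : ∀ (g : Equiv.Perm D) z, P (ren g z) ↔ P z) :
    MemCode (fun z z' => CountEq V z z' ∧ (P z ↔ P z')) n := by
  classical
  refine MemCode.of_fintype (κ := (Fin V → Fin 3) × Bool) (ι := Empty) (by simpa using hn)
    (by simp) (fun z => (counts V z, decide (P z))) (fun _ => Empty.elim) fun z z' g ht _ => ?_
  simp only [Prod.mk.injEq, decide_eq_decide] at ht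
  exact ⟨countEq_ren g ht.1, by rw [hr]; exact ht.2⟩

theorem MemCode.mono {E : Word D A → Word D A → Prop} {n m : ℕ} (h : MemCode E n) (hm : n ≤ m) :
    MemCode E m := by
  obtain ⟨t, δ, H⟩ := h
  exact MemCode.of_fintype (by simpa using hm) (by simpa using hm) t δ H

theorem MemCode.and {E E' : Word D A → Word D A → Prop} {n m : ℕ} (h : MemCode E n)
    (h' : MemCode E' n) (hm : n * n + (n + n) ≤ m) :
    MemCode (fun z z' => E z z' ∧ E' z z') m := by
  obtain ⟨t, δ, H⟩ := h
  obtain ⟨t', δ', H'⟩ := h'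
  refine MemCode.of_fintype (κ := Fin n × Fin n) (ι := Fin n ⊕ Fin n) (by simp; omega)
    (by simp; omega) (fun z => (t z, t' z)) (fun z => Sum.elim (δ z) (δ' z)) ?_
  intro z z' g ht hδ
  simp only [Prod.mk.injEq] at ht
  exact ⟨H z z' g ht.1 fun i => hδ (Sum.inl i), H' z z' g ht.2 fun i => hδ (Sum.inr i)⟩

/-- By projectability, two variants of the same word with the same profile are congruent. So the
classes of the variants of `z` are determined by the set of profiles that occur and by the data
values of one chosen variant for each. This accounts for `2 ^ profCard n` in the number of types and
`profCard n * n` in the number of data values. -/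
theorem MemCode.lift {V : ℕ} {E : Word D A → Word D A → Prop} (hE : Nice V E) {n m : ℕ}
    (h : MemCode E n) (b : Bool) (x : ℕ)
    (hm : 3 ^ V * 2 ^ profCard n + profCard n * n ≤ m) :
    MemCode (fun z z' => CountEq V z z' ∧ Lift b x E z z') m := by
  classical
  obtain ⟨t, δ, π, H, hπ⟩ := h.exists_prof
  have ex : ∀ (z : Word D A) (p : Prof n), ∃ y : Word D A,
      (∃ y, Variant b x z y ∧ π y = p) → Variant b x z y ∧ π y = p := fun z p => by
    by_cases h : ∃ y, Variant b x z y ∧ π y = p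
    · exact ⟨h.choose, fun _ => h.choose_spec⟩
    · exact ⟨[], fun h' => (h h').elim⟩
  choose Y hY using ex
  refine MemCode.of_fintype (κ := (Fin V → Fin 3) × (Prof n → Bool)) (ι := Prof n × Fin n)
    (by rw [Fintype.card_prod, Fintype.card_fun, Fintype.card_fun, card_prof]; simp; omega)
    (by rw [Fintype.card_prod, card_prof, Fintype.card_fin]; omega)
    (fun z => (counts V z, fun p => decide (∃ y, Variant b x z y ∧ π y = p)))
    (fun z i => δ (Y z i.1) i.2) fun z z' g ht hδ => ?_
  simp only [Prod.mk.injEq] at ht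
  obtain ⟨hc, hp⟩ := ht
  have hp : ∀ p, (∃ y, Variant b x z y ∧ π y = p) ↔ (∃ y, Variant b x z' y ∧ π y = p) :=
    fun p => by simpa using congrFun hp p
  -- Here projectability is used: variants of one word have the same underlying data word.
  have uniq : ∀ {z y y' : Word D A}, Variant b x z y → Variant b x z y' → π y = π y' →
      E y y' := by
    intro z y y' hy hy' he
    obtain ⟨h1, g, hg⟩ := hπ y y' he
    exact hE.proj g (by rw [base_eq_of_er hy.1, base_eq_of_er hy'.1]) (H y y' g h1 hg)
  -- A single renaming `g` matches the chosen variants of `z` and `z'` for all profiles at once,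
  -- since it matches all their data values.
  have main : ∀ p, (∃ y, Variant b x z y ∧ π y = p) →
      Variant b x z (Y z p) ∧ π (Y z p) = p ∧ Variant b x z' (Y z' p) ∧ π (Y z' p) = p ∧
        E (_root_.ren g (Y z p)) (Y z' p) := by
    intro p h
    obtain ⟨h1, h2⟩ := hY z p h
    obtain ⟨h3, h4⟩ := hY z' p ((hp p).1 h)
    exact ⟨h1, h2, h3, h4, H _ _ g (hπ _ _ (h2.trans h4.symm)).1 fun i => hδ (p, i)⟩
  refine ⟨countEq_ren g hc, fun y hy => ?_, fun y hy => ?_⟩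
  · obtain ⟨y, rfl, hy⟩ := variant_of_ren hy
    obtain ⟨h1, h2, h3, h4, h5⟩ := main (π y) ⟨y, by assumption, rfl⟩
    exact ⟨_, h3, hE.trans (hE.ren g (uniq (by assumption) h1 h2.symm)) h5⟩
  · obtain ⟨h1, h2, h3, h4, h5⟩ := main (π y) ((hp _).2 ⟨y, hy, rfl⟩)
    exact ⟨_, variant_self_ren g h1, hE.trans h5 (uniq h3 hy h4)⟩

end Word

/-! ### Computable bounds for the number of types. -/

namespace MSO

variable {D : Type u} {A : Type v}

/-- In a useful word each of the variables marks at most one position, so two further data values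
and two further bits determine the guard. -/
theorem memCode_guard {E : Word D A → Word D A → Prop} {n m : ℕ} {φ : MSO A} {x y : ℕ}
    (h : MemCode E n) (hm : n * 4 + 2 ≤ m) :
    MemCode (fun z z' => E z z' ∧ Guard φ x y z z') m := by
  classical
  obtain ⟨t, δ, H⟩ := h
  -- The value `none` also covers sets with several elements; this is harmless, because `val` is
  -- evaluated for the guard only where the cardinality is at most one.
  let val : ℕ → Word D A → Option D := fun i z =>
    if h : ∃ d, data i z = {d} then some h.choose else none
  have val_some : ∀ i z d, val i z = some d ↔ data i z = {d} := by
    intro i z d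
    by_cases h : ∃ d, data i z = {d}
    · have hs := h.choose_spec
      simp only [val, dif_pos h, Option.some.injEq]
      constructor
      · rintro rfl; exact hs
      · intro h'; exact Set.singleton_injective (hs.symm.trans h')
    · simp only [val, dif_neg h, reduceCtorEq, false_iff]
      exact fun h' => h ⟨d, h'⟩
  have small : ∀ i (z : Word D A), cnt i z ≤ 1 → data i z = ∅ ∨ ∃ d, data i z = {d} := by
    intro i z hc
    rcases Nat.eq_zero_or_pos (cnt i z) with h0 | h0
    · exact Or.inl (data_eq_empty h0)
    · obtain ⟨p, hp, Hp⟩ := exists_position (show cnt i z = 1 by omega)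
      simp only [decide_eq_true_eq] at Hp
      refine Or.inr ⟨z[p].1, ?_⟩
      rw [data_eq_of_position Hp]
      ext d
      simp [base, hp, eq_comm]
  have eq_data : ∀ i (z z' : Word D A) (g : Equiv.Perm D), cnt i z ≤ 1 → cnt i z' ≤ 1 →
      (val i z).map g = val i z' → data i (ren g z) = data i z' := by
    intro i z z' g hc hc' he
    rw [data_ren]
    rcases small i z hc with h | ⟨d, h⟩
    · have : val i z = none := by
        rw [Option.eq_none_iff_forall_ne_some]
        intro d hd
        rw [val_some, h] at hd
        exact (Set.singleton_ne_empty d hd.symm).elim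
      rw [this, Option.map_none] at he
      rcases small i z' hc' with h' | ⟨d, h'⟩
      · rw [h, h', Set.image_empty]
      · rw [(val_some i z' d).2 h'] at he
        cases he
    · rw [(val_some i z d).2 h, Option.map_some] at he
      rw [h, (val_some i z' _).1 he.symm, Set.image_singleton]
  refine MemCode.of_fintype (κ := Fin n × Bool × Bool) (ι := Fin n ⊕ Bool) (by simp; omega)
    (by simp; omega)
    (fun z => (t z, decide (Useful φ x y z), decide (Holds (sim x y) z)))
    (fun z => Sum.elim (δ z) fun b => if b then val (2 * x) z else val (2 * y) z) ?_
  intro z z' g ht hδ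
  simp only [Prod.mk.injEq, decide_eq_decide] at ht
  obtain ⟨h1, h2, h3⟩ := ht
  refine ⟨H z z' g h1 fun i => hδ (Sum.inl i), fun hu => ?_⟩
  have hu := (useful_ren_iff g).1 hu
  have hc : ∀ z : Word D A, Useful φ x y z → cnt (2 * x) z ≤ 1 ∧ cnt (2 * y) z ≤ 1 := by
    rintro z ⟨u, v, -, h1, h2⟩
    simp only [cnt_append] at h1 h2
    omega
  obtain ⟨a, b⟩ := hc z hu
  obtain ⟨a', b'⟩ := hc z' (h2.1 hu)
  refine ⟨fun _ => eq_data _ z z' g a a' ?_, fun _ => eq_data _ z z' g b b' ?_, ?_⟩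
  · simpa using hδ (Sum.inr true)
  · simpa using hδ (Sum.inr false)
  · rw [holds_ren g.injective, h3]

/-- The growth of the number of types with the size of the formula. -/
def growth (V n : ℕ) : ℕ :=
  3 ^ V * 2 ^ profCard n + profCard n * n + (n * n + (n + n)) + (n * 4 + 2) + 3 ^ V * 2

/-- A bound for the number of types of a formula with the code `e`. -/
def bound (V e : ℕ) : ℕ := (growth V)^[e] 0

theorem bound_succ (V e : ℕ) : bound V (e + 1) = growth V (bound V e) :=
  Function.iterate_succ_apply' _ _ _

theorem bound_mono (V : ℕ) : Monotone (bound V) := by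
  refine monotone_nat_of_le_succ fun e => ?_
  rw [bound_succ, growth]
  omega

theorem growth_le {V e e' : ℕ} (h : e < e') : growth V (bound V e) ≤ bound V e' := by
  rw [← bound_succ]
  exact bound_mono V h

/-- Recursion over codes needs strict growth, which fails for small numbers, as in `Nat.pair 0 1 =
1`. -/
theorem lt_pair {t m : ℕ} (hm : 2 ≤ m) : m < Nat.pair t m := by
  rcases Nat.lt_or_ge t m with h | h
  · rw [Nat.pair, if_pos h]
    nlinarith
  · rw [Nat.pair, if_neg (by omega)]
    nlinarith

theorem le_pair {t m : ℕ} (ht : 2 ≤ t) : 2 ≤ Nat.pair t m := ht.trans (Nat.left_le_pair t m)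

variable [Encodable A]

theorem two_le_code (φ : MSO A) : 2 ≤ φ.code := by
  induction φ with
  | exFO x φ ih => exact (ih.trans (Nat.right_le_pair x _)).trans (Nat.right_le_pair _ _)
  | exSO x φ ih => exact (ih.trans (Nat.right_le_pair x _)).trans (Nat.right_le_pair _ _)
  | _ => exact le_pair (by omega)

theorem code_lt_exFO (x : ℕ) (φ : MSO A) : φ.code < (exFO x φ).code :=
  (Nat.right_le_pair x _).trans_lt (lt_pair ((two_le_code φ).trans (Nat.right_le_pair x _)))

theorem code_lt_exSO (x : ℕ) (φ : MSO A) : φ.code < (exSO x φ).code :=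
  (Nat.right_le_pair x _).trans_lt (lt_pair ((two_le_code φ).trans (Nat.right_le_pair x _)))

theorem code_lt_neg (φ : MSO A) : φ.code < (neg φ).code := lt_pair (two_le_code φ)

theorem code_lt_conj_left (φ ψ : MSO A) : φ.code < (conj φ ψ).code :=
  (Nat.left_le_pair _ _).trans_lt (lt_pair ((two_le_code φ).trans (Nat.left_le_pair _ _)))

theorem code_lt_conj_right (φ ψ : MSO A) : ψ.code < (conj φ ψ).code :=
  (Nat.right_le_pair _ _).trans_lt (lt_pair ((two_le_code ψ).trans (Nat.right_le_pair _ _)))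

theorem bound_of_atom (V : ℕ) (φ : MSO A) : 3 ^ V * 2 ≤ bound V φ.code := by
  refine le_trans ?_ (growth_le (V := V) (show 0 < φ.code by have := two_le_code φ; omega))
  rw [growth]
  omega

/-- Each connective costs at most one application of `growth`, and codes strictly increase from
subformulas to formulas. Indexing the bound by the code makes it computable without decoding the
formula. -/
theorem RigidlyGuarded.memCode {V : ℕ} {φ : MSO A} (h : RigidlyGuarded D φ) (hV : φ.Below V) :
    MemCode (Cong V φ : Word D A → Word D A → Prop) (bound V φ.code) := by
  induction h with
  | @exFO x φ hφ ih =>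
    refine (ih hV.2).lift (hφ.cong hV.2).1 true (2 * x)
      (le_trans ?_ (growth_le (code_lt_exFO x φ)))
    rw [growth]
    omega
  | @exSO X φ hφ ih =>
    refine (ih hV.2).lift (hφ.cong hV.2).1 false (2 * X + 1)
      (le_trans ?_ (growth_le (code_lt_exSO X φ)))
    rw [growth]
    omega
  | letter a x => exact memCode_test (bound_of_atom V _) fun g z => holds_ren g.injective _ z
  | lt x y => exact memCode_test (bound_of_atom V _) fun g z => holds_ren g.injective _ z
  | mem x X => exact memCode_test (bound_of_atom V _) fun g z => holds_ren g.injective _ z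
  | @neg φ _ ih => exact (ih hV).mono (bound_mono V (code_lt_neg φ).le)
  | @conj φ ψ _ hψ ih₁ ih₂ =>
    have hne : ∀ x y, ψ ≠ sim x y := by rintro x y rfl; cases hψ
    rw [show (Cong V (MSO.conj φ ψ) : Word D A → Word D A → Prop) =
      fun z z' => Cong V φ z z' ∧ Cong V ψ z z' from
      funext fun z => funext fun z' => propext (cong_conj_of_ne hne z z')]
    have hlt : max φ.code ψ.code < (MSO.conj φ ψ).code :=
      max_lt (code_lt_conj_left φ ψ) (code_lt_conj_right φ ψ)
    refine ((ih₁ hV.1).mono (bound_mono V (le_max_left _ _))).and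
      ((ih₂ hV.2).mono (bound_mono V (le_max_right _ _))) (le_trans ?_ (growth_le hlt))
    rw [growth]
    omega
  | @guardedSim φ x y hφ hxy hf hr ih =>
    have h1 := (hφ.cong hV.1).1
    rw [show (Cong V (MSO.conj φ (MSO.sim x y)) : Word D A → Word D A → Prop) =
      fun z z' => Cong V φ z z' ∧ Guard φ x y z z' from
      funext fun z => funext fun z' => propext (cong_conj_sim h1)]
    refine memCode_guard (ih hV.1) (le_trans ?_ (growth_le (code_lt_conj_left φ _)))
    rw [growth]
    omega

end MSO

/-! ## Bounded contexts -/

namespace Word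

variable {D : Type u} {A : Type v}

/-- The word with its annotation restricted to the variables below `V`. -/
def res (V : ℕ) (z : Word D A) : Word D A := z.map fun p => (p.1, p.2.1, p.2.2 ∩ Finset.range V)

@[simp] theorem res_append (V : ℕ) (y z : Word D A) : res V (y ++ z) = res V y ++ res V z :=
  List.map_append

theorem er_res (x V : ℕ) (z : Word D A) : er x (res V z) = res V (er x z) := by
  simp [er, res, Finset.erase_inter]

theorem cnt_res {x V : ℕ} (hx : x < V) (z : Word D A) : cnt x (res V z) = cnt x z := by
  simp [cnt, res, List.countP_map, Function.comp_def, hx]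

theorem res_eq_self {V : ℕ} {z : Word D A} (h : ∀ p ∈ z, p.2.2 ⊆ Finset.range V) :
    res V z = z := by
  conv_rhs => rw [← List.map_id z]
  exact List.map_congr_left fun p hp => by simp [Finset.inter_eq_left.2 (h p hp)]

/-- The witness takes the marks of `x` from `y` and all other marks from `z`; as `x < V`, the
restriction keeps the former. -/
theorem exists_of_er_res {x V : ℕ} (hx : x < V) {z : Word D A} :
    ∀ {y : Word D A}, er x y = er x (res V z) → ∃ y', y = res V y' ∧ er x y' = er x z := by
  induction z with
  | nil =>
    intro y h
    simp [er, res] at h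
    exact ⟨[], by simp [h, res], rfl⟩
  | cons p z ih =>
    intro y h
    cases y with
    | nil => simp [er, res] at h
    | cons q y =>
      simp only [er, res, List.map_cons, List.cons.injEq, Prod.mk.injEq] at h
      obtain ⟨⟨h1, h2, h3⟩, h4⟩ := h
      obtain ⟨y', rfl, hy'⟩ := ih (y := y) h4
      refine ⟨(p.1, p.2.1, if x ∈ q.2.2 then insert x p.2.2 else p.2.2.erase x) :: y', ?_, ?_⟩
      · have : q.2.2 = (if x ∈ q.2.2 then insert x p.2.2 else p.2.2.erase x) ∩
            Finset.range V := by
          ext i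
          have hi := congrArg (i ∈ ·) h3
          simp only [Finset.mem_erase, Finset.mem_inter, Finset.mem_range, eq_iff_iff] at hi
          by_cases hix : i = x
          · subst hix
            by_cases hq : i ∈ q.2.2 <;> simp [hq, hx]
          · by_cases hq : x ∈ q.2.2 <;> simpa [hq, hix] using hi
        simp only [res, List.map_cons, ← this, ← h1, ← h2]
      · simp only [er, List.map_cons, List.cons.injEq, Prod.mk.injEq, true_and]
        refine ⟨?_, hy'⟩
        split_ifs <;> simp

end Word

namespace MSO

variable {D : Type u} {A : Type v}

/-- Satisfaction depends only on the values of the variables of the formula. -/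
theorem holds_res {V : ℕ} {φ : MSO A} : φ.Below V → ∀ z : Word D A,
    (Holds φ (res V z) ↔ Holds φ z) := by
  induction φ with
  | exFO x φ ih =>
    intro hV z
    constructor
    · rintro ⟨y, he, hc, hs⟩
      obtain ⟨y', rfl, he'⟩ := exists_of_er_res hV.1 he
      exact ⟨y', he', by rwa [cnt_res hV.1] at hc, (ih hV.2 y').1 hs⟩
    · rintro ⟨y, he, hc, hs⟩
      exact ⟨res V y, by rw [er_res, er_res, he], by rwa [cnt_res hV.1], (ih hV.2 y).2 hs⟩
  | exSO X φ ih =>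
    intro hV z
    constructor
    · rintro ⟨y, he, hs⟩
      obtain ⟨y', rfl, he'⟩ := exists_of_er_res hV.1 he
      exact ⟨y', he', (ih hV.2 y').1 hs⟩
    · rintro ⟨y, he, hs⟩
      exact ⟨res V y, by rw [er_res, er_res, he], (ih hV.2 y).2 hs⟩
  | letter a x =>
    intro hV z
    have hV : 2 * x < V := hV
    simp only [Holds, res, List.mem_map, exists_exists_and_eq_and, Finset.mem_inter,
      Finset.mem_range, hV, and_true]
  | lt x y =>
    intro hV z
    constructor
    · rintro ⟨z₁, z₂, he, h1, h2⟩
      obtain ⟨y₁, y₂, rfl, rfl, rfl⟩ := List.map_eq_append_iff.1 he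
      exact ⟨y₁, y₂, rfl, by rwa [← cnt_res hV.1], by rwa [← cnt_res hV.2]⟩
    · rintro ⟨z₁, z₂, rfl, h1, h2⟩
      exact ⟨res V z₁, res V z₂, by simp, by rwa [cnt_res hV.1], by rwa [cnt_res hV.2]⟩
  | mem x X =>
    intro hV z
    simp only [Holds, res, List.mem_map, exists_exists_and_eq_and, Finset.mem_inter,
      Finset.mem_range, hV.1, hV.2, and_true]
  | sim x y =>
    intro hV z
    simp only [Holds, res, List.mem_map, exists_exists_and_eq_and, Finset.mem_inter,
      Finset.mem_range, hV.1, hV.2, and_true]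
  | neg φ ih => intro hV z; exact not_congr (ih hV z)
  | conj φ ψ ih₁ ih₂ => intro hV z; exact and_congr (ih₁ hV.1 z) (ih₂ hV.2 z)

end MSO

/-! ### Small words and the transfer of data values to an initial segment. -/

namespace Word

variable {D : Type u} {A : Type v}

/-- Words of length at most `L` with data values below `K` and variables below `V`. -/
def Small (V K L : ℕ) (z : Word ℕ A) : Prop :=
  z.length ≤ L ∧ ∀ p ∈ z, p.1 < K ∧ p.2.2 ⊆ Finset.range V

theorem Small.append {V K L L' : ℕ} {y z : Word ℕ A} (hy : Small V K L y) (hz : Small V K L' z) :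
    Small V K (L + L') (y ++ z) := by
  refine ⟨by rw [List.length_append]; exact add_le_add hy.1 hz.1, fun p hp => ?_⟩
  exact (List.mem_append.1 hp).elim (hy.2 p) (hz.2 p)

theorem Small.mono {V K L K' L' : ℕ} {z : Word ℕ A} (hz : Small V K L z) (hK : K ≤ K')
    (hL : L ≤ L') : Small V K' L' z :=
  ⟨hz.1.trans hL, fun p hp => ⟨(hz.2 p hp).1.trans_le hK, (hz.2 p hp).2⟩⟩

theorem Small.variant {V K L x : ℕ} {y z : Word ℕ A} (hz : Small V K L z) (hx : x < V)
    (h : er x y = er x z) : Small V K L y := by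
  refine ⟨by rw [length_eq_of_er h]; exact hz.1, fun p hp => ?_⟩
  have hp' : (p.1, p.2.1, p.2.2.erase x) ∈ er x z := by
    rw [← h]
    exact List.mem_map_of_mem hp
  obtain ⟨q, hq, he⟩ := List.mem_map.1 hp'
  simp only [Prod.mk.injEq] at he
  obtain ⟨h1, h2⟩ := hz.2 q hq
  refine ⟨he.1 ▸ h1, fun i hi => ?_⟩
  by_cases hix : i = x
  · subst hix; exact Finset.mem_range.2 hx
  · have : i ∈ q.2.2.erase x := by rw [he.2.2]; exact Finset.mem_erase.2 ⟨hix, hi⟩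
    exact h2 (Finset.mem_of_mem_erase this)

/-- Any word with finitely many data values can be renamed into the first natural numbers, while
the data values among the first `K` are fixed. -/
theorem exists_perm_into {j : ℕ → D} (hj : Function.Injective j) (K : ℕ) (s : Finset D) :
    ∃ g : Equiv.Perm D, (∀ i < K, g (j i) = j i) ∧
      ∀ d ∈ s, ∃ i < K + s.card, g d = j i := by
  classical
  let C : Finset D := (Finset.range K).image j
  let e := (s \ C).equivFin
  have hcard : (s \ C).card ≤ s.card := Finset.card_le_card Finset.sdiff_subset
  -- Elements of `s` beyond the first `K` values are numbered consecutively from `K` on.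
  let f : D → D := fun d => if h : d ∈ s \ C then j (K + e ⟨d, h⟩) else d
  have hfC : ∀ d ∈ C, f d = d := fun d hd => dif_neg (by simp [hd])
  have hC : ∀ d, d ∈ C ↔ ∃ i < K, j i = d := by simp [C]
  obtain ⟨g, hg⟩ := exists_perm_of_injOn (s := (↑(C ∪ s) : Set D)) (f := f)
    (Finset.finite_toSet _) (by
      intro a ha b hb hab
      have dich : ∀ d ∈ (↑(C ∪ s) : Set D), d ∈ C ∨ ∃ h : d ∈ s \ C, f d = j (K + e ⟨d, h⟩) := by
        intro d hd
        by_cases hdC : d ∈ C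
        · exact Or.inl hdC
        · have hds : d ∈ s \ C := by
            simp only [Finset.coe_union, Set.mem_union, Finset.mem_coe] at hd
            exact Finset.mem_sdiff.2 ⟨hd.resolve_left hdC, hdC⟩
          exact Or.inr ⟨hds, dif_pos hds⟩
      have cross : ∀ a b, a ∈ C → (∃ h : b ∈ s \ C, f b = j (K + e ⟨b, h⟩)) → f a ≠ f b := by
        rintro a b ha ⟨h, hb⟩ hab
        rw [hfC a ha, hb] at hab
        obtain ⟨i, hi, rfl⟩ := (hC a).1 ha
        have := hj hab
        omega
      rcases dich a ha with h1 | h1 <;> rcases dich b hb with h2 | h2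
      · rwa [hfC a h1, hfC b h2] at hab
      · exact (cross a b h1 h2 hab).elim
      · exact (cross b a h2 h1 hab.symm).elim
      · obtain ⟨h1, e1⟩ := h1
        obtain ⟨h2, e2⟩ := h2
        rw [e1, e2] at hab
        have h3 : (e ⟨a, h1⟩ : ℕ) = e ⟨b, h2⟩ := by have := hj hab; omega
        simpa using e.injective (Fin.ext h3))
  refine ⟨g, fun i hi => ?_, fun d hd => ?_⟩
  · have hi' : j i ∈ C := (hC _).2 ⟨i, hi, rfl⟩
    rw [hg _ (by simp [hi']), hfC _ hi']
  · rw [hg _ (by simp [hd])]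
    by_cases hdC : d ∈ C
    · obtain ⟨i, hi, rfl⟩ := (hC _).1 hdC
      exact ⟨i, by omega, hfC _ hdC⟩
    · have hds : d ∈ s \ C := Finset.mem_sdiff.2 ⟨hd, hdC⟩
      exact ⟨K + e ⟨d, hds⟩, by have := (e ⟨d, hds⟩).2; omega, dif_pos hds⟩

/-- A word all of whose data values are in the range of `j` is a renamed word. -/
theorem exists_ren_eq {B : Type*} {j : ℕ → D} {K : ℕ} {z : List (D × B)}
    (h : ∀ p ∈ z, ∃ i < K, p.1 = j i) :
    ∃ z₀ : List (ℕ × B), ren j z₀ = z ∧ (∀ p ∈ z₀, p.1 < K) ∧ ∀ p ∈ z₀, ∃ q ∈ z, q.2 = p.2 := by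
  induction z with
  | nil => exact ⟨[], rfl, by simp, by simp⟩
  | cons p z ih =>
    obtain ⟨z₀, rfl, h1, h2⟩ := ih fun q hq => h q (List.mem_cons_of_mem _ hq)
    obtain ⟨i, hi, he⟩ := h p List.mem_cons_self
    refine ⟨(i, p.2) :: z₀, by simp [ren, ← he], ?_, ?_⟩
    · intro q hq
      rcases List.mem_cons.1 hq with rfl | hq
      exacts [hi, h1 q hq]
    · intro q hq
      rcases List.mem_cons.1 hq with rfl | hq
      · exact ⟨p, List.mem_cons_self, rfl⟩
      · obtain ⟨q', hq', he⟩ := h2 q hq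
        exact ⟨q', List.mem_cons_of_mem _ hq', he⟩

theorem card_dataValues_le {B : Type*} [DecidableEq D] (z : List (D × B)) :
    ((z.map Prod.fst).toFinset).card ≤ z.length :=
  (List.toFinset_card_le _).trans (List.length_map _).le

end Word

namespace MSO

variable {D : Type u} {A : Type v}

/-- Small contexts suffice to decide whether a word is useful. -/
theorem useful_ren_iff_small {V N K L : ℕ} {E : Word D A → Word D A → Prop} (hE : Nice V E) {n : ℕ}
    (hn : MemCode E n) (hN : profCard n ≤ N) {φ : MSO A} (hV : φ.Below V) (hφ : Preserves φ E)
    {x y : ℕ} (hf : φ.freeVars ⊆ {Sum.inl x, Sum.inl y}) (hx : 2 * x < V) (hy : 2 * y < V)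
    {j : ℕ → D} (hj : Function.Injective j) {z : Word ℕ A} (hz : Small V K L z) :
    Useful φ x y (ren j z) ↔ ∃ u v, Small V (K + 2 * N) N u ∧ Small V (K + 2 * N) N v ∧
      Holds φ (u ++ z ++ v) ∧ cnt (2 * x) (u ++ z ++ v) = 1 ∧ cnt (2 * y) (u ++ z ++ v) = 1 := by
  classical
  constructor
  · rintro ⟨u, v, h, h1, h2⟩
    -- The contexts are first shortened up to congruence, then renamed, and finally stripped of the
    -- marks of variables that do not matter.
    obtain ⟨u', eu, lu, -⟩ := hE.exists_short hn u
    obtain ⟨v', ev, lv, -⟩ := hE.exists_short hn v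
    have e : E (u ++ ren j z ++ v) (u' ++ ren j z ++ v') :=
      hE.append (hE.append eu (hE.refl _)) ev
    have h' := hφ _ _ e (fun t ht => by
      have := hf ht
      simp only [Finset.mem_insert, Finset.mem_singleton, Sum.inl.injEq] at this
      rcases this with rfl | rfl
      exacts [h1, h2]) h
    have h1' := (hE.count e).eq_one hx h1
    have h2' := (hE.count e).eq_one hy h2
    -- The two short contexts have at most `2 * N` data values together; they are moved into the
    -- range while those of `z` stay fixed.
    obtain ⟨g, hg, hg'⟩ := exists_perm_into hj K (((u' ++ v').map Prod.fst).toFinset)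
    have hcard := card_dataValues_le (u' ++ v')
    rw [List.length_append] at hcard
    have small : ∀ t : Word D A, t.length ≤ N → (∀ p ∈ t, p ∈ u' ++ v') →
        ∃ t₀, Small V (K + 2 * N) N t₀ ∧ ren j t₀ = ren g (res V t) := by
      intro t ht htm
      obtain ⟨t₀, h1, h2, h3⟩ := exists_ren_eq (j := j) (K := K + 2 * N) (z := ren g (res V t)) (by
        intro p hp
        obtain ⟨q, hq, rfl⟩ := List.mem_map.1 hp
        obtain ⟨r, hr, rfl⟩ := List.mem_map.1 hq
        obtain ⟨i, hi, he⟩ := hg' r.1 (List.mem_toFinset.2 (List.mem_map_of_mem (htm r hr)))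
        exact ⟨i, by omega, he⟩)
      refine ⟨t₀, ⟨?_, fun p hp => ⟨h2 p hp, ?_⟩⟩, h1⟩
      · rw [← length_ren j, h1, length_ren, res, List.length_map]
        exact ht
      · obtain ⟨q, hq, he⟩ := h3 p hp
        obtain ⟨r, hr, rfl⟩ := List.mem_map.1 hq
        obtain ⟨s, hs, rfl⟩ := List.mem_map.1 hr
        rw [← he]
        exact Finset.inter_subset_right
    obtain ⟨u₀, su, eu₀⟩ := small u' (by omega) fun p hp => List.mem_append_left _ hp
    obtain ⟨v₀, sv, ev₀⟩ := small v' (by omega) fun p hp => List.mem_append_right _ hp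
    have hzz : ren g (res V (ren j z)) = ren j z := by
      rw [res_eq_self (fun p hp => by
        obtain ⟨q, hq, rfl⟩ := List.mem_map.1 hp
        exact (hz.2 q hq).2), ren_ren]
      exact ren_congr fun p hp => hg _ (hz.2 p hp).1
    have key : ren j (u₀ ++ z ++ v₀) = ren g (res V (u' ++ ren j z ++ v')) := by
      rw [ren_append, ren_append, eu₀, ev₀, res_append, res_append, ren_append, ren_append, hzz]
    refine ⟨u₀, v₀, su, sv, ?_, ?_, ?_⟩
    · rwa [← holds_ren hj, key, holds_ren g.injective, holds_res hV]
    · rwa [← cnt_ren j, key, cnt_ren, cnt_res hx]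
    · rwa [← cnt_ren j, key, cnt_ren, cnt_res hy]
  · rintro ⟨u, v, -, -, h, h1, h2⟩
    refine ⟨ren j u, ren j v, ?_⟩
    rw [← ren_append, ← ren_append, holds_ren hj, cnt_ren, cnt_ren]
    exact ⟨h, h1, h2⟩

end MSO

/-! ## Primitive recursive functions -/

attribute [fun_prop] Primrec Primrec.const Primrec.comp PrimrecPred
attribute [fun_prop] PrimrecPred.and PrimrecPred.or PrimrecPred.not

namespace Primrec

variable {α β γ : Type*} [Primcodable α] [Primcodable β] [Primcodable γ]

@[fun_prop] theorem id_fun : Primrec fun a : α => a := Primrec.id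

@[fun_prop] theorem fst_fun {f : α → β × γ} (hf : Primrec f) : Primrec fun a => (f a).1 :=
  Primrec.fst.comp hf

@[fun_prop] theorem snd_fun {f : α → β × γ} (hf : Primrec f) : Primrec fun a => (f a).2 :=
  Primrec.snd.comp hf

@[fun_prop] theorem mk_fun {f : α → β} {g : α → γ} (hf : Primrec f) (hg : Primrec g) :
    Primrec fun a => (f a, g a) := hf.pair hg

@[fun_prop] theorem add_fun {f g : α → ℕ} (hf : Primrec f) (hg : Primrec g) :
    Primrec fun a => f a + g a := Primrec.nat_add.comp hf hg

@[fun_prop] theorem sub_fun {f g : α → ℕ} (hf : Primrec f) (hg : Primrec g) :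
    Primrec fun a => f a - g a := Primrec.nat_sub.comp hf hg

@[fun_prop] theorem mul_fun {f g : α → ℕ} (hf : Primrec f) (hg : Primrec g) :
    Primrec fun a => f a * g a := Primrec.nat_mul.comp hf hg

@[fun_prop] theorem pow_fun {f g : α → ℕ} (hf : Primrec f) (hg : Primrec g) :
    Primrec fun a => f a ^ g a := (Primrec₂.unpaired'.1 Nat.Primrec.pow).comp hf hg

@[fun_prop] theorem div_fun {f g : α → ℕ} (hf : Primrec f) (hg : Primrec g) :
    Primrec fun a => f a / g a := Primrec.nat_div.comp hf hg

@[fun_prop] theorem mod_fun {f g : α → ℕ} (hf : Primrec f) (hg : Primrec g) :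
    Primrec fun a => f a % g a := Primrec.nat_mod.comp hf hg

@[fun_prop] theorem min_fun {f g : α → ℕ} (hf : Primrec f) (hg : Primrec g) :
    Primrec fun a => min (f a) (g a) := Primrec.nat_min.comp hf hg

@[fun_prop] theorem unpair_fun {f : α → ℕ} (hf : Primrec f) : Primrec fun a => (f a).unpair :=
  Primrec.unpair.comp hf

@[fun_prop] theorem natPair_fun {f g : α → ℕ} (hf : Primrec f) (hg : Primrec g) :
    Primrec fun a => Nat.pair (f a) (g a) := Primrec₂.natPair.comp hf hg

@[fun_prop] theorem encode_fun {f : α → β} (hf : Primrec f) :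
    Primrec fun a => Encodable.encode (f a) := Primrec.encode.comp hf

@[fun_prop] theorem append_fun {f g : α → List β} (hf : Primrec f) (hg : Primrec g) :
    Primrec fun a => f a ++ g a := Primrec.list_append.comp hf hg

@[fun_prop] theorem cons_fun {f : α → β} {g : α → List β} (hf : Primrec f) (hg : Primrec g) :
    Primrec fun a => f a :: g a := Primrec.list_cons.comp hf hg

@[fun_prop] theorem length_fun {f : α → List β} (hf : Primrec f) : Primrec fun a => (f a).length :=
  Primrec.list_length.comp hf

@[fun_prop] theorem range_fun {f : α → ℕ} (hf : Primrec f) : Primrec fun a => List.range (f a) :=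
  Primrec.list_range.comp hf

@[fun_prop] theorem take_fun {f : α → ℕ} {g : α → List β} (hf : Primrec f) (hg : Primrec g) :
    Primrec fun a => (g a).take (f a) := Primrec.list_take.comp hf hg

@[fun_prop] theorem drop_fun {f : α → ℕ} {g : α → List β} (hf : Primrec f) (hg : Primrec g) :
    Primrec fun a => (g a).drop (f a) := Primrec.list_drop.comp hf hg

@[fun_prop] theorem getElem?_fun {f : α → List β} {g : α → ℕ} (hf : Primrec f) (hg : Primrec g) :
    Primrec fun a => (f a)[g a]? := Primrec.list_getElem?.comp hf hg

@[fun_prop] theorem getD_fun {f : α → Option β} {g : α → β} (hf : Primrec f) (hg : Primrec g) :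
    Primrec fun a => (f a).getD (g a) := Primrec.option_getD.comp hf hg

@[fun_prop] theorem map_fun {f : α → List β} {g : α → β → γ} (hf : Primrec f)
    (hg : Primrec fun x : α × β => g x.1 x.2) : Primrec fun a => (f a).map (g a) :=
  Primrec.list_map hf hg

@[fun_prop] theorem flatMap_fun {f : α → List β} {g : α → β → List γ} (hf : Primrec f)
    (hg : Primrec fun x : α × β => g x.1 x.2) : Primrec fun a => (f a).flatMap (g a) :=
  Primrec.list_flatMap hf hg

@[fun_prop] theorem ite_fun {p : α → Prop} [DecidablePred p] {f g : α → β} (hp : PrimrecPred p)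
    (hf : Primrec f) (hg : Primrec g) : Primrec fun a => if p a then f a else g a :=
  Primrec.ite hp hf hg

@[fun_prop] theorem filter_fun {f : α → List β} {p : α → β → Prop} [∀ a b, Decidable (p a b)]
    (hf : Primrec f) (hp : PrimrecPred fun x : α × β => p x.1 x.2) :
    Primrec fun a => (f a).filter fun b => p a b := by
  have : Primrec fun a => (f a).flatMap fun b => if p a b then [b] else [] := by fun_prop
  refine this.of_eq fun a => ?_
  induction f a with
  | nil => rfl
  | cons b l ih => by_cases h : p a b <;> simp [h, ← ih]

@[fun_prop] theorem foldl_fun {f : α → List β} {g : α → γ} {h : α → γ → β → γ} (hf : Primrec f)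
    (hg : Primrec g) (hh : Primrec fun x : α × γ × β => h x.1 x.2.1 x.2.2) :
    Primrec fun a => (f a).foldl (h a) (g a) :=
  Primrec.list_foldl (h := fun a x => h a x.1 x.2) hf hg hh

@[fun_prop] theorem foldr_fun {f : α → List β} {g : α → γ} {h : α → β → γ → γ} (hf : Primrec f)
    (hg : Primrec g) (hh : Primrec fun x : α × β × γ => h x.1 x.2.1 x.2.2) :
    Primrec fun a => (f a).foldr (h a) (g a) :=
  Primrec.list_foldr (h := fun a x => h a x.1 x.2) hf hg hh

@[fun_prop] theorem natRec_fun {f : α → ℕ} {g : α → β} {h : α → ℕ → β → β} (hf : Primrec f)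
    (hg : Primrec g) (hh : Primrec fun x : α × ℕ × β => h x.1 x.2.1 x.2.2) :
    Primrec fun a => (Nat.rec (g a) (h a) (f a) : β) :=
  Primrec.nat_rec' (h := fun a x => h a x.1 x.2) hf hg hh

end Primrec

namespace PrimrecPred

variable {α β : Type*} [Primcodable α] [Primcodable β]

@[fun_prop] theorem eq_fun {f g : α → β} (hf : Primrec f) (hg : Primrec g) :
    PrimrecPred fun a => f a = g a := Primrec.eq.comp hf hg

@[fun_prop] theorem lt_fun {f g : α → ℕ} (hf : Primrec f) (hg : Primrec g) :
    PrimrecPred fun a => f a < g a := Primrec.nat_lt.comp hf hg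

@[fun_prop] theorem le_fun {f g : α → ℕ} (hf : Primrec f) (hg : Primrec g) :
    PrimrecPred fun a => f a ≤ g a := Primrec.nat_le.comp hf hg

@[fun_prop] theorem imp {p q : α → Prop} (hp : PrimrecPred p) (hq : PrimrecPred q) :
    PrimrecPred fun a => p a → q a := (hp.not.or hq).of_eq fun a => by tauto

@[fun_prop] theorem iff {p q : α → Prop} (hp : PrimrecPred p) (hq : PrimrecPred q) :
    PrimrecPred fun a => p a ↔ q a := ((hp.imp hq).and (hq.imp hp)).of_eq fun a => by tauto

@[fun_prop] theorem exists_mem_fun {f : α → List β} {p : α → β → Prop} (hf : Primrec f)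
    (hp : PrimrecPred fun x : α × β => p x.1 x.2) : PrimrecPred fun a => ∃ b ∈ f a, p a b :=
  (PrimrecRel.exists_mem_list (R := fun (b : β) (a : α) => p a b)
    (hp.comp (Primrec.snd.pair Primrec.fst))).comp hf Primrec.id

@[fun_prop] theorem forall_mem_fun {f : α → List β} {p : α → β → Prop} (hf : Primrec f)
    (hp : PrimrecPred fun x : α × β => p x.1 x.2) : PrimrecPred fun a => ∀ b ∈ f a, p a b :=
  (PrimrecRel.forall_mem_list (R := fun (b : β) (a : α) => p a b)
    (hp.comp (Primrec.snd.pair Primrec.fst))).comp hf Primrec.id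

@[fun_prop] theorem mem_fun {f : α → β} {g : α → List β} (hf : Primrec f) (hg : Primrec g) :
    PrimrecPred fun a => f a ∈ g a := by
  have : PrimrecPred fun a => ∃ b ∈ g a, b = f a := by fun_prop
  exact this.of_eq fun a => by simp

end PrimrecPred

/-- Finite sets of natural numbers are coded by their binary expansions. -/
instance primcodableFinset : Primcodable (Finset ℕ) := Primcodable.ofEquiv ℕ Finset.equivBitIndices.symm

namespace Primrec

variable {α : Type*} [Primcodable α]

@[fun_prop] theorem equivBitIndices_fun {f : α → ℕ} (hf : Primrec f) :
    Primrec fun a => Finset.equivBitIndices (f a) :=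
  (Primrec.of_equiv_symm (e := Finset.equivBitIndices.symm)).comp hf

@[fun_prop] theorem equivBitIndices_symm_fun {f : α → Finset ℕ} (hf : Primrec f) :
    Primrec fun a => Finset.equivBitIndices.symm (f a) :=
  (Primrec.of_equiv (e := Finset.equivBitIndices.symm)).comp hf

theorem mem_iff_bit (x : ℕ) (b : Finset ℕ) : x ∈ b ↔ Finset.equivBitIndices.symm b / 2 ^ x % 2 = 1 := by
  conv_lhs => rw [← Finset.equivBitIndices.apply_symm_apply b]
  rw [Finset.equivBitIndices_apply, List.mem_toFinset, Nat.mem_bitIndices,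
    Nat.testBit_eq_decide_div_mod_eq, decide_eq_true_eq]

@[fun_prop] theorem _root_.PrimrecPred.mem_finset_fun {f : α → ℕ} {g : α → Finset ℕ}
    (hf : Primrec f) (hg : Primrec g) : PrimrecPred fun a => f a ∈ g a := by
  have : PrimrecPred fun a => Finset.equivBitIndices.symm (g a) / 2 ^ f a % 2 = 1 := by fun_prop
  exact this.of_eq fun a => (mem_iff_bit _ _).symm

@[fun_prop] theorem erase_fun {f : α → Finset ℕ} {g : α → ℕ} (hf : Primrec f) (hg : Primrec g) :
    Primrec fun a => (f a).erase (g a) := by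
  have : Primrec fun a => Finset.equivBitIndices (if g a ∈ f a then
    Finset.equivBitIndices.symm (f a) - 2 ^ g a else Finset.equivBitIndices.symm (f a)) := by fun_prop
  refine this.of_eq fun a => ?_
  rw [← Equiv.eq_symm_apply]
  split_ifs with h
  · rw [Finset.equivBitIndices_symm_apply, Finset.equivBitIndices_symm_apply,
      ← Finset.sum_erase_add _ _ h, Nat.add_sub_cancel]
  · rw [Finset.erase_eq_of_notMem h]

@[fun_prop] theorem insert_fun {f : α → ℕ} {g : α → Finset ℕ} (hf : Primrec f) (hg : Primrec g) :
    Primrec fun a => insert (f a) (g a) := by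
  have : Primrec fun a => Finset.equivBitIndices (if f a ∈ g a then
    Finset.equivBitIndices.symm (g a) else 2 ^ f a + Finset.equivBitIndices.symm (g a)) := by fun_prop
  refine this.of_eq fun a => ?_
  rw [← Equiv.eq_symm_apply]
  split_ifs with h
  · rw [Finset.insert_eq_of_mem h]
  · rw [Finset.equivBitIndices_symm_apply, Finset.equivBitIndices_symm_apply, Finset.sum_insert h]

end Primrec

namespace Word

/-- Subsets of `Finset.range V` can thus be enumerated by the numbers below `2 ^ V`, which keeps the
enumeration of letters primitive recursive. -/
theorem equivBitIndices_subset {V n : ℕ} : Finset.equivBitIndices n ⊆ Finset.range V ↔ n < 2 ^ V := by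
  constructor
  · intro h
    have e := Finset.equivBitIndices.symm_apply_apply n
    rw [Finset.equivBitIndices_symm_apply] at e
    rw [← e]
    exact Nat.geomSum_lt le_rfl fun k hk => Finset.mem_range.1 (h hk)
  · intro h i hi
    rw [Finset.equivBitIndices_apply, List.mem_toFinset] at hi
    have := Nat.two_pow_le_of_mem_bitIndices hi
    exact Finset.mem_range.2 ((Nat.pow_lt_pow_iff_right (by omega)).1 (this.trans_lt h))

end Word

namespace MSO

@[fun_prop] theorem primrec_profCard : Primrec profCard := by
  unfold profCard
  fun_prop

theorem primrec_growth : Primrec fun p : ℕ × ℕ => growth p.1 p.2 := by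
  unfold growth
  fun_prop

@[fun_prop] theorem primrec_bound {α : Type*} [Primcodable α] {f g : α → ℕ} (hf : Primrec f)
    (hg : Primrec g) : Primrec fun a => bound (f a) (g a) :=
  Primrec.nat_iterate hg (Primrec.const 0)
    (primrec_growth.comp (Primrec.pair (hf.comp Primrec.fst) Primrec.snd))

end MSO

/-! ## Evaluation of formulas and of their congruences -/

/-- The lists of length at most `L` over a list of letters. -/
def listsUpTo {β : Type*} (l : List β) (L : ℕ) : List (List β) :=
  Nat.rec [[]] (fun _ s => [] :: l.flatMap fun p => s.map fun z => p :: z) L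

theorem mem_listsUpTo {β : Type*} {l : List β} {L : ℕ} {z : List β} :
    z ∈ listsUpTo l L ↔ z.length ≤ L ∧ ∀ p ∈ z, p ∈ l := by
  induction L generalizing z with
  | zero =>
    change z ∈ [[]] ↔ _
    simp only [List.mem_singleton, Nat.le_zero, List.length_eq_zero_iff]
    constructor
    · rintro rfl; simp
    · exact And.left
  | succ L ih =>
    change z ∈ [] :: l.flatMap (fun p => (listsUpTo l L).map fun z => p :: z) ↔ _
    cases z with
    | nil => simp
    | cons p z =>
      simp only [List.mem_cons, reduceCtorEq, false_or, List.mem_flatMap, List.mem_map,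
        List.cons.injEq, ih, List.length_cons, Nat.add_le_add_iff_right]
      constructor
      · rintro ⟨p, hp, z, ⟨h1, h2⟩, rfl, rfl⟩
        refine ⟨h1, ?_⟩
        rintro q (rfl | hq)
        exacts [hp, h2 q hq]
      · rintro ⟨h1, h2⟩
        exact ⟨p, h2 p (Or.inl rfl), z, ⟨h1, fun q hq => h2 q (Or.inr hq)⟩, rfl, rfl⟩

@[fun_prop] theorem primrec_listsUpTo {α β : Type*} [Primcodable α] [Primcodable β]
    {f : α → List β} {g : α → ℕ} (hf : Primrec f) (hg : Primrec g) :
    Primrec fun a => listsUpTo (f a) (g a) := by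
  unfold listsUpTo
  fun_prop

section Eval

variable {A : Type v}

/-- The letters with data values below `K` and variables below `V`. -/
def smallLetters (La : List A) (V K : ℕ) : List (ℕ × A × Finset ℕ) :=
  (List.range K).flatMap fun d => La.flatMap fun a => (List.range (2 ^ V)).map fun n =>
    (d, a, Finset.equivBitIndices n)

/-- The words of length at most `L` with data values below `K` and variables below `V`. -/
def smallWords (La : List A) (V K L : ℕ) : List (Word ℕ A) := listsUpTo (smallLetters La V K) L

theorem mem_smallWords {La : List A} (hLa : ∀ a, a ∈ La) {V K L : ℕ} {z : Word ℕ A} :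
    z ∈ smallWords La V K L ↔ Word.Small V K L z := by
  rw [smallWords, mem_listsUpTo, Word.Small]
  refine and_congr_right fun _ => forall₂_congr fun p _ => ?_
  obtain ⟨d, a, b⟩ := p
  simp only [smallLetters, List.mem_flatMap, List.mem_map, List.mem_range, Prod.mk.injEq]
  constructor
  · rintro ⟨d, hd, a, -, n, hn, rfl, rfl, rfl⟩
    exact ⟨hd, equivBitIndices_subset.2 hn⟩
  · rintro ⟨hd, hb⟩
    refine ⟨d, hd, a, hLa a, Finset.equivBitIndices.symm b, ?_, rfl, rfl, by simp⟩
    rw [← equivBitIndices_subset, Equiv.apply_symm_apply]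
    exact hb

/-- The tables of a formula: the words that satisfy it, and the pairs of congruent words. -/
abbrev Tab (A : Type v) := List (Word ℕ A) × List (Word ℕ A × Word ℕ A)

/-- The number of variables, the words for the congruence, those for satisfaction, and the
contexts. -/
abbrev Env (A : Type v) := ℕ × List (Word ℕ A) × List (Word ℕ A) × List (Word ℕ A)

/-- The table of the formula with code `e`. -/
def tabAt (T : List (Tab A)) (e : ℕ) : Tab A := T[e]?.getD ([], [])

/-- The positions `x` and `y` carry the same data value. -/
def simStep (x y : ℕ) (z : Word ℕ A) : Prop :=
  ∃ p ∈ z, ∃ q ∈ z, 2 * x ∈ p.2.2 ∧ 2 * y ∈ q.2.2 ∧ p.1 = q.1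

/-- Evaluation of a formula from the tables of its subformulas. -/
def holdsStep [Encodable A] (T : List (Tab A)) (t r : ℕ) (z : Word ℕ A) : Prop :=
  (t = 0 ∧ ∃ y ∈ (tabAt T r.unpair.2).1, er (2 * r.unpair.1) y = er (2 * r.unpair.1) z ∧
    cnt (2 * r.unpair.1) y = 1) ∨
  (t = 1 ∧ ∃ y ∈ (tabAt T r.unpair.2).1,
    er (2 * r.unpair.1 + 1) y = er (2 * r.unpair.1 + 1) z) ∨
  (t = 2 ∧ ∃ p ∈ z, 2 * r.unpair.2 ∈ p.2.2 ∧ Encodable.encode p.2.1 = r.unpair.1) ∨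
  (t = 3 ∧ ∃ i ∈ List.range (z.length + 1), 0 < cnt (2 * r.unpair.1) (z.take i) ∧
    0 < cnt (2 * r.unpair.2) (z.drop i)) ∨
  (t = 4 ∧ ∃ p ∈ z, 2 * r.unpair.1 ∈ p.2.2 ∧ 2 * r.unpair.2 + 1 ∈ p.2.2) ∨
  (t = 5 ∧ simStep r.unpair.1 r.unpair.2 z) ∨
  (t = 6 ∧ ¬ z ∈ (tabAt T r).1) ∨
  (t = 7 ∧ z ∈ (tabAt T r.unpair.1).1 ∧ z ∈ (tabAt T r.unpair.2).1)

/-- Comparison of the cardinalities of variables. -/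
def countStep (V : ℕ) (z z' : Word ℕ A) : Prop :=
  ∀ x ∈ List.range V, min 2 (cnt x z) = min 2 (cnt x z')

/-- One direction of the comparison of variants. -/
def liftStep (b : ℕ) (x : ℕ) (P : List (Word ℕ A)) (Q : List (Word ℕ A × Word ℕ A))
    (z z' : Word ℕ A) : Prop :=
  ∀ y ∈ P, er x y = er x z ∧ (b = 0 → cnt x y ≤ 1) →
    ∃ y' ∈ P, (er x y' = er x z' ∧ (b = 0 → cnt x y' ≤ 1)) ∧ (y, y') ∈ Q

/-- One direction of the comparison of data values. -/
def dataStep (x : ℕ) (z z' : Word ℕ A) : Prop :=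
  ∀ p ∈ z, x ∈ p.2.2 → ∃ q ∈ z', x ∈ q.2.2 ∧ q.1 = p.1

/-- Usefulness with respect to a list of contexts. -/
def usefulStep (H C : List (Word ℕ A)) (x y : ℕ) (z : Word ℕ A) : Prop :=
  ∃ u ∈ C, ∃ v ∈ C, u ++ z ++ v ∈ H ∧ cnt (2 * x) (u ++ z ++ v) = 1 ∧
    cnt (2 * y) (u ++ z ++ v) = 1

/-- The condition on the data values in the congruence of a guarded equality. -/
def guardStep (H C : List (Word ℕ A)) (x y : ℕ) (z z' : Word ℕ A) : Prop :=
  usefulStep H C x y z →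
    (cnt (2 * y) z = 0 → dataStep (2 * x) z z' ∧ dataStep (2 * x) z' z) ∧
    (cnt (2 * x) z = 0 → dataStep (2 * y) z z' ∧ dataStep (2 * y) z' z) ∧
    (simStep x y z ↔ simStep x y z')

/-- Evaluation of the congruence of a formula from the tables of its subformulas. -/
def congStep [Encodable A] (a : Env A) (T : List (Tab A)) (t r : ℕ) (z z' : Word ℕ A) : Prop :=
  (t = 0 ∧ countStep a.1 z z' ∧
    liftStep 0 (2 * r.unpair.1) a.2.1 (tabAt T r.unpair.2).2 z z' ∧
    liftStep 0 (2 * r.unpair.1) a.2.1 (tabAt T r.unpair.2).2 z' z) ∨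
  (t = 1 ∧ countStep a.1 z z' ∧
    liftStep 1 (2 * r.unpair.1 + 1) a.2.1 (tabAt T r.unpair.2).2 z z' ∧
    liftStep 1 (2 * r.unpair.1 + 1) a.2.1 (tabAt T r.unpair.2).2 z' z) ∨
  ((t = 2 ∨ t = 3 ∨ t = 4) ∧ countStep a.1 z z' ∧ (holdsStep T t r z ↔ holdsStep T t r z')) ∨
  (t = 5 ∧ countStep a.1 z z') ∨
  (t = 6 ∧ (z, z') ∈ (tabAt T r).2) ∨
  (t = 7 ∧ (z, z') ∈ (tabAt T r.unpair.1).2 ∧ (z, z') ∈ (tabAt T r.unpair.2).2 ∧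
    (r.unpair.2.unpair.1 = 5 → guardStep (tabAt T r.unpair.1).1 a.2.2.2
      r.unpair.2.unpair.2.unpair.1 r.unpair.2.unpair.2.unpair.2 z z'))

open Classical in
/-- The table of the next formula. -/
noncomputable def tabStep [Encodable A] (a : Env A) (T : List (Tab A)) : Tab A :=
  (a.2.2.1.filter fun z => holdsStep T T.length.unpair.1 T.length.unpair.2 z,
   (a.2.1.flatMap fun z => a.2.1.map fun z' => (z, z')).filter fun q =>
     congStep a T T.length.unpair.1 T.length.unpair.2 q.1 q.2)

/-- The tables of the formulas with codes below `n`. -/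
noncomputable def tabs [Encodable A] (a : Env A) (n : ℕ) : List (Tab A) :=
  Nat.rec [] (fun _ T => T ++ [tabStep a T]) n

end Eval

/-! ### Primitive recursiveness of the evaluation. -/

section Primrec

variable {A : Type v} [Primcodable A] {α : Type*} [Primcodable α]

@[fun_prop] theorem primrec_smallWords {La : List A} {f g h : α → ℕ} (hf : Primrec f)
    (hg : Primrec g) (hh : Primrec h) : Primrec fun a => smallWords La (f a) (g a) (h a) := by
  unfold smallWords smallLetters
  fun_prop

@[fun_prop] theorem primrec_er {f : α → ℕ} {g : α → Word ℕ A} (hf : Primrec f) (hg : Primrec g) :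
    Primrec fun a => er (f a) (g a) := by
  unfold er
  fun_prop

@[fun_prop] theorem primrec_cnt {f : α → ℕ} {g : α → Word ℕ A} (hf : Primrec f)
    (hg : Primrec g) : Primrec fun a => cnt (f a) (g a) := by
  have : Primrec fun a => ((g a).filter fun p => f a ∈ p.2.2).length := by fun_prop
  exact this.of_eq fun a => (List.countP_eq_length_filter ..).symm

@[fun_prop] theorem primrec_tabAt {f : α → List (Tab A)} {g : α → ℕ} (hf : Primrec f)
    (hg : Primrec g) : Primrec fun a => tabAt (f a) (g a) := by
  unfold tabAt
  fun_prop

@[fun_prop] theorem primrec_simStep {f g : α → ℕ} {h : α → Word ℕ A} (hf : Primrec f)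
    (hg : Primrec g) (hh : Primrec h) : PrimrecPred fun a => simStep (f a) (g a) (h a) := by
  unfold simStep
  fun_prop

@[fun_prop] theorem primrec_holdsStep {f : α → List (Tab A)} {g g' : α → ℕ} {h : α → Word ℕ A}
    (hf : Primrec f) (hg : Primrec g) (hg' : Primrec g') (hh : Primrec h) :
    PrimrecPred fun a => holdsStep (f a) (g a) (g' a) (h a) := by
  unfold holdsStep
  fun_prop

@[fun_prop] theorem primrec_countStep {f : α → ℕ} {g h : α → Word ℕ A} (hf : Primrec f)
    (hg : Primrec g) (hh : Primrec h) : PrimrecPred fun a => countStep (f a) (g a) (h a) := by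
  unfold countStep
  fun_prop

@[fun_prop] theorem primrec_liftStep {f f' : α → ℕ} {P : α → List (Word ℕ A)}
    {Q : α → List (Word ℕ A × Word ℕ A)} {g h : α → Word ℕ A} (hf : Primrec f) (hf' : Primrec f')
    (hP : Primrec P) (hQ : Primrec Q) (hg : Primrec g) (hh : Primrec h) :
    PrimrecPred fun a => liftStep (f a) (f' a) (P a) (Q a) (g a) (h a) := by
  unfold liftStep
  fun_prop

@[fun_prop] theorem primrec_dataStep {f : α → ℕ} {g h : α → Word ℕ A} (hf : Primrec f)
    (hg : Primrec g) (hh : Primrec h) : PrimrecPred fun a => dataStep (f a) (g a) (h a) := by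
  unfold dataStep
  fun_prop

@[fun_prop] theorem primrec_usefulStep {H C : α → List (Word ℕ A)} {f g : α → ℕ}
    {h : α → Word ℕ A} (hH : Primrec H) (hC : Primrec C) (hf : Primrec f)
    (hg : Primrec g) (hh : Primrec h) :
    PrimrecPred fun a => usefulStep (H a) (C a) (f a) (g a) (h a) := by
  unfold usefulStep
  fun_prop

@[fun_prop] theorem primrec_guardStep {H C : α → List (Word ℕ A)} {f g : α → ℕ}
    {h h' : α → Word ℕ A} (hH : Primrec H) (hC : Primrec C) (hf : Primrec f)
    (hg : Primrec g) (hh : Primrec h) (hh' : Primrec h') :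
    PrimrecPred fun a => guardStep (H a) (C a) (f a) (g a) (h a) (h' a) := by
  unfold guardStep
  fun_prop

@[fun_prop] theorem primrec_congStep {E : α → Env A} {f : α → List (Tab A)} {g g' : α → ℕ}
    {h h' : α → Word ℕ A} (hE : Primrec E) (hf : Primrec f) (hg : Primrec g) (hg' : Primrec g')
    (hh : Primrec h) (hh' : Primrec h') :
    PrimrecPred fun a => congStep (E a) (f a) (g a) (g' a) (h a) (h' a) := by
  unfold congStep
  fun_prop

@[fun_prop] theorem primrec_tabStep {E : α → Env A} {f : α → List (Tab A)} (hE : Primrec E)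
    (hf : Primrec f) : Primrec fun a => tabStep (E a) (f a) := by
  unfold tabStep
  fun_prop

@[fun_prop] theorem primrec_tabs {E : α → Env A} {f : α → ℕ} (hE : Primrec E)
    (hf : Primrec f) : Primrec fun a => tabs (E a) (f a) := by
  unfold tabs
  fun_prop

end Primrec

/-! ### Correctness of the evaluation on small words. -/

section Correctness

variable {D : Type u} {A : Type v}

variable {La : List A} {V N K : ℕ}

theorem countStep_iff {j : ℕ → D} {z z' : Word ℕ A} :
    countStep V z z' ↔ CountEq V (ren j z) (ren j z') := by
  simp only [countStep, CountEq, cnt_ren, List.mem_range]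

theorem dataStep_iff {j : ℕ → D} (hj : Function.Injective j) {x : ℕ} {z z' : Word ℕ A} :
    dataStep x z z' ∧ dataStep x z' z ↔ data x (ren j z) = data x (ren j z') := by
  have half : ∀ z z' : Word ℕ A, dataStep x z z' ↔ data x z ⊆ data x z' := by
    intro z z'
    constructor
    · rintro h _ ⟨p, hp, hx, rfl⟩
      exact h p hp hx
    · intro h p hp hx
      exact h ⟨p, hp, hx, rfl⟩
  rw [MSO.data_ren, MSO.data_ren, (Set.image_injective.2 hj).eq_iff, half, half]
  exact subset_antisymm_iff.symm

/-- A variant of a small word at a variable below `V` is small, since length and data values do not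
change; so the search through `P` is exhaustive. -/
theorem liftStep_iff {j : ℕ → D} {L : ℕ} {E : Word D A → Word D A → Prop} {n : ℕ} {b : Bool}
    (hb : n = 0 ↔ b = true) {x : ℕ} (hx : x < V) {P : List (Word ℕ A)}
    {Q : List (Word ℕ A × Word ℕ A)} (hP : ∀ z, z ∈ P ↔ Word.Small V K L z)
    (hQ : ∀ z z', (z, z') ∈ Q ↔
      (Word.Small V K L z ∧ Word.Small V K L z') ∧ E (ren j z) (ren j z'))
    {z z' : Word ℕ A} (hz : Word.Small V K L z) (hz' : Word.Small V K L z') :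
    liftStep n x P Q z z' ↔
      ∀ y, Variant b x (ren j z) y → ∃ y', Variant b x (ren j z') y' ∧ E y y' := by
  simp only [liftStep, hP, hQ, hb]
  constructor
  · intro H y hy
    obtain ⟨y, rfl, hv⟩ := variant_of_ren hy
    obtain ⟨y', h1, h2, -, h3⟩ := H y (hz.variant hx hv.1) hv
    exact ⟨ren j y', variant_self_ren j h2, h3⟩
  · intro H y hys hy
    obtain ⟨y', h1, h2⟩ := H (ren j y) (variant_self_ren j hy)
    obtain ⟨y', rfl, hv⟩ := variant_of_ren h1
    have := hz'.variant hx hv.1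
    exact ⟨y', this, hv, ⟨hys, this⟩, h2⟩

theorem profCard_mono : Monotone profCard := by
  intro n m h
  unfold profCard
  have h2 : 2 ^ n ≤ 2 ^ m := Nat.pow_le_pow_right (by omega) h
  exact Nat.mul_le_mul h (Nat.mul_le_mul
    ((Nat.pow_le_pow_left h2 n).trans (Nat.pow_le_pow_right (by positivity) h)) h2)

variable [Encodable A]

theorem length_tabs (a : Env A) (n : ℕ) : (tabs a n).length = n := by
  induction n with
  | zero => rfl
  | succ n ih =>
    change (tabs a n ++ [tabStep a (tabs a n)]).length = n + 1
    rw [List.length_append, ih, List.length_singleton]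

/-- This is course-of-values recursion: the entry for the code `e` is computed from the entries
below `e` and not changed afterwards. -/
theorem tabAt_tabs (a : Env A) {e n : ℕ} (h : e < n) :
    tabAt (tabs a n) e = tabStep a (tabs a e) := by
  induction n with
  | zero => omega
  | succ n ih =>
    change tabAt (tabs a n ++ [tabStep a (tabs a n)]) e = _
    have hl := length_tabs a n
    rcases Nat.lt_succ_iff_lt_or_eq.1 h with h | rfl
    · rw [← ih h, tabAt, tabAt, List.getElem?_append_left (by omega)]
    · rw [tabAt, List.getElem?_append_right (by omega), hl]
      simp

theorem mem_tabStep_fst {a : Env A} {t r : ℕ} {z : Word ℕ A} :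
    z ∈ (tabStep a (tabs a (Nat.pair t r))).1 ↔
      z ∈ a.2.2.1 ∧ holdsStep (tabs a (Nat.pair t r)) t r z := by
  simp [tabStep, length_tabs]

theorem mem_tabStep_snd {a : Env A} {t r : ℕ} {z z' : Word ℕ A} :
    (z, z') ∈ (tabStep a (tabs a (Nat.pair t r))).2 ↔
      (z ∈ a.2.1 ∧ z' ∈ a.2.1) ∧ congStep a (tabs a (Nat.pair t r)) t r z z' := by
  simp [tabStep, length_tabs]

/-- The environment for words of length at most `2 * N` with data values below `K`. -/
def envOf (La : List A) (V N K : ℕ) : Env A :=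
  (V, smallWords La V K (2 * N), smallWords La V (K + 2 * N) (4 * N),
    smallWords La V (K + 2 * N) N)

theorem holdsStep_lt_iff {T : List (Tab A)} {x y : ℕ} {z : Word ℕ A} :
    holdsStep T 3 (Nat.pair x y) z ↔ (MSO.lt x y : MSO A).Holds z := by
  simp only [holdsStep, Nat.unpair_pair, MSO.Holds]
  constructor
  · simp only [OfNat.ofNat_ne_zero, false_and, Nat.reduceEqDiff, false_or, true_and, or_false]
    rintro ⟨i, -, h1, h2⟩
    exact ⟨_, _, (List.take_append_drop i z).symm, h1, h2⟩
  · rintro ⟨z₁, z₂, rfl, h1, h2⟩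
    refine Or.inr (Or.inr (Or.inr (Or.inl ⟨trivial, z₁.length, ?_, ?_, ?_⟩)))
    · simp
    · simpa using h1
    · simpa using h2

theorem holdsStep_letter_iff {T : List (Tab A)} {a : A} {x : ℕ} {z : Word ℕ A} :
    holdsStep T 2 (Nat.pair (Encodable.encode a) x) z ↔ (MSO.letter a x).Holds z := by
  simp [holdsStep, MSO.Holds]

theorem holdsStep_mem_iff {T : List (Tab A)} {x X : ℕ} {z : Word ℕ A} :
    holdsStep T 4 (Nat.pair x X) z ↔ (MSO.mem x X : MSO A).Holds z := by
  simp [holdsStep, MSO.Holds]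

/-- The first component of the table of a formula. -/
theorem mem_tab_holds (hLa : ∀ a, a ∈ La) (φ : MSO A) : φ.Below V → ∀ z : Word ℕ A,
    (z ∈ (tabStep (envOf La V N K) (tabs (envOf La V N K) φ.code)).1 ↔
      Word.Small V (K + 2 * N) (4 * N) z ∧ φ.Holds z) := by
  set a := envOf La V N K with ha
  have mem : ∀ z, z ∈ a.2.2.1 ↔ Word.Small V (K + 2 * N) (4 * N) z := fun z =>
    mem_smallWords hLa
  induction φ with
  | exFO x φ ih =>
    intro hV z
    have hlt : φ.code < Nat.pair 0 (Nat.pair x φ.code) := MSO.code_lt_exFO x φ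
    rw [MSO.code, mem_tabStep_fst, mem]
    -- Variants of small words are small, so all witnesses of the quantifier appear in the table.
    refine and_congr_right fun hz => ?_
    simp only [holdsStep, Nat.unpair_pair, tabAt_tabs a hlt, ih hV.2, MSO.Holds, true_and,
      OfNat.zero_ne_ofNat, zero_ne_one, false_and, or_false]
    exact exists_congr fun y => ⟨fun h => ⟨h.2.1, h.2.2, h.1.2⟩,
      fun h => ⟨⟨hz.variant hV.1 h.1, h.2.2⟩, h.1, h.2.1⟩⟩
  | exSO X φ ih =>
    intro hV z
    have hlt : φ.code < Nat.pair 1 (Nat.pair X φ.code) := MSO.code_lt_exSO X φ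
    rw [MSO.code, mem_tabStep_fst, mem]
    refine and_congr_right fun hz => ?_
    simp only [holdsStep, Nat.unpair_pair, tabAt_tabs a hlt, ih hV.2, MSO.Holds, true_and,
      OfNat.one_ne_ofNat, one_ne_zero, false_and, or_false, false_or]
    exact exists_congr fun y => ⟨fun h => ⟨h.2, h.1.2⟩,
      fun h => ⟨⟨hz.variant hV.1 h.1, h.2⟩, h.1⟩⟩
  | letter b x =>
    intro hV z
    rw [MSO.code, mem_tabStep_fst, mem, holdsStep_letter_iff]
  | lt x y =>
    intro hV z
    rw [MSO.code, mem_tabStep_fst, mem, holdsStep_lt_iff]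
  | mem x X =>
    intro hV z
    rw [MSO.code, mem_tabStep_fst, mem, holdsStep_mem_iff]
  | sim x y =>
    intro hV z
    rw [MSO.code, mem_tabStep_fst, mem]
    simp [holdsStep, MSO.Holds, simStep]
  | neg φ ih =>
    intro hV z
    have hlt : φ.code < Nat.pair 6 φ.code := MSO.code_lt_neg φ
    rw [MSO.code, mem_tabStep_fst, mem]
    refine and_congr_right fun hz => ?_
    simp [holdsStep, tabAt_tabs a hlt, ih hV, MSO.Holds, hz]
  | conj φ ψ ih₁ ih₂ =>
    intro hV z
    have hlt : φ.code < Nat.pair 7 (Nat.pair φ.code ψ.code) := MSO.code_lt_conj_left φ ψ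
    have hlt' : ψ.code < Nat.pair 7 (Nat.pair φ.code ψ.code) := MSO.code_lt_conj_right φ ψ
    rw [MSO.code, mem_tabStep_fst, mem]
    refine and_congr_right fun hz => ?_
    simp [holdsStep, tabAt_tabs a hlt, tabAt_tabs a hlt', ih₁ hV.1, ih₂ hV.2, MSO.Holds, hz]

/-- The second component of the table of a rigidly guarded formula. -/
theorem mem_tab_cong (hLa : ∀ a, a ∈ La) {φ : MSO A} (h : φ.RigidlyGuarded D)
    {j : ℕ → D} (hj : Function.Injective j) :
    φ.Below V → profCard (MSO.bound V φ.code) ≤ N → ∀ z z' : Word ℕ A,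
    ((z, z') ∈ (tabStep (envOf La V N K) (tabs (envOf La V N K) φ.code)).2 ↔
      (Word.Small V K (2 * N) z ∧ Word.Small V K (2 * N) z') ∧
        φ.Cong V (ren j z) (ren j z')) := by
  set a := envOf La V N K with ha
  have mem : ∀ z, z ∈ a.2.1 ↔ Word.Small V K (2 * N) z := fun z => mem_smallWords hLa
  have ha1 : a.1 = V := rfl
  have mono : ∀ {c c' : ℕ}, c < c' → profCard (MSO.bound V c') ≤ N →
      profCard (MSO.bound V c) ≤ N := fun hc hN =>
    (profCard_mono (MSO.bound_mono V hc.le)).trans hN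
  induction h with
  | @exFO x φ hφ ih =>
    intro hV hN z z'
    have hlt : φ.code < Nat.pair 0 (Nat.pair x φ.code) := MSO.code_lt_exFO x φ
    have ih := ih hV.2 (mono hlt hN)
    rw [MSO.code, mem_tabStep_snd, mem, mem]
    refine and_congr_right fun hz => ?_
    have hE := (hφ.cong hV.2).1
    have l := liftStep_iff (b := true) (n := 0) (by simp) hV.1 mem ih hz.1 hz.2
    have l' := liftStep_iff (b := true) (n := 0) (by simp) hV.1 mem ih hz.2 hz.1
    simp only [congStep, Nat.unpair_pair, tabAt_tabs a hlt, true_and,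
      OfNat.zero_ne_ofNat, zero_ne_one, false_and, or_false, MSO.Cong]
    -- The second search runs from `z'` to `z` and yields pairs in reverse order, hence the appeal
    -- to symmetry.
    refine and_congr countStep_iff (and_congr l (l'.trans ?_))
    exact forall₂_congr fun y _ => exists_congr fun y' =>
      and_congr_right fun _ => ⟨hE.symm, hE.symm⟩
  | @exSO X φ hφ ih =>
    intro hV hN z z'
    have hlt : φ.code < Nat.pair 1 (Nat.pair X φ.code) := MSO.code_lt_exSO X φ
    have ih := ih hV.2 (mono hlt hN)
    rw [MSO.code, mem_tabStep_snd, mem, mem]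
    refine and_congr_right fun hz => ?_
    have hE := (hφ.cong hV.2).1
    have l := liftStep_iff (b := false) (n := 1) (by simp) hV.1 mem ih hz.1 hz.2
    have l' := liftStep_iff (b := false) (n := 1) (by simp) hV.1 mem ih hz.2 hz.1
    simp only [congStep, Nat.unpair_pair, tabAt_tabs a hlt, true_and, OfNat.one_ne_ofNat,
      one_ne_zero, false_and, or_false, false_or, MSO.Cong]
    refine and_congr countStep_iff (and_congr l (l'.trans ?_))
    exact forall₂_congr fun y _ => exists_congr fun y' =>
      and_congr_right fun _ => ⟨hE.symm, hE.symm⟩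
  | letter b x =>
    intro hV hN z z'
    rw [MSO.code, mem_tabStep_snd, mem, mem]
    simp [congStep, holdsStep_letter_iff, MSO.Cong, MSO.holds_ren hj, countStep_iff (j := j), ha1]
  | lt x y =>
    intro hV hN z z'
    rw [MSO.code, mem_tabStep_snd, mem, mem]
    simp [congStep, holdsStep_lt_iff, MSO.Cong, MSO.holds_ren hj, countStep_iff (j := j), ha1]
  | mem x X =>
    intro hV hN z z'
    rw [MSO.code, mem_tabStep_snd, mem, mem]
    simp [congStep, holdsStep_mem_iff, MSO.Cong, MSO.holds_ren hj, countStep_iff (j := j), ha1]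
  | @neg φ hφ ih =>
    intro hV hN z z'
    have hlt : φ.code < Nat.pair 6 φ.code := MSO.code_lt_neg φ
    have ih := ih hV (mono hlt hN)
    rw [MSO.code, mem_tabStep_snd, mem, mem]
    refine and_congr_right fun hz => ?_
    simp [congStep, tabAt_tabs a hlt, ih, hz, MSO.Cong]
  | @conj φ ψ hφ hψ ih₁ ih₂ =>
    intro hV hN z z'
    have hlt : φ.code < Nat.pair 7 (Nat.pair φ.code ψ.code) := MSO.code_lt_conj_left φ ψ
    have hlt' : ψ.code < Nat.pair 7 (Nat.pair φ.code ψ.code) := MSO.code_lt_conj_right φ ψ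
    have ih₁ := ih₁ hV.1 (mono hlt hN)
    have ih₂ := ih₂ hV.2 (mono hlt' hN)
    have hne : ∀ x y, ψ ≠ MSO.sim x y := by rintro x y rfl; cases hψ
    -- The tag `5` belongs to equality tests, which are not rigidly guarded by themselves, so the
    -- guard clause is vacuous.
    have h5 : ψ.code.unpair.1 ≠ 5 := by cases hψ <;> simp [MSO.code]
    rw [MSO.cong_conj_of_ne hne, MSO.code, mem_tabStep_snd, mem, mem]
    refine and_congr_right fun hz => ?_
    simp [congStep, tabAt_tabs a hlt, tabAt_tabs a hlt', ih₁, ih₂, hz, h5]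
  | @guardedSim φ x y hφ hxy hf hr ih =>
    intro hV hN z z'
    have hlt : φ.code < Nat.pair 7 (Nat.pair φ.code (Nat.pair 5 (Nat.pair x y))) :=
      MSO.code_lt_conj_left φ (MSO.sim x y)
    have hlt' : Nat.pair 5 (Nat.pair x y) < Nat.pair 7 (Nat.pair φ.code (Nat.pair 5 (Nat.pair x y))) :=
      MSO.code_lt_conj_right φ (MSO.sim x y)
    have hN' := mono hlt hN
    have ih := ih hV.1 hN'
    obtain ⟨hE, hP⟩ := hφ.cong hV.1
    -- This is the reason for the larger satisfaction table: two contexts of length `N` around a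
    -- word of length `2 * N` give `4 * N`, with data values below `K + 2 * N`.
    have hu : ∀ z, Word.Small V K (2 * N) z →
        (usefulStep (tabStep a (tabs a φ.code)).1 a.2.2.2 x y z ↔ φ.Useful x y (ren j z)) := by
      intro z hz
      rw [MSO.useful_ren_iff_small hE (hφ.memCode hV.1) hN' hV.1 hP hf hV.2.1 hV.2.2 hj hz]
      have memC : ∀ z, z ∈ a.2.2.2 ↔ Word.Small V (K + 2 * N) N z := fun z => mem_smallWords hLa
      have memH := mem_tab_holds (N := N) (K := K) hLa φ hV.1
      rw [← ha] at memH
      simp only [usefulStep, memC, memH]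
      constructor
      · rintro ⟨u, hu, v, hv, ⟨-, h1⟩, h2⟩
        exact ⟨u, v, hu, hv, h1, h2⟩
      · rintro ⟨u, v, hu, hv, h1, h2⟩
        refine ⟨u, hu, v, hv, ⟨?_, h1⟩, h2⟩
        refine ((hu.append (hz.mono ?_ le_rfl)).append hv).mono le_rfl ?_ <;> omega
    rw [MSO.cong_conj_sim hE, MSO.code, MSO.code, mem_tabStep_snd, mem, mem]
    refine and_congr_right fun hz => ?_
    -- The bare equality test is not rigidly guarded, so no induction hypothesis covers its table
    -- entry, which is computed directly.
    have h5 : (z, z') ∈ (tabStep a (tabs a (Nat.pair 5 (Nat.pair x y)))).2 ↔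
        CountEq V (ren j z) (ren j z') := by
      rw [mem_tabStep_snd, mem, mem]
      simp [congStep, hz, countStep_iff (j := j), ha1]
    have hs : ∀ z : Word ℕ A, simStep x y z ↔ (MSO.sim x y : MSO A).Holds (ren j z) := fun z => by
      rw [MSO.holds_ren hj]; rfl
    simp only [congStep, Nat.unpair_pair, tabAt_tabs a hlt, tabAt_tabs a hlt', ih, h5, hz,
      and_self, true_and, guardStep, hu _ hz.1, dataStep_iff hj, hs, MSO.Guard, cnt_ren,
      OfNat.ofNat_ne_zero, OfNat.ofNat_ne_one, Nat.reduceEqDiff, false_and, or_self, false_or,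
      forall_const]
    exact ⟨fun h => ⟨h.1, h.2.2⟩, fun h => ⟨h.1, hE.count h.1, h.2⟩⟩

end Correctness

/-! ## The quotient data monoid -/

/-- A word with its letters replaced. -/
def relabel {D B B' : Type*} (c : B → B') (z : List (D × B)) : List (D × B') :=
  z.map fun p => (p.1, c p.2)

namespace Word

variable {D : Type u} {A B : Type v} {V : ℕ}

theorem relabel_append {B' : Type*} (c : B → B') (y z : List (D × B)) :
    relabel c (y ++ z) = relabel c y ++ relabel c z := List.map_append

theorem relabel_ren {B' : Type*} (c : B → B') (g : D → D) (z : List (D × B)) :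
    relabel c (ren g z) = ren g (relabel c z) := by
  simp [relabel, ren]

theorem relabel_rep {B' : Type*} (c : B → B') (n : ℕ) (z : List (D × B)) :
    relabel c (rep n z) = rep n (relabel c z) := by
  induction n with
  | zero => rfl
  | succ n ih => rw [rep_succ, rep_succ, relabel_append, ih]

theorem exists_relabel_eq {B' : Type*} {c : B → B'} {z : List (D × B')}
    (h : ∀ p ∈ z, ∃ b, c b = p.2) : ∃ y : List (D × B), relabel c y = z := by
  induction z with
  | nil => exact ⟨[], rfl⟩
  | cons p z ih =>
    obtain ⟨y, rfl⟩ := ih fun q hq => h q (List.mem_cons_of_mem _ hq)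
    obtain ⟨b, hb⟩ := h p List.mem_cons_self
    exact ⟨(p.1, b) :: y, by simp [relabel, hb]⟩

namespace Nice

variable {E : Word D A → Word D A → Prop}

/-- The pullback of a congruence along a relabeling of letters. -/
def con (hE : Nice V E) (c : B → A × Finset ℕ) : Con (FreeMonoid (D × B)) where
  r y z := E (relabel c (FreeMonoid.toList y)) (relabel c (FreeMonoid.toList z))
  iseqv := ⟨fun _ => hE.refl _, fun h => hE.symm h, fun h h' => hE.trans h h'⟩
  mul' h h' := by
    rw [FreeMonoid.toList_mul, FreeMonoid.toList_mul, relabel_append, relabel_append]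
    exact hE.append h h'

theorem toList_smul (g : Equiv.Perm D) (z : FreeMonoid (D × B)) :
    FreeMonoid.toList (g • z) = _root_.ren g (FreeMonoid.toList z) := rfl

theorem con_smul (hE : Nice V E) (c : B → A × Finset ℕ) (g : Equiv.Perm D)
    {y z : FreeMonoid (D × B)} (h : hE.con c y z) : hE.con c (g • y) (g • z) := by
  change E _ _
  rw [toList_smul, toList_smul, relabel_ren, relabel_ren]
  exact hE.ren g h

/-- The action of the renamings on the quotient. -/
abbrev quotientAction (hE : Nice V E) (c : B → A × Finset ℕ) :
    MulDistribMulAction (Equiv.Perm D) (hE.con c).Quotient where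
  smul g := Quotient.map (g • ·) fun _ _ h => hE.con_smul c g h
  one_smul s := by
    induction s using Con.induction_on with
    | H z => exact congrArg _ (one_smul (Equiv.Perm D) z)
  mul_smul g h s := by
    induction s using Con.induction_on with
    | H z => exact congrArg _ (mul_smul g h z)
  smul_mul g s t := by
    induction s using Con.induction_on with
    | H y =>
      induction t using Con.induction_on with
      | H z => exact congrArg _ (smul_mul' g y z)
  smul_one g := congrArg _ (smul_one g)

/-- The data monoid of congruence classes. -/
def dataMonoid (hE : Nice V E) (c : B → A × Finset ℕ) : DataMonoid.{u, max u v} D :=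
  letI := hE.quotientAction c
  { carrier := (hE.con c).Quotient
    finite_memory := fun s => by
      induction s using Con.induction_on with
      | H z =>
        obtain ⟨C, hC⟩ := (freeDataMonoid D B).finite_memory z
        exact ⟨C, fun g hg => congrArg _ (hC g hg)⟩ }

/-- The quotient morphism. -/
def hom (hE : Nice V E) (c : B → A × Finset ℕ) :
    (freeDataMonoid D B).Hom (hE.dataMonoid c) where
  toMonoidHom := (hE.con c).mk'
  map_smul' _ _ := rfl

/-- The class of a word with letters in the range of `c`. -/
def IsClass (hE : Nice V E) (c : B → A × Finset ℕ) (s : hE.dataMonoid c) (z : Word D A) : Prop :=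
  ∃ y, (hE.hom c).onWord y = s ∧ relabel c y = z

variable {hE : Nice V E} {c : B → A × Finset ℕ} {s t : hE.dataMonoid c} {y z : Word D A}

theorem onWord_eq_iff {y z : List (D × B)} :
    (hE.hom c).onWord y = (hE.hom c).onWord z ↔ E (relabel c y) (relabel c z) :=
  (hE.con c).eq

theorem onWord_append (y z : List (D × B)) :
    (hE.hom c).onWord (y ++ z) = (hE.hom c).onWord y * (hE.hom c).onWord z := rfl

theorem smul_onWord (g : Equiv.Perm D) (z : List (D × B)) :
    g • (hE.hom c).onWord z = (hE.hom c).onWord (_root_.ren g z) := rfl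

theorem exists_onWord (s : hE.dataMonoid c) : ∃ z, (hE.hom c).onWord z = s := by
  induction s using Con.induction_on with
  | H z => exact ⟨FreeMonoid.toList z, rfl⟩

theorem IsClass.eq_iff (h : hE.IsClass c s y) (h' : hE.IsClass c t z) : s = t ↔ E y z := by
  obtain ⟨y, rfl, rfl⟩ := h
  obtain ⟨z, rfl, rfl⟩ := h'
  exact onWord_eq_iff

theorem IsClass.mul (h : hE.IsClass c s y) (h' : hE.IsClass c t z) :
    hE.IsClass c (s * t) (y ++ z) := by
  obtain ⟨y, rfl, rfl⟩ := h
  obtain ⟨z, rfl, rfl⟩ := h'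
  exact ⟨y ++ z, onWord_append _ _, relabel_append _ _ _⟩

theorem IsClass.smul (h : hE.IsClass c s y) (g : Equiv.Perm D) :
    hE.IsClass c (g • s) (_root_.ren g y) := by
  obtain ⟨y, rfl, rfl⟩ := h
  exact ⟨_root_.ren g y, (smul_onWord _ _).symm, relabel_ren _ _ _⟩

theorem exists_isClass (h : ∀ p ∈ z, ∃ b, c b = p.2) : ∃ s, hE.IsClass c s z := by
  obtain ⟨y, rfl⟩ := exists_relabel_eq h
  exact ⟨_, y, rfl, rfl⟩

theorem isClass_onWord (y : List (D × B)) :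
    hE.IsClass c ((hE.hom c).onWord y) (relabel c y) := ⟨y, rfl, rfl⟩

theorem IsClass.letters (h : hE.IsClass c s z) : ∀ p ∈ z, ∃ b, c b = p.2 := by
  obtain ⟨y, rfl, rfl⟩ := h
  intro p hp
  obtain ⟨q, -, rfl⟩ := List.mem_map.1 hp
  exact ⟨q.2, rfl⟩

/-- An orbit is determined by the profile of any word that represents one of its elements. -/
theorem orbitFinite {n : ℕ} (hn : MemCode E n) : (hE.dataMonoid c).OrbitFinite := by
  obtain ⟨π, hπ⟩ := hn.orbit
  have ex : ∀ o : MulAction.orbitRel.Quotient (Equiv.Perm D) (hE.dataMonoid c),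
      ∃ y, (Quotient.mk _ ((hE.hom c).onWord y) :
        MulAction.orbitRel.Quotient (Equiv.Perm D) (hE.dataMonoid c)) = o := by
    intro o
    induction o using Quotient.inductionOn with
    | h s =>
      obtain ⟨y, rfl⟩ := exists_onWord s
      exact ⟨y, rfl⟩
  choose f hf using ex
  refine Finite.of_injective (fun o => π (relabel c (f o))) fun o o' h => ?_
  obtain ⟨g, hg⟩ := hπ _ _ h
  rw [← hf o, ← hf o']
  refine (Quotient.sound (MulAction.orbitRel_apply.2 (MulAction.mem_orbit_iff.2 ⟨g, ?_⟩))).symm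
  rw [smul_onWord, onWord_eq_iff, relabel_ren]
  exact hg

theorem aperiodic (h : ∀ z, ∃ N, ∀ n ≥ N, E (rep (n + 1) z) (rep n z)) :
    (hE.dataMonoid c).Aperiodic := by
  intro s
  obtain ⟨y, rfl⟩ := exists_onWord s
  have hp : ∀ n, (hE.hom c).onWord y ^ n = (hE.hom c).onWord (rep n y) := by
    intro n
    induction n with
    | zero => rfl
    | succ n ih => rw [rep_succ, onWord_append, pow_succ', ih]
  obtain ⟨N, hN⟩ := h (relabel c y)
  refine ⟨N, ?_⟩
  rw [hp, hp, onWord_eq_iff, relabel_rep, relabel_rep]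
  exact hN N le_rfl

/-- The accepting set given by an invariant property of words. -/
def accept (hE : Nice V E) (c : B → A × Finset ℕ) (P : Word D A → Prop) :
    Set (hE.dataMonoid c) := {s | ∃ z, hE.IsClass c s z ∧ P z}

theorem IsClass.mem_accept {P : Word D A → Prop} (hP : ∀ y z, E y z → P y → P z)
    (h : hE.IsClass c s z) : s ∈ hE.accept c P ↔ P z :=
  ⟨fun ⟨_, h', hy⟩ => hP _ _ ((h'.eq_iff h).1 rfl) hy, fun hz => ⟨z, h, hz⟩⟩

theorem recognizes {P : Word D A → Prop} (hP : ∀ y z, E y z → P y → P z)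
    (hr : ∀ (g : Equiv.Perm D) z, P z → P (_root_.ren g z)) {L : Set (List (D × B))}
    (hL : ∀ y, y ∈ L ↔ P (relabel c y)) : (hE.hom c).Recognizes (hE.accept c P) L := by
  refine ⟨?_, fun y => (hL y).trans ((isClass_onWord y).mem_accept hP).symm⟩
  rintro g s ⟨z, hz, hPz⟩
  exact ⟨_, hz.smul g, hr g z hPz⟩

/-- A renaming that fixes all data values of a representative fixes the representative. -/
theorem supports_of_isClass (h : hE.IsClass c s z) {S : Set D} (hS : ∀ p ∈ z, p.1 ∈ S) :
    MulAction.Supports (Equiv.Perm D) S s := by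
  intro g hg
  refine ((h.smul g).eq_iff h).2 ?_
  rw [show _root_.ren g z = z from (ren_congr fun p hp => hg (hS p hp)).trans (ren_id z)]
  exact hE.refl z

/-- Shortening introduces no new letters, so the short word still comes from the alphabet of the
monoid, as `IsClass` requires. -/
theorem exists_isClass_short {n : ℕ} (hn : MemCode E n) (s : hE.dataMonoid c) :
    ∃ z, hE.IsClass c s z ∧ z.length ≤ profCard n := by
  obtain ⟨y, rfl⟩ := exists_onWord s
  obtain ⟨z, h1, h2, h3⟩ := hE.exists_short hn (relabel c y)
  have hl : ∀ p ∈ z, ∃ b, c b = p.2 := by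
    intro p hp
    obtain ⟨q, hq, he⟩ := h3 p hp
    obtain ⟨r, -, rfl⟩ := List.mem_map.1 hq
    exact ⟨r.2, he⟩
  obtain ⟨t, ht⟩ := exists_isClass (hE := hE) hl
  rw [((isClass_onWord (hE := hE) (c := c) y).eq_iff ht).2 h1]
  exact ⟨z, ht, h2⟩

end Nice

/-! ### Supports detected by shifting data values. -/

/-- Two injective sequences of the same length differ by a permutation. -/
theorem exists_perm_of_seq {m : ℕ} {f f' : ℕ → D} (hf : Set.InjOn f (Set.Iio m))
    (hf' : Set.InjOn f' (Set.Iio m)) : ∃ g : Equiv.Perm D, ∀ i < m, g (f i) = f' i := by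
  have h := Equiv.Perm.isMultiplyPretransitive D m
  obtain ⟨g, hg⟩ := h.exists_smul_eq
    (⟨fun i => f i, fun i j hij => Fin.ext (hf i.2 j.2 hij)⟩ : Fin m ↪ D)
    (⟨fun i => f' i, fun i j hij => Fin.ext (hf' i.2 j.2 hij)⟩ : Fin m ↪ D)
  exact ⟨g, fun i hi => DFunLike.congr_fun hg ⟨i, hi⟩⟩

/-- Shifts the data values outside the first `k` by `N`. -/
def shift (k N d : ℕ) : ℕ := if d < k then d else d + N

theorem shift_injective (k N : ℕ) : Function.Injective (shift k N) := by
  intro a b h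
  unfold shift at h
  split_ifs at h <;> omega

namespace Nice

variable {E : Word D A → Word D A → Prop} {hE : Nice V E} {c : B → A × Finset ℕ}
  {s : hE.dataMonoid c}

/-- On the finitely many data values of `z` the shift agrees with a permutation that fixes the first
`k` values, and such a permutation fixes `s`. -/
theorem rel_shift_of_supports {j : ℕ → D} (hj : Function.Injective j) {k N : ℕ} {z : Word ℕ A}
    (hz : ∀ p ∈ z, p.1 < k + N) (h : hE.IsClass c s (_root_.ren j z))
    (hs : MulAction.Supports (Equiv.Perm D) (Set.range fun i : Fin k => j i) s) :
    E (_root_.ren j z) (_root_.ren j (_root_.ren (shift k N) z)) := by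
  obtain ⟨g, hg⟩ := exists_perm_of_seq (m := k + N) (f := j) (f' := fun i => j (shift k N i))
    hj.injOn (hj.comp (shift_injective k N)).injOn
  have hgs : g • s = s := hs g (by
    rintro _ ⟨i, rfl⟩
    have := hg i (by omega)
    rw [shift, if_pos i.2] at this
    exact this)
  have key : _root_.ren g (_root_.ren j z) = _root_.ren j (_root_.ren (shift k N) z) := by
    rw [ren_ren, ren_ren]
    exact ren_congr fun p hp => hg _ (hz p hp)
  rw [← key]
  exact (h.eq_iff (h.smul g)).1 hgs.symm

/-- Let `g` fix the first `k` values, let `w` represent `s` and let `w'` be its shifted copy. A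
permutation `q` that fixes `w` moves the fresh values of `w'` away from those of `g w`, so `w` is
congruent to `q w'`. A permutation `p` that acts as `g` on `w` and fixes `q w'` then shows that `g
w` is congruent to `q w'`, hence to `w`. -/
theorem supports_of_rel_shift {j : ℕ → D} (hj : Function.Injective j) {k N : ℕ} {z : Word ℕ A}
    (hz : ∀ p ∈ z, p.1 < k + N) (h : hE.IsClass c s (_root_.ren j z))
    (he : E (_root_.ren j z) (_root_.ren j (_root_.ren (shift k N) z))) :
    MulAction.Supports (Equiv.Perm D) (Set.range fun i : Fin k => j i) s := by
  intro g hg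
  have hgk : ∀ i < k, g (j i) = j i := fun i hi => hg ⟨⟨i, hi⟩, rfl⟩
  -- From `M` on, the values of `j` avoid the finitely many images under `g` that matter.
  obtain ⟨M, hM⟩ : ∃ M, ∀ m ≥ M, ∀ i < k + N, j m ≠ g (j i) := by
    have hfin : {m | ∃ i < k + N, j m = g (j i)}.Finite := by
      refine Set.Finite.subset (((Set.finite_Iio (k + N)).image fun i => g (j i)).preimage
        hj.injOn) ?_
      rintro m ⟨i, hi, he⟩
      exact ⟨i, hi, he.symm⟩
    obtain ⟨M, hM⟩ := hfin.bddAbove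
    refine ⟨M + 1, fun m hm i hi hmi => ?_⟩
    have := hM ⟨i, hi, hmi⟩
    omega
  let f : ℕ → D := fun i => if i < k + N then j i else j (i + M)
  have hf : Function.Injective f := by
    intro a b hab
    simp only [f] at hab
    split_ifs at hab <;> have := hj hab <;> omega
  obtain ⟨q, hq⟩ := exists_perm_of_seq (m := k + N + N) (f := j) (f' := f) hj.injOn hf.injOn
  obtain ⟨p, hp⟩ := exists_perm_of_seq (m := k + N + N) (f := f)
    (f' := fun i => if i < k + N then g (j i) else j (i + M)) hf.injOn (by
      intro a _ b _ hab
      by_cases ha : a < k + N <;> by_cases hb : b < k + N <;> simp only [ha, hb, if_true,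
        if_false] at hab
      · exact hj (g.injective hab)
      · exact (hM _ (by omega) _ ha hab.symm).elim
      · exact (hM _ (by omega) _ hb hab).elim
      · have := hj hab
        omega)
  set w := _root_.ren j z with hw
  set w' := _root_.ren j (_root_.ren (shift k N) z) with hw'
  have hqw : _root_.ren q w = w := by
    rw [hw, ren_ren]
    refine ren_congr fun r hr => ?_
    have h1 := hz r hr
    have h2 := hq r.1 (by omega)
    simpa only [f, h1, if_true, Function.comp_apply] using h2
  have hpw : _root_.ren p w = _root_.ren g w := by
    rw [hw, ren_ren, ren_ren]
    refine ren_congr fun r hr => ?_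
    have h1 := hz r hr
    have h2 := hp r.1 (by omega)
    simpa only [f, h1, if_true, Function.comp_apply] using h2
  have hpq : _root_.ren p (_root_.ren q w') = _root_.ren q w' := by
    simp only [hw', ren_ren]
    refine ren_congr fun r hr => ?_
    have h1 := hz r hr
    have h2 : shift k N r.1 < k + N + N := by unfold shift; split_ifs <;> omega
    simp only [Function.comp_apply, hq _ h2, hp _ h2]
    simp only [f]
    -- A shifted value is either below `k`, where `g` is the identity, or at least `k + N`, where
    -- `q` has moved it away.
    by_cases h3 : shift k N r.1 < k + N
    · have h4 : shift k N r.1 < k := by unfold shift at h3 ⊢; split_ifs at h3 ⊢ <;> omega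
      simp only [h3, if_true, hgk _ h4]
    · simp only [h3, if_false]
  have e1 : E w (_root_.ren q w') := by
    have := hE.ren q he
    rwa [hqw] at this
  have e2 : E (_root_.ren g w) (_root_.ren q w') := by
    have := hE.ren p e1
    rwa [hpw, hpq] at this
  exact ((h.smul g).eq_iff h).2 (hE.trans e2 (hE.symm e1))

/-- A short representative is renamed into the initial segment by a permutation that fixes the first
`k` values; this does not change its class. -/
theorem exists_isClass_small {n : ℕ} (hn : MemCode E n) {j : ℕ → D} (hj : Function.Injective j)
    {k : ℕ} (hs : MulAction.Supports (Equiv.Perm D) (Set.range fun i : Fin k => j i) s) :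
    ∃ z : Word ℕ A, hE.IsClass c s (_root_.ren j z) ∧ z.length ≤ profCard n ∧
      ∀ p ∈ z, p.1 < k + profCard n := by
  classical
  obtain ⟨w, hw, hl⟩ := exists_isClass_short hn s
  obtain ⟨g, hg, hg'⟩ := exists_perm_into hj k ((w.map Prod.fst).toFinset)
  have hcard := card_dataValues_le w
  obtain ⟨z, h1, h2, -⟩ := exists_ren_eq (j := j) (K := k + profCard n) (z := _root_.ren g w) (by
    intro p hp
    obtain ⟨q, hq, rfl⟩ := List.mem_map.1 hp
    obtain ⟨i, hi, he⟩ := hg' q.1 (List.mem_toFinset.2 (List.mem_map_of_mem hq))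
    exact ⟨i, by omega, he⟩)
  have hgs : g • s = s := hs g (by
    rintro _ ⟨i, rfl⟩
    exact hg i i.2)
  refine ⟨z, ?_, ?_, h2⟩
  · rw [h1, ← hgs]
    exact hw.smul g
  · rw [← length_ren j, h1, length_ren]
    exact hl

end Nice

end Word

/-! ## Computation of finite representations -/

section Tables

variable {A : Type v}

open Classical in
/-- Representatives of the members of a list with respect to a table of an equivalence relation. -/
noncomputable def representatives {β : Type*} (Q : List (β × β)) (l : List β) : List β :=
  l.foldl (fun s z => if ∃ y ∈ s, (y, z) ∈ Q then s else s ++ [z]) []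

/-- In the greedy scan an element is added only if no chosen one is related to it. No property of an
equivalence relation is needed beyond reflexivity at the element in question. -/
theorem representatives_spec {β : Type*} (Q : List (β × β)) (l : List β) :
    (∀ y ∈ representatives Q l, y ∈ l) ∧
    (∀ z ∈ l, (z, z) ∈ Q → ∃ y ∈ representatives Q l, (y, z) ∈ Q) ∧
    (representatives Q l).Pairwise fun y z => (y, z) ∉ Q := by
  classical
  induction l using List.reverseRecOn with
  | nil => simp [representatives]
  | append_singleton l x ih =>
    obtain ⟨h1, h2, h3⟩ := ih
    have e : representatives Q (l ++ [x]) = if ∃ y ∈ representatives Q l, (y, x) ∈ Q then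
        representatives Q l else representatives Q l ++ [x] := by
      rw [representatives, List.foldl_append]
      rfl
    rw [e]
    split_ifs with hx
    · refine ⟨fun y hy => List.mem_append_left _ (h1 y hy), fun z hz hzz => ?_, h3⟩
      rcases List.mem_append.1 hz with hz | hz
      · exact h2 z hz hzz
      · obtain rfl := List.mem_singleton.1 hz
        exact hx
    · refine ⟨fun y hy => ?_, fun z hz hzz => ?_, ?_⟩
      · rcases List.mem_append.1 hy with hy | hy
        · exact List.mem_append_left _ (h1 y hy)
        · exact List.mem_append_right _ hy
      · rcases List.mem_append.1 hz with hz | hz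
        · obtain ⟨y, hy, hyz⟩ := h2 z hz hzz
          exact ⟨y, List.mem_append_left _ hy, hyz⟩
        · obtain rfl := List.mem_singleton.1 hz
          exact ⟨z, List.mem_append_right _ (List.mem_singleton_self z), hzz⟩
      · refine List.pairwise_append.2 ⟨h3, List.pairwise_singleton _ _, fun y hy z hz hyz => ?_⟩
        obtain rfl := List.mem_singleton.1 hz
        exact hx ⟨y, hy, hyz⟩

open Classical in
/-- The short words over the given letters whose classes are supported by the first `k` data
values. -/
noncomputable def candidates (k N : ℕ) (Q : List (Word ℕ A × Word ℕ A))
    (Λ : List (ℕ × A × Finset ℕ)) : List (Word ℕ A) :=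
  (listsUpTo ((List.range (k + N)).flatMap fun d => Λ.map fun q => (d, q.2)) N).filter fun z =>
    (z, ren (shift k N) z) ∈ Q

/-- The word with a given number. -/
def entry (r : List (Word ℕ A)) (i : ℕ) : Word ℕ A := r[i]?.getD []

open Classical in
/-- The table of the product. -/
noncomputable def mulTable (Q : List (Word ℕ A × Word ℕ A)) (r : List (Word ℕ A)) :
    List (ℕ × ℕ × ℕ) :=
  ((List.range r.length).flatMap fun i => (List.range r.length).flatMap fun j =>
    (List.range r.length).map fun l => (i, j, l)).filter fun t =>
      (entry r t.1 ++ entry r t.2.1, entry r t.2.2) ∈ Q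

open Classical in
/-- The table of the action. -/
noncomputable def actTable (k : ℕ) (Q : List (Word ℕ A × Word ℕ A)) (r : List (Word ℕ A)) :
    List (List ℕ × ℕ × ℕ) :=
  ((listsUpTo (List.range k) k).flatMap fun g => (List.range r.length).flatMap fun i =>
    (List.range r.length).map fun j => (g, i, j)).filter fun t =>
      (ren (fun d => t.1[d]?.getD d) (entry r t.2.1), entry r t.2.2) ∈ Q

open Classical in
/-- The table of the images of the letters. -/
noncomputable def imgTable (k : ℕ) (Q : List (Word ℕ A × Word ℕ A)) (r : List (Word ℕ A))
    (Λ : List (ℕ × A × Finset ℕ)) : List (ℕ × ℕ × ℕ) :=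
  (((List.range k).flatMap fun d => Λ.flatMap fun q => (List.range r.length).map fun i =>
    (d, q, i)).filter fun t => ([(t.1, t.2.1.2)], entry r t.2.2) ∈ Q).map fun t =>
      (t.1, t.2.1.1, t.2.2)

open Classical in
/-- The table of the accepting elements. -/
noncomputable def accTable (H : List (Word ℕ A)) (r : List (Word ℕ A)) (Xs : List ℕ) : List ℕ :=
  (List.range r.length).filter fun i => entry r i ∈ H ∧ ∀ x ∈ Xs, cnt (2 * x) (entry r i) = 1

/-- The finite representation computed from the tables `H` and `Q` of a formula. -/
noncomputable def tableRep (k N : ℕ) (H : List (Word ℕ A)) (Q : List (Word ℕ A × Word ℕ A))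
    (Xs : List ℕ) (Λ : List (ℕ × A × Finset ℕ)) : FiniteRep :=
  (k, (representatives Q (candidates k N Q Λ)).length,
    mulTable Q (representatives Q (candidates k N Q Λ)),
    actTable k Q (representatives Q (candidates k N Q Λ)),
    imgTable k Q (representatives Q (candidates k N Q Λ)) Λ,
    accTable H (representatives Q (candidates k N Q Λ)) Xs)

theorem mem_mulTable {Q : List (Word ℕ A × Word ℕ A)} {r : List (Word ℕ A)} {i j l : ℕ} :
    (i, j, l) ∈ mulTable Q r ↔ (i < r.length ∧ j < r.length ∧ l < r.length) ∧
      (entry r i ++ entry r j, entry r l) ∈ Q := by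
  simp [mulTable]

theorem mem_actTable {k : ℕ} {Q : List (Word ℕ A × Word ℕ A)} {r : List (Word ℕ A)}
    {g : List ℕ} {i j : ℕ} :
    (g, i, j) ∈ actTable k Q r ↔
      ((g.length ≤ k ∧ ∀ d ∈ g, d < k) ∧ i < r.length ∧ j < r.length) ∧
      (ren (fun d => g[d]?.getD d) (entry r i), entry r j) ∈ Q := by
  simp [actTable, mem_listsUpTo]

theorem mem_imgTable {k : ℕ} {Q : List (Word ℕ A × Word ℕ A)} {r : List (Word ℕ A)}
    {Λ : List (ℕ × A × Finset ℕ)} {d c i : ℕ} :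
    (d, c, i) ∈ imgTable k Q r Λ ↔ (d < k ∧ i < r.length) ∧
      ∃ q, (c, q) ∈ Λ ∧ ([(d, q)], entry r i) ∈ Q := by
  simp only [imgTable, List.mem_map, List.mem_filter, List.mem_flatMap, List.mem_range,
    decide_eq_true_eq]
  constructor
  · rintro ⟨_, ⟨⟨d', hd, q, hq, i', hi, rfl⟩, hQ⟩, he⟩
    simp only [Prod.mk.injEq] at he
    obtain ⟨rfl, rfl, rfl⟩ := he
    exact ⟨⟨hd, hi⟩, q.2, hq, hQ⟩
  · rintro ⟨⟨hd, hi⟩, q, hq, hQ⟩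
    exact ⟨(d, (c, q), i), ⟨⟨d, hd, (c, q), hq, i, hi, rfl⟩, hQ⟩, rfl⟩

theorem mem_accTable {H r : List (Word ℕ A)} {Xs : List ℕ} {i : ℕ} :
    i ∈ accTable H r Xs ↔ i < r.length ∧ entry r i ∈ H ∧ ∀ x ∈ Xs, cnt (2 * x) (entry r i) = 1 := by
  simp [accTable]

theorem mem_candidates {k N : ℕ} {Q : List (Word ℕ A × Word ℕ A)} {Λ : List (ℕ × A × Finset ℕ)}
    {z : Word ℕ A} :
    z ∈ candidates k N Q Λ ↔ (z.length ≤ N ∧ ∀ p ∈ z, p.1 < k + N ∧ ∃ c, (c, p.2) ∈ Λ) ∧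
      (z, ren (shift k N) z) ∈ Q := by
  simp only [candidates, List.mem_filter, mem_listsUpTo, List.mem_flatMap, List.mem_range,
    List.mem_map, decide_eq_true_eq]
  refine and_congr_left fun _ => and_congr_right fun _ => forall₂_congr fun p _ => ?_
  constructor
  · rintro ⟨d, hd, q, hq, rfl⟩
    exact ⟨hd, q.1, hq⟩
  · rintro ⟨hd, c, hc⟩
    exact ⟨p.1, hd, (c, p.2), hc, rfl⟩

end Tables

/-! ### Primitive recursiveness of the representation. -/

section Primrec

variable {A : Type v} [Primcodable A] {α : Type*} [Primcodable α]

@[fun_prop] theorem primrec_representatives {β : Type*} [Primcodable β] {f : α → List (β × β)}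
    {g : α → List β} (hf : Primrec f) (hg : Primrec g) :
    Primrec fun a => representatives (f a) (g a) := by
  unfold representatives
  fun_prop

@[fun_prop] theorem primrec_entry {f : α → List (Word ℕ A)} {g : α → ℕ} (hf : Primrec f)
    (hg : Primrec g) : Primrec fun a => entry (f a) (g a) := by
  unfold entry
  fun_prop

variable {k N : α → ℕ} {H r : α → List (Word ℕ A)} {Q : α → List (Word ℕ A × Word ℕ A)}
  {Xs : α → List ℕ} {Λ : α → List (ℕ × A × Finset ℕ)}

@[fun_prop] theorem primrec_candidates (hk : Primrec k) (hN : Primrec N) (hQ : Primrec Q)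
    (hΛ : Primrec Λ) : Primrec fun a => candidates (k a) (N a) (Q a) (Λ a) := by
  unfold candidates ren shift
  fun_prop

@[fun_prop] theorem primrec_mulTable (hQ : Primrec Q) (hr : Primrec r) :
    Primrec fun a => mulTable (Q a) (r a) := by
  unfold mulTable
  fun_prop

@[fun_prop] theorem primrec_actTable (hk : Primrec k) (hQ : Primrec Q) (hr : Primrec r) :
    Primrec fun a => actTable (k a) (Q a) (r a) := by
  unfold actTable ren
  fun_prop

@[fun_prop] theorem primrec_imgTable (hk : Primrec k) (hQ : Primrec Q) (hr : Primrec r)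
    (hΛ : Primrec Λ) : Primrec fun a => imgTable (k a) (Q a) (r a) (Λ a) := by
  unfold imgTable
  fun_prop

@[fun_prop] theorem primrec_accTable (hH : Primrec H) (hr : Primrec r) (hXs : Primrec Xs) :
    Primrec fun a => accTable (H a) (r a) (Xs a) := by
  unfold accTable
  fun_prop

@[fun_prop] theorem primrec_tableRep (hk : Primrec k) (hN : Primrec N) (hH : Primrec H)
    (hQ : Primrec Q) (hXs : Primrec Xs) (hΛ : Primrec Λ) :
    Primrec fun a => tableRep (k a) (N a) (H a) (Q a) (Xs a) (Λ a) := by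
  unfold tableRep
  fun_prop

end Primrec

/-! ### Correctness of the representation. -/

section Represents

variable {D : Type u} {A B : Type v} {V : ℕ} {E : Word D A → Word D A → Prop} {hE : Nice V E}
  {lam : B → A × Finset ℕ}

open Nice in
-- Candidates have length at most `N` and data values below `k + N`. The table `Q` must reach length
-- `2 * N` to compare products, and data values below `k + 2 * N` to compare a candidate with its
-- shift.
theorem represents_tableRep {n : ℕ} (hn : MemCode E n) {j : ℕ → D} (hj : Function.Injective j)
    {k N : ℕ} (hN : profCard n ≤ N) (hN1 : 1 ≤ N) (hk : 2 * N ≤ k) {H : List (Word ℕ A)}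
    {Q : List (Word ℕ A × Word ℕ A)}
    (hQ : ∀ z z', (z, z') ∈ Q ↔ (Word.Small V (k + 2 * N) (2 * N) z ∧
      Word.Small V (k + 2 * N) (2 * N) z') ∧ E (ren j z) (ren j z'))
    (hlam : ∀ b, (lam b).2 ⊆ Finset.range V) {c : B → ℕ} (hc : Function.Injective c)
    {Λ : List (ℕ × A × Finset ℕ)} (hΛ : ∀ q, q ∈ Λ ↔ ∃ b, q = (c b, lam b))
    {P : Word D A → Prop} (hP : ∀ y z, E y z → P y → P z) {Xs : List ℕ}
    (hH : ∀ z, Word.Small V (k + 2 * N) (2 * N) z →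
      ((z ∈ H ∧ ∀ x ∈ Xs, cnt (2 * x) z = 1) ↔ P (ren j z))) :
    (tableRep k N H Q Xs Λ).Represents c (hE.hom lam) (hE.accept lam P) := by
  set r := representatives Q (candidates k N Q Λ) with hr
  obtain ⟨r1, r2, r3⟩ := representatives_spec Q (candidates k N Q Λ)
  rw [← hr] at r1 r2 r3
  have hmem : ∀ i : Fin r.length, entry r i ∈ r := fun i => by
    simp [entry]
  have small : ∀ {z : Word ℕ A}, z.length ≤ 2 * N → (∀ p ∈ z, p.1 < k + N ∧
      ∃ c, (c, p.2) ∈ Λ) → Word.Small V (k + 2 * N) (2 * N) z := by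
    intro z h1 h2
    refine ⟨h1, fun p hp => ?_⟩
    obtain ⟨h3, d, h4⟩ := h2 p hp
    obtain ⟨b, hb⟩ := (hΛ _).1 h4
    rw [(Prod.mk.inj hb).2]
    exact ⟨by omega, hlam b⟩
  have hcand : ∀ i : Fin r.length, ((entry r i).length ≤ N ∧ ∀ p ∈ entry r i, p.1 < k + N ∧
      ∃ c, (c, p.2) ∈ Λ) ∧ (entry r i, ren (shift k N) (entry r i)) ∈ Q := fun i =>
    mem_candidates.1 (r1 _ (hmem i))
  have hsmall : ∀ i : Fin r.length, Word.Small V (k + 2 * N) (2 * N) (entry r i) := fun i =>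
    small (by have := (hcand i).1.1; omega) (hcand i).1.2
  have letters : ∀ {z : Word ℕ A}, (∀ p ∈ z, p.1 < k + N ∧ ∃ c, (c, p.2) ∈ Λ) →
      ∀ p ∈ ren j z, ∃ b, lam b = p.2 := by
    intro z hz p hp
    obtain ⟨q, hq, rfl⟩ := List.mem_map.1 hp
    obtain ⟨d, hd⟩ := (hz q hq).2
    obtain ⟨b, hb⟩ := (hΛ _).1 hd
    exact ⟨b, (Prod.mk.inj hb).2.symm⟩
  have ex : ∀ i : Fin r.length, ∃ s, hE.IsClass lam s (ren j (entry r i)) := fun i =>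
    exists_isClass (letters (hcand i).1.2)
  choose s hs using ex
  let ι : Fin k ↪ D := ⟨fun i => j i, fun a b h => Fin.ext (hj h)⟩
  have hι : Set.range ι = Set.range fun i : Fin k => j i := rfl
  have supp : ∀ i, MulAction.Supports (Equiv.Perm D) (Set.range ι) (s i) := fun i => by
    rw [hι]
    exact supports_of_rel_shift hj (fun p hp => ((hcand i).1.2 p hp).1) (hs i)
      ((hQ _ _).1 (hcand i).2).2
  -- Injectivity holds because the representatives are pairwise incongruent; surjectivity because a
  -- supported element has a small representative, which passes the shift test.
  have bij : Function.Bijective fun i =>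
      (⟨s i, supp i⟩ : {s // MulAction.Supports (Equiv.Perm D) (Set.range ι) s}) := by
    constructor
    · intro a b hab
      have hab : s a = s b := congrArg Subtype.val hab
      have key : ∀ {a b : Fin r.length}, a < b → s a ≠ s b := by
        intro a b hlt hab
        refine List.pairwise_iff_getElem.1 r3 a b a.2 b.2 hlt ?_
        have := (hQ (entry r a) (entry r b)).2
          ⟨⟨hsmall a, hsmall b⟩, ((hs a).eq_iff (hs b)).1 hab⟩
        simpa [entry] using this
      rcases lt_trichotomy a b with h | h | h
      exacts [(key h hab).elim, h, (key h hab.symm).elim]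
    · rintro ⟨t, ht⟩
      obtain ⟨z, hz, hl, hd⟩ := exists_isClass_small hn hj ht
      have hd : ∀ p ∈ z, p.1 < k + N ∧ ∃ c, (c, p.2) ∈ Λ := fun p hp => by
        obtain ⟨b, hb⟩ := hz.letters (j p.1, p.2) (List.mem_map_of_mem hp)
        refine ⟨(hd p hp).trans_le (by omega), c b, (hΛ _).2 ⟨b, ?_⟩⟩
        rw [hb]
      have hzs := small (by omega) hd
      have hzc : z ∈ candidates k N Q Λ := by
        refine mem_candidates.2 ⟨⟨by omega, hd⟩, (hQ _ _).2 ⟨⟨hzs, ?_⟩,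
          rel_shift_of_supports hj (fun p hp => (hd p hp).1) hz ht⟩⟩
        refine ⟨(length_ren _ _).trans_le hzs.1, fun p hp => ?_⟩
        obtain ⟨q, hq, rfl⟩ := List.mem_map.1 hp
        refine ⟨?_, (hzs.2 q hq).2⟩
        have := (hd q hq).1
        simp only [shift]
        split_ifs <;> omega
      obtain ⟨y, hy, hyz⟩ := r2 z hzc ((hQ _ _).2 ⟨⟨hzs, hzs⟩, hE.refl _⟩)
      obtain ⟨i, hi, rfl⟩ := List.getElem_of_mem hy
      refine ⟨⟨i, hi⟩, Subtype.ext (((hs _).eq_iff hz).2 ?_)⟩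
      simpa [entry, hi] using ((hQ _ _).1 hyz).2
  refine ⟨ι, Equiv.ofBijective _ bij, by omega, ?_, ?_, ?_, ?_, ?_⟩
  -- The data values of a short representative support the element, and there are at most `N` of
  -- them, which is at most half of `k`.
  · classical
    intro t
    obtain ⟨z, hz, hl⟩ := exists_isClass_short hn t
    have := card_dataValues_le z
    refine ⟨(z.map Prod.fst).toFinset, supports_of_isClass hz fun p hp => ?_, by omega⟩
    exact List.mem_toFinset.2 (List.mem_map_of_mem hp)
  · intro a b l
    simp only [← hr, Equiv.ofBijective_apply]
    rw [mem_mulTable, hQ, ((hs a).mul (hs b)).eq_iff (hs l), ren_append]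
    refine ⟨fun h => h.2.2, fun h => ⟨⟨a.2, b.2, l.2⟩, ⟨?_, hsmall l⟩, h⟩⟩
    refine small ?_ fun p hp => ?_
    · have := (hcand a).1.1
      have := (hcand b).1.1
      rw [List.length_append]
      omega
    · exact (List.mem_append.1 hp).elim ((hcand a).1.2 p) ((hcand b).1.2 p)
  · intro g a b
    simp only [← hr, Equiv.ofBijective_apply]
    -- The default `d` makes the list act as the identity beyond `k`, as `viaEmbedding` does outside
    -- the range of `ι`.
    set f : ℕ → ℕ := fun d => (List.ofFn fun d => (g d : ℕ))[d]?.getD d with hf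
    have hfk : ∀ d (hd : d < k), f d = g ⟨d, hd⟩ := fun d hd => by simp [hf, hd]
    have hfk' : ∀ d, k ≤ d → f d = d := fun d hd => by
      simp [hf, hd.not_gt]
    have hfl : ∀ d < k + N, f d < k + N := fun d hd => by
      rcases lt_or_ge d k with h | h
      · rw [hfk d h]
        have := (g ⟨d, h⟩).2
        omega
      · rwa [hfk' d h]
    have hg : ren j (ren f (entry r a)) = ren (g.viaEmbedding ι) (ren j (entry r a)) := by
      rw [ren_ren, ren_ren]
      refine ren_congr fun p _ => ?_
      rcases lt_or_ge p.1 k with h | h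
      · rw [Function.comp_apply, hfk _ h]
        exact (Equiv.Perm.viaEmbedding_apply g ι ⟨p.1, h⟩).symm
      · rw [Function.comp_apply, hfk' _ h]
        refine (Equiv.Perm.viaEmbedding_apply_of_notMem g ι _ ?_).symm
        rintro ⟨i, hi⟩
        have := hj hi
        omega
    rw [mem_actTable, hQ, ((hs a).smul _).eq_iff (hs b), ← hg]
    refine ⟨fun h => h.2.2, fun h => ⟨⟨⟨by simp, ?_⟩, a.2, b.2⟩, ⟨?_, hsmall b⟩, h⟩⟩
    · intro d hd
      obtain ⟨i, rfl⟩ := List.mem_ofFn.1 hd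
      exact (g i).2
    · refine small ?_ fun p hp => ?_
      · rw [length_ren]
        have := (hcand a).1.1
        omega
      · obtain ⟨q, hq, rfl⟩ := List.mem_map.1 hp
        exact ⟨hfl _ ((hcand a).1.2 q hq).1, ((hcand a).1.2 q hq).2⟩
  · intro d b i
    simp only [← hr, Equiv.ofBijective_apply]
    rw [mem_imgTable, (isClass_onWord (hE := hE) (c := lam) [(ι d, b)]).eq_iff (hs i)]
    constructor
    · rintro ⟨-, q, hq, h⟩
      obtain ⟨b', hb⟩ := (hΛ _).1 hq
      obtain ⟨h1, rfl⟩ := Prod.mk.inj hb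
      obtain rfl := hc h1
      exact ((hQ _ _).1 h).2
    · intro h
      refine ⟨⟨d.2, i.2⟩, lam b, (hΛ _).2 ⟨b, rfl⟩, (hQ _ _).2 ⟨⟨?_, hsmall i⟩, h⟩⟩
      refine small (by simp; omega) fun p hp => ?_
      obtain rfl := List.mem_singleton.1 hp
      exact ⟨by have := d.2; simp only; omega, c b, (hΛ _).2 ⟨b, rfl⟩⟩
  · intro i
    simp only [← hr, Equiv.ofBijective_apply]
    rw [mem_accTable, (hs i).mem_accept hP, ← hH _ (hsmall i)]
    exact ⟨fun h => h.2, fun h => ⟨i.2, h⟩⟩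

end Represents

/-! ### From a formula to its representation. -/

section FormulaRep

variable {D : Type u} {A B : Type v}

namespace MSO

theorem Below.mono {V V' : ℕ} (h : V ≤ V') {φ : MSO A} (hφ : φ.Below V) : φ.Below V' := by
  induction φ with
  | exFO x φ ih => exact ⟨hφ.1.trans_le h, ih hφ.2⟩
  | exSO X φ ih => exact ⟨hφ.1.trans_le h, ih hφ.2⟩
  | letter a x => exact hφ.trans_le h
  | lt x y => exact ⟨hφ.1.trans_le h, hφ.2.trans_le h⟩
  | mem x X => exact ⟨hφ.1.trans_le h, hφ.2.trans_le h⟩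
  | sim x y => exact ⟨hφ.1.trans_le h, hφ.2.trans_le h⟩
  | neg φ ih => exact ih hφ
  | conj φ ψ ih₁ ih₂ => exact ⟨ih₁ hφ.1, ih₂ hφ.2⟩

/-- Pairing dominates both components, so every variable name is at most the code; the numbering of
the two kinds of variables gives the factor two. -/
theorem below_code [Encodable A] (φ : MSO A) : φ.Below (2 * φ.code + 2) := by
  have l : ∀ t x y, x ≤ Nat.pair t (Nat.pair x y) := fun t x y =>
    (Nat.left_le_pair x y).trans (Nat.right_le_pair _ _)
  have r : ∀ t x y, y ≤ Nat.pair t (Nat.pair x y) := fun t x y =>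
    (Nat.right_le_pair x y).trans (Nat.right_le_pair _ _)
  induction φ with
  | exFO x φ ih =>
    have := l 0 x φ.code
    have := r 0 x φ.code
    exact ⟨by rw [code]; omega, ih.mono (by rw [code]; omega)⟩
  | exSO X φ ih =>
    have := l 1 X φ.code
    have := r 1 X φ.code
    exact ⟨by rw [code]; omega, ih.mono (by rw [code]; omega)⟩
  | letter a x =>
    have := r 2 (Encodable.encode a) x
    rw [Below, code]
    omega
  | lt x y =>
    have := l 3 x y
    have := r 3 x y
    rw [Below, code]
    omega
  | mem x X =>
    have := l 4 x X
    have := r 4 x X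
    rw [Below, code]
    omega
  | sim x y =>
    have := l 5 x y
    have := r 5 x y
    rw [Below, code]
    omega
  | neg φ ih =>
    have := Nat.right_le_pair 6 φ.code
    exact ih.mono (by rw [code]; omega)
  | conj φ ψ ih₁ ih₂ =>
    have := l 7 φ.code ψ.code
    have := r 7 φ.code ψ.code
    exact ⟨ih₁.mono (by rw [code]; omega), ih₂.mono (by rw [code]; omega)⟩

theorem code_congr {i i' : Encodable A} (h : ∀ a, i.encode a = i'.encode a) :
    ∀ φ : MSO A, @code A i φ = @code A i' φ := by
  intro φ
  induction φ with
  | exFO x φ ih => exact congrArg (fun n => Nat.pair 0 (Nat.pair x n)) ih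
  | exSO X φ ih => exact congrArg (fun n => Nat.pair 1 (Nat.pair X n)) ih
  | letter a x => exact congrArg (fun n => Nat.pair 2 (Nat.pair n x)) (h a)
  | lt x y => rfl
  | mem x X => rfl
  | sim x y => rfl
  | neg φ ih => exact congrArg (Nat.pair 6) ih
  | conj φ ψ ih₁ ih₂ => exact congrArg₂ (fun m n => Nat.pair 7 (Nat.pair m n)) ih₁ ih₂

/-- Satisfaction in an annotated word that marks one position for each of the given first-order
variables. -/
def Accepts (φ : MSO A) (Xs : List ℕ) (z : Word D A) : Prop :=
  φ.Holds z ∧ ∀ x ∈ Xs, cnt (2 * x) z = 1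

theorem accepts_ren {D' : Type*} {g : D → D'} (hg : Function.Injective g) {φ : MSO A} {Xs : List ℕ}
    {z : Word D A} : φ.Accepts Xs (ren g z) ↔ φ.Accepts Xs z := by
  simp only [Accepts, holds_ren hg, cnt_ren]

theorem Accepts.of_rel {V : ℕ} {E : Word D A → Word D A → Prop} (hE : Nice V E) {φ : MSO A}
    (hφ : φ.Preserves E) {Xs : List ℕ} (hX : ∀ x ∈ Xs, 2 * x < V)
    (hf : ∀ x, Sum.inl x ∈ φ.freeVars → x ∈ Xs) {y z : Word D A} (h : E y z)
    (hy : φ.Accepts Xs y) : φ.Accepts Xs z :=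
  ⟨hφ _ _ h (fun x hx => hy.2 x (hf x hx)) hy.1,
    fun x hx => (hE.count h).eq_one (hX x hx) (hy.2 x hx)⟩

end MSO

/-- The tables of the formula with code `e` that determine its data monoid. -/
noncomputable def repTab [Encodable A] (La : List A) (V e : ℕ) : Tab A :=
  tabStep (envOf La V (profCard (MSO.bound V e))
      (2 * profCard (MSO.bound V e) + 1 + 2 * profCard (MSO.bound V e)))
    (tabs (envOf La V (profCard (MSO.bound V e))
      (2 * profCard (MSO.bound V e) + 1 + 2 * profCard (MSO.bound V e))) e)

/-- The finite representation computed from the code of a formula. -/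
noncomputable def formulaRep [Encodable A] (La : List A) (V e : ℕ) (Xs : List ℕ)
    (Λ : List (ℕ × A × Finset ℕ)) : FiniteRep :=
  tableRep (2 * profCard (MSO.bound V e) + 1) (profCard (MSO.bound V e)) (repTab La V e).1
    (repTab La V e).2 Xs Λ

@[fun_prop] theorem primrec_envOf [Primcodable A] {α : Type*} [Primcodable α] {La : List A}
    {V N K : α → ℕ} (hV : Primrec V) (hN : Primrec N) (hK : Primrec K) :
    Primrec fun a => envOf La (V a) (N a) (K a) := by
  unfold envOf
  fun_prop

@[fun_prop] theorem primrec_formulaRep [Primcodable A] {α : Type*} [Primcodable α] {La : List A}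
    {V e : α → ℕ} {Xs : α → List ℕ} {Λ : α → List (ℕ × A × Finset ℕ)} (hV : Primrec V)
    (he : Primrec e) (hXs : Primrec Xs) (hΛ : Primrec Λ) :
    Primrec fun a => formulaRep La (V a) (e a) (Xs a) (Λ a) := by
  have hN : Primrec fun a => profCard (MSO.bound (V a) (e a)) :=
    MSO.primrec_profCard.comp (MSO.primrec_bound hV he)
  have hT : Primrec fun a => repTab La (V a) (e a) := by
    unfold repTab
    fun_prop
  unfold formulaRep
  fun_prop

open Nice in
theorem represents_formulaRep [Encodable A] {La : List A} (hLa : ∀ a, a ∈ La) {φ : MSO A}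
    (h : φ.RigidlyGuarded D) {V : ℕ} (hV : φ.Below V) {j : ℕ → D} (hj : Function.Injective j)
    {lam : B → A × Finset ℕ} (hlam : ∀ b, (lam b).2 ⊆ Finset.range V) {c : B → ℕ}
    (hc : Function.Injective c) {Λ : List (ℕ × A × Finset ℕ)}
    (hΛ : ∀ q, q ∈ Λ ↔ ∃ b, q = (c b, lam b)) {Xs : List ℕ} (hX : ∀ x ∈ Xs, 2 * x < V)
    (hf : ∀ x, Sum.inl x ∈ φ.freeVars → x ∈ Xs) :
    (formulaRep La V φ.code Xs Λ).Represents c ((h.cong hV).1.hom lam)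
      ((h.cong hV).1.accept lam (φ.Accepts Xs)) := by
  obtain ⟨hE, hP⟩ := h.cong hV
  have hN1 : 1 ≤ profCard (MSO.bound V φ.code) := by
    have h1 : 1 ≤ MSO.bound V φ.code :=
      le_trans (Nat.mul_pos (by positivity) (by omega)) (MSO.bound_of_atom V φ)
    unfold profCard
    exact Nat.mul_pos h1 (by positivity)
  refine represents_tableRep (h.memCode hV) hj le_rfl hN1 (by omega)
    (fun z z' => mem_tab_cong hLa h hj hV le_rfl z z') hlam hc hΛ
    (fun y z hyz hy => hy.of_rel hE hP hX hf hyz) fun z hz => ?_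
  rw [MSO.accepts_ren hj, repTab, mem_tab_holds hLa φ hV, MSO.Accepts,
    and_iff_right (hz.mono (by omega) (by omega))]

open Nice in
/-- The data monoid of a rigidly guarded formula. -/
theorem exists_represents [Infinite D] [Encodable A] {La : List A} (hLa : ∀ a, a ∈ La) {φ : MSO A}
    (h : φ.RigidlyGuarded D) {V : ℕ} (hV : φ.Below V)
    {lam : B → A × Finset ℕ} (hlam : ∀ b, (lam b).2 ⊆ Finset.range V) {c : B → ℕ}
    (hc : Function.Injective c) {Λ : List (ℕ × A × Finset ℕ)}
    (hΛ : ∀ q, q ∈ Λ ↔ ∃ b, q = (c b, lam b)) {Xs : List ℕ} (hX : ∀ x ∈ Xs, 2 * x < V)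
    (hf : ∀ x, Sum.inl x ∈ φ.freeVars → x ∈ Xs) {L : Set (List (D × B))}
    (hL : ∀ y, y ∈ L ↔ φ.Accepts Xs (relabel lam y)) :
    ∃ (hE : Nice V (φ.Cong V : Word D A → Word D A → Prop)) (F : Set (hE.dataMonoid lam)),
      (hE.dataMonoid lam).OrbitFinite ∧ (hE.hom lam).Recognizes F L ∧
      (formulaRep La V φ.code Xs Λ).Represents c (hE.hom lam) F :=
  ⟨(h.cong hV).1, _, orbitFinite (h.memCode hV),
    recognizes (fun _ _ hyz hy => hy.of_rel (h.cong hV).1 (h.cong hV).2 hX hf hyz)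
      (fun g _ hz => (MSO.accepts_ren g.injective).2 hz) hL,
    represents_formulaRep hLa h hV (Infinite.natEmbedding D).injective hlam hc hΛ hX hf⟩

end FormulaRep

/-! ## Sentences -/

section Sentences

variable {D : Type u} {A : Type v}

theorem mem_language_iff {φ : MSO A} (hφ : φ.freeVars = ∅) (w : List (D × A)) :
    w ∈ φ.language D ↔ φ.Accepts [] (relabel (fun a => (a, ∅)) w) := by
  have hb : base (relabel (fun a : A => (a, (∅ : Finset ℕ))) w) = w := by
    simp [base, relabel, Function.comp_def]
  have := MSO.sat_iff_holds φ (relabel (fun a => (a, ∅)) w) (fun _ => 0) (fun _ => ∅)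
    (by simp [hφ]) (by simp [hφ])
  rw [hb] at this
  simpa [MSO.Accepts, MSO.language] using this

/-- The finite representation computed from the code of a sentence. -/
noncomputable def sentenceRep [Encodable A] (La : List A) (e : ℕ) : FiniteRep :=
  formulaRep La (2 * e + 2) e [] (La.map fun a => (Encodable.encode a, a, ∅))

theorem primrec_sentenceRep [Primcodable A] (La : List A) : Primrec (sentenceRep La) := by
  unfold sentenceRep
  fun_prop

theorem exists_represents_language [Infinite D] [Encodable A] {La : List A} (hLa : ∀ a, a ∈ La)
    {φ : MSO A} (h : φ.RigidlyGuarded D) (hφ : φ.freeVars = ∅) :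
    ∃ (hE : Nice (2 * φ.code + 2) (φ.Cong (2 * φ.code + 2) : Word D A → Word D A → Prop))
      (F : Set (hE.dataMonoid fun a => (a, ∅))),
      (hE.dataMonoid fun a => (a, ∅)).OrbitFinite ∧
      (hE.hom fun a => (a, ∅)).Recognizes F (φ.language D) ∧
      (sentenceRep La φ.code).Represents Encodable.encode (hE.hom fun a => (a, ∅)) F := by
  refine exists_represents hLa h φ.below_code (by simp) Encodable.encode_injective ?_ (by simp)
    (by simp [hφ]) (mem_language_iff hφ)
  intro q
  simp only [List.mem_map]
  exact ⟨fun ⟨a, _, ha⟩ => ⟨a, ha.symm⟩, fun ⟨a, ha⟩ => ⟨a, hLa a, ha.symm⟩⟩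

end Sentences

/-! ## Annotated languages -/

section Annotated

variable {D : Type u} {A : Type v}

theorem getElem?_annotate {m : ℕ} (w : List (D × A)) (U : Fin m → Finset ℕ) (i : ℕ) :
    (annotate w U)[i]? = w[i]?.map fun p => (p.1, (p.2, fun j => decide (i ∈ U j))) := by
  simp [annotate, List.getElem?_mapIdx]

/-- Every word over the extended alphabet is an annotation, of its own projection by the sets of
positions where the bits are set. -/
theorem annotate_eq_self {m : ℕ} (z : List (D × (A × (Fin m → Bool)))) :
    annotate (relabel Prod.fst z) (fun j => (Finset.range z.length).filter fun i =>
      ∃ p, z[i]? = some p ∧ p.2.2 j = true) = z := by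
  refine List.ext_getElem? fun i => ?_
  rw [getElem?_annotate, relabel, List.getElem?_map, Option.map_map]
  cases hz : z[i]? with
  | none => rfl
  | some p =>
    have hi : i < z.length := (List.getElem?_eq_some_iff.1 hz).1
    simp only [Option.map_some, Function.comp_apply, Option.some.injEq]
    refine Prod.ext rfl (Prod.ext rfl (funext fun j => ?_))
    simp [hi, (List.getElem?_eq_some_iff.1 hz).2]

/-- A variable of either kind as a number. -/
def MSOVar.bit (x : MSOVar) : ℕ := Sum.casesOn x (fun x => 2 * x) (fun X => 2 * X + 1)

theorem MSOVar.bit_injective : Function.Injective MSOVar.bit := by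
  rintro (x | x) (y | y) h <;> simp only [MSOVar.bit] at h <;> first | omega | (congr 1; omega)

/-- The annotation by bits as an annotation by variables. -/
def letterOf (X : List MSOVar) (b : A × (Fin X.length → Bool)) : A × Finset ℕ :=
  (b.1, (Finset.univ.filter fun j => b.2 j = true).image fun j => (X.get j).bit)

theorem bit_mem_letterOf {X : List MSOVar} (hX : X.Nodup) {b : A × (Fin X.length → Bool)}
    {j : Fin X.length} : (X.get j).bit ∈ (letterOf X b).2 ↔ b.2 j = true := by
  simp only [letterOf, Finset.mem_image, Finset.mem_filter, Finset.mem_univ, true_and]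
  constructor
  · rintro ⟨i, hi, he⟩
    rwa [← List.nodup_iff_injective_get.1 hX (MSOVar.bit_injective he)]
  · exact fun h => ⟨j, h, rfl⟩

theorem base_relabel_letterOf (X : List MSOVar) (z : List (D × (A × (Fin X.length → Bool)))) :
    base (relabel (letterOf X) z) = relabel Prod.fst z := by
  simp [base, relabel, letterOf]

theorem relabel_fst_annotate {m : ℕ} (w : List (D × A)) (U : Fin m → Finset ℕ) :
    relabel Prod.fst (annotate w U) = w := by
  refine List.ext_getElem? fun i => ?_
  rw [relabel, List.getElem?_map, getElem?_annotate, Option.map_map]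
  cases w[i]? <;> rfl

/-- Annotations of one word have the same underlying data word, so this is `Nice.proj` read in the
quotient. -/
theorem projectable {V : ℕ} {E : Word D A → Word D A → Prop} (hE : Nice V E) (X : List MSOVar) :
    (hE.hom (letterOf X)).Projectable := by
  rintro w U U' - - ⟨g, hg⟩
  rw [Nice.smul_onWord, Nice.onWord_eq_iff, relabel_ren] at hg
  refine Nice.onWord_eq_iff.2 (hE.proj g ?_ hg)
  rw [base_relabel_letterOf, base_relabel_letterOf, relabel_fst_annotate, relabel_fst_annotate]

/-- The first-order variables among the variables with the given numbers. -/
def firstOrder (Y : List ℕ) : List ℕ := (Y.filter fun y => y % 2 = 0).map (· / 2)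

theorem mem_firstOrder {X : List MSOVar} {x : ℕ} :
    x ∈ firstOrder (X.map MSOVar.bit) ↔ Sum.inl x ∈ X := by
  simp only [firstOrder, List.mem_map, List.mem_filter, decide_eq_true_eq]
  constructor
  · rintro ⟨_, ⟨⟨y | y, hy, rfl⟩, h⟩, rfl⟩
    · simpa [MSOVar.bit] using hy
    · simp only [MSOVar.bit] at h
      omega
  · intro h
    exact ⟨2 * x, ⟨⟨_, h, rfl⟩, by omega⟩, by omega⟩

/-- The bits determine the values of the listed variables, provided that no variable is listed
twice. A word belongs to the language when each listed first-order variable marks a single position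
and the formula holds. -/
theorem mem_annotatedLanguage_iff {φ : MSO A} {X : List MSOVar} (hX : X.Nodup)
    (hf : ∀ x ∈ φ.freeVars, x ∈ X) (z : List (D × (A × (Fin X.length → Bool)))) :
    z ∈ φ.annotatedLanguage D X ↔
      φ.Accepts (firstOrder (X.map MSOVar.bit)) (relabel (letterOf X) z) := by
  set z' := relabel (letterOf X) z with hz'
  have hl : z'.length = z.length := List.length_map _
  have get : ∀ x ∈ X, ∃ j, X.get j = x := fun x hx => List.get_of_mem hx
  have bit : ∀ {i : ℕ} {p j}, z'[i]? = some p → ∃ q, z[i]? = some q ∧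
      ((X.get j).bit ∈ p.2.2 ↔ q.2.2 j = true) := by
    intro i p j hp
    rw [hz', relabel, List.getElem?_map, Option.map_eq_some_iff] at hp
    obtain ⟨q, hq, rfl⟩ := hp
    exact ⟨q, hq, bit_mem_letterOf hX⟩
  constructor
  · rintro ⟨w, U, ν, μ, rfl, hU, hν, hs⟩
    have hlw : w.length = z'.length := by rw [hl]; simp [annotate]
    have bit' : ∀ {i : ℕ} {p j}, z'[i]? = some p → ((X.get j).bit ∈ p.2.2 ↔ i ∈ U j) := by
      intro i p j hp
      obtain ⟨q, hq, h⟩ := bit (j := j) hp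
      rw [getElem?_annotate, Option.map_eq_some_iff] at hq
      obtain ⟨r, -, rfl⟩ := hq
      simpa using h
    have pos : ∀ x, Sum.inl x ∈ X → ν x < z'.length ∧
        ∀ i p, z'[i]? = some p → (2 * x ∈ p.2.2 ↔ i = ν x) := by
      intro x hx
      obtain ⟨j, hj⟩ := get _ hx
      have hUj : U j = {ν x} := by rw [hν, hj]; rfl
      refine ⟨?_, fun i p hp => ?_⟩
      · have := hU j (hUj ▸ Finset.mem_singleton_self _)
        rw [← hlw]
        exact Finset.mem_range.1 this
      · have := bit' (j := j) hp
        rwa [hj, hUj, Finset.mem_singleton] at this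
    refine ⟨(MSO.sat_iff_holds φ z' ν μ (fun x hx => pos x (hf _ hx)) ?_).1 ?_, fun x hx => ?_⟩
    · intro Y hY i p hp
      obtain ⟨j, hj⟩ := get _ (hf _ hY)
      have hUj : U j = μ Y := by rw [hν, hj]; rfl
      have := bit' (j := j) hp
      rwa [hj, hUj] at this
    · rwa [hz', base_relabel_letterOf, relabel_fst_annotate]
    · obtain ⟨h1, h2⟩ := pos x (mem_firstOrder.1 hx)
      exact countP_eq_one h1 fun i p hp => by simpa using h2 i p hp
  · rintro ⟨h1, h2⟩
    -- First-order variables outside the list get the irrelevant value `0`.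
    have pos : ∀ x, ∃ i, Sum.inl x ∈ X → i < z'.length ∧
        ∀ k p, z'[k]? = some p → (2 * x ∈ p.2.2 ↔ k = i) := by
      intro x
      by_cases hx : Sum.inl x ∈ X
      · obtain ⟨i, hi, h⟩ := exists_position (h2 x (mem_firstOrder.2 hx))
        exact ⟨i, fun _ => ⟨hi, fun k p hp => by simpa using h k p hp⟩⟩
      · exact ⟨0, fun h => (hx h).elim⟩
    choose ν hν using pos
    classical
    let μ : ℕ → Finset ℕ := fun Y => (Finset.range z.length).filter fun i =>
      ∃ p, z'[i]? = some p ∧ 2 * Y + 1 ∈ p.2.2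
    have lt : ∀ {i : ℕ} {p}, z'[i]? = some p → i < z.length := fun h =>
      hl ▸ (List.getElem?_eq_some_iff.1 h).1
    have hμ : ∀ Y i p, z'[i]? = some p → (2 * Y + 1 ∈ p.2.2 ↔ i ∈ μ Y) := by
      intro Y i p hp
      rw [Finset.mem_filter, Finset.mem_range, and_iff_right (lt hp), hp]
      simp only [Option.some.injEq, exists_eq_left']
    refine ⟨relabel Prod.fst z, _, ν, μ, (annotate_eq_self z).symm, fun j => ?_, fun j => ?_, ?_⟩
    · rw [relabel, List.length_map]
      exact Finset.filter_subset _ _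
    · ext i
      rw [Finset.mem_filter, Finset.mem_range]
      have key : ∀ n, (X.get j).bit = n → ((i < z.length ∧ ∃ p, z[i]? = some p ∧ p.2.2 j = true) ↔
          ∃ p, z'[i]? = some p ∧ n ∈ p.2.2) := by
        rintro _ rfl
        constructor
        · rintro ⟨-, q, hq, h⟩
          have hq' : z'[i]? = some (q.1, letterOf X q.2) := by
            rw [hz', relabel, List.getElem?_map, hq]
            rfl
          exact ⟨_, hq', (bit_mem_letterOf hX).2 h⟩
        · rintro ⟨p, hp, h⟩
          obtain ⟨q, hq, h'⟩ := bit (j := j) hp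
          exact ⟨lt hp, q, hq, h'.1 h⟩
      rcases hj : X.get j with x | Y
      · rw [key (2 * x) (by rw [hj]; rfl)]
        have hx : Sum.inl x ∈ X := hj ▸ List.get_mem X j
        obtain ⟨h3, h4⟩ := hν x hx
        simp only [Sum.elim_inl, Finset.mem_singleton]
        constructor
        · rintro ⟨p, hp, h⟩
          exact (h4 i p hp).1 h
        · rintro rfl
          exact ⟨_, List.getElem?_eq_getElem h3, (h4 _ _ (List.getElem?_eq_getElem h3)).2 rfl⟩
      · rw [key (2 * Y + 1) (by rw [hj]; rfl)]
        simp only [Sum.elim_inr]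
        constructor
        · rintro ⟨p, hp, h⟩
          exact (hμ Y i p hp).1 h
        · exact fun h => (Finset.mem_filter.1 h).2
    · rw [← base_relabel_letterOf]
      exact (MSO.sat_iff_holds φ z' ν μ (fun x hx => hν x (hf _ hx))
        fun Y _ i p hp => hμ Y i p hp).2 h1

/-- The set of the variables whose bits are set. -/
def variablesOf (Y : List ℕ) (l : List Bool) : Finset ℕ :=
  (List.range Y.length).foldr
    (fun i s => if l[i]? = some true then insert (Y[i]?.getD 0) s else s) ∅

theorem mem_variablesOf {Y : List ℕ} {l : List Bool} {v : ℕ} :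
    v ∈ variablesOf Y l ↔ ∃ i < Y.length, l[i]? = some true ∧ Y[i]?.getD 0 = v := by
  have : ∀ r : List ℕ, v ∈ r.foldr
      (fun i s => if l[i]? = some true then insert (Y[i]?.getD 0) s else s) (∅ : Finset ℕ) ↔
        ∃ i ∈ r, l[i]? = some true ∧ Y[i]?.getD 0 = v := by
    intro r
    induction r with
    | nil => simp
    | cons i r ih =>
      rw [List.foldr_cons]
      split_ifs with h
      · rw [Finset.mem_insert, ih]
        simp [h, eq_comm]
      · rw [ih]
        simp [h]
  simp only [variablesOf, this, List.mem_range]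

/-- The annotated letters, with their codes. -/
def annotatedLetters [Encodable A] (La : List A) (Y : List ℕ) : List (ℕ × A × Finset ℕ) :=
  La.flatMap fun a => ((listsUpTo [true, false] Y.length).filter fun l => l.length = Y.length).map
    fun l => (Nat.pair (Encodable.encode a) (Encodable.encode l), a, variablesOf Y l)

theorem mem_annotatedLetters [Encodable A] {La : List A} (hLa : ∀ a, a ∈ La) {X : List MSOVar}
    (q : ℕ × A × Finset ℕ) : q ∈ annotatedLetters La (X.map MSOVar.bit) ↔
      ∃ b, q = (annotatedLetterCode b, letterOf X b) := by
  have hv : ∀ b : A × (Fin X.length → Bool),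
      variablesOf (X.map MSOVar.bit) (List.ofFn b.2) = (letterOf X b).2 := by
    intro b
    ext v
    rw [mem_variablesOf]
    simp only [letterOf, Finset.mem_image, Finset.mem_filter, Finset.mem_univ, true_and,
      List.length_map]
    constructor
    · rintro ⟨i, hi, h, rfl⟩
      refine ⟨⟨i, hi⟩, ?_, ?_⟩
      · simpa [hi] using h
      · simp [hi]
    · rintro ⟨⟨i, hi⟩, h, rfl⟩
      exact ⟨i, hi, by simpa [hi] using h, by simp [hi]⟩
  simp only [annotatedLetters, List.mem_flatMap, List.mem_map, List.mem_filter, mem_listsUpTo,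
    List.length_map, decide_eq_true_eq]
  constructor
  · rintro ⟨a, -, l, ⟨-, hl⟩, rfl⟩
    have hl' : List.ofFn (fun j : Fin X.length => l.get (j.cast hl.symm)) = l := by
      refine List.ext_getElem (by simp [hl]) fun i _ _ => by simp
    refine ⟨(a, fun j => l.get (j.cast hl.symm)), ?_⟩
    have := hv (a, fun j => l.get (j.cast hl.symm))
    simp only [hl'] at this
    rw [this]
    refine Prod.ext ?_ rfl
    simp only [annotatedLetterCode, hl']
  · rintro ⟨b, rfl⟩
    refine ⟨b.1, hLa _, List.ofFn b.2, ⟨⟨by simp, fun t _ => by cases t <;> simp⟩, by simp⟩, ?_⟩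
    rw [hv]
    rfl

theorem annotatedLetterCode_injective [Encodable A] {m : ℕ} :
    Function.Injective (annotatedLetterCode : A × (Fin m → Bool) → ℕ) := by
  intro b b' h
  obtain ⟨h1, h2⟩ := Nat.pair_eq_pair.1 h
  exact Prod.ext (Encodable.encode_injective h1)
    (List.ofFn_injective (Encodable.encode_injective h2))

/-- A bound for the variables of a formula with code `e` and for those with numbers in `Y`. -/
def variableBound (e : ℕ) (Y : List ℕ) : ℕ := 2 * e + 2 + Y.foldr (fun y s => y + s) 0

theorem lt_variableBound {e y : ℕ} {Y : List ℕ} (h : y ∈ Y) : y < variableBound e Y := by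
  have : y ≤ Y.sum := List.le_sum_of_mem h
  have hs : Y.sum = Y.foldr (fun y s => y + s) 0 := rfl
  rw [variableBound]
  omega

/-- The finite representation computed from the code of a formula and from the numbers of its
variables. -/
noncomputable def annotatedRep [Encodable A] (La : List A) (e : ℕ) (Y : List ℕ) : FiniteRep :=
  formulaRep La (variableBound e Y) e (firstOrder Y) (annotatedLetters La Y)

theorem primrec_annotatedRep [Primcodable A] (La : List A) :
    Primrec fun p : ℕ × List MSOVar => annotatedRep La p.1 (p.2.map MSOVar.bit) := by
  have hb : Primrec MSOVar.bit := Primrec.sumCasesOn (f := fun x : MSOVar => x) Primrec.id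
    (show Primrec fun p : MSOVar × ℕ => 2 * p.2 by fun_prop)
    (show Primrec fun p : MSOVar × ℕ => 2 * p.2 + 1 by fun_prop)
  unfold annotatedRep variableBound firstOrder annotatedLetters variablesOf
  fun_prop

theorem exists_represents_annotatedLanguage [Infinite D] [Encodable A] {La : List A}
    (hLa : ∀ a, a ∈ La) {φ : MSO A} (h : φ.RigidlyGuarded D) {X : List MSOVar} (hX : X.Nodup)
    (hf : ∀ x ∈ φ.freeVars, x ∈ X) :
    ∃ (M : DataMonoid.{u, max u v} D)
      (h : (freeDataMonoid D (A × (Fin X.length → Bool))).Hom M) (F : Set M),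
      M.OrbitFinite ∧ h.Projectable ∧ h.Recognizes F (φ.annotatedLanguage D X) ∧
      (annotatedRep La φ.code (X.map MSOVar.bit)).Represents annotatedLetterCode h F := by
  have hV : φ.Below (variableBound φ.code (X.map MSOVar.bit)) :=
    φ.below_code.mono (Nat.le_add_right _ _)
  have hlam : ∀ b : A × (Fin X.length → Bool),
      (letterOf X b).2 ⊆ Finset.range (variableBound φ.code (X.map MSOVar.bit)) := by
    intro b v hv
    obtain ⟨j, -, rfl⟩ := Finset.mem_image.1 hv
    exact Finset.mem_range.2 (lt_variableBound (List.mem_map_of_mem (List.get_mem X j)))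
  obtain ⟨hE, F, h1, h2, h3⟩ := exists_represents hLa h hV hlam annotatedLetterCode_injective
    (mem_annotatedLetters hLa)
    (fun x hx => lt_variableBound (List.mem_map.2 ⟨_, mem_firstOrder.1 hx, rfl⟩))
    (fun x hx => mem_firstOrder.2 (hf _ hx)) (mem_annotatedLanguage_iff hX hf)
  exact ⟨_, _, F, h1, projectable hE X, h2, h3⟩

end Annotated

/-! ### Assembly for an arbitrary encoding of the alphabet. -/

/-- A finite type with an injective coding by numbers is primitive recursively coded. -/
noncomputable abbrev primcodableOfFinite (A : Type v) [Finite A] [i : Encodable A] : Primcodable A where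
  encode := i.encode
  decode := Encodable.decode₂ A
  encodek := Encodable.encodek₂
  prim := by
    have hfin := Set.finite_range (i.encode)
    -- Decoding is a test for membership in a finite list of codes, with `n + 1` standing for
    -- `some`; `Encodable.decode₂` is used because it rejects every number that is not a code.
    have : Primrec fun n : ℕ => if n ∈ hfin.toFinset.toList then n + 1 else 0 := by fun_prop
    refine (Primrec.nat_iff.1 this).of_eq fun n => ?_
    split_ifs with h
    · simp only [Finset.mem_toList, Set.Finite.mem_toFinset, Set.mem_range] at h
      obtain ⟨a, rfl⟩ := h
      simp
    · cases hd : Encodable.decode₂ A n with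
      | none => simp
      | some a =>
        refine (h ?_).elim
        simp only [Finset.mem_toList, Set.Finite.mem_toFinset, Set.mem_range]
        exact ⟨a, Encodable.decode₂_eq_some.1 hd⟩

/-- The main theorem, for an alphabet that is primitive recursively coded. -/
theorem effectivelyRecognized (D : Type u) [Infinite D] (A : Type v) [Finite A] [Primcodable A] :
    (∃ f : ℕ × List MSOVar →. FiniteRep, Partrec f ∧
      ∀ (φ : MSO A) (X : List MSOVar), φ.RigidlyGuarded D → X.Nodup →
        (∀ x ∈ φ.freeVars, x ∈ X) →
        ∃ R ∈ f (φ.code, X), ∃ (M : DataMonoid.{u, max u v} D)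
          (h : (freeDataMonoid D (A × (Fin X.length → Bool))).Hom M) (F : Set M),
          M.OrbitFinite ∧ h.Projectable ∧ h.Recognizes F (φ.annotatedLanguage D X) ∧
          R.Represents annotatedLetterCode h F) ∧
    ∃ f : ℕ →. FiniteRep, Partrec f ∧
      ∀ φ : MSO A, φ.RigidlyGuarded D → φ.freeVars = ∅ →
        ∃ R ∈ f φ.code, ∃ (M : DataMonoid.{u, max u v} D)
          (h : (freeDataMonoid D A).Hom M) (F : Set M),
          M.OrbitFinite ∧ (φ.IsFO → M.Aperiodic) ∧ h.Recognizes F (φ.language D) ∧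
          R.Represents Encodable.encode h F := by
  obtain ⟨La, hLa⟩ : ∃ La : List A, ∀ a, a ∈ La :=
    ⟨(Set.finite_univ (α := A)).toFinset.toList, by simp⟩
  refine ⟨⟨_, (primrec_annotatedRep La).to_comp.partrec, fun φ X h hX hf => ?_⟩,
    ⟨_, (primrec_sentenceRep La).to_comp.partrec, fun φ h hφ => ?_⟩⟩
  · exact ⟨_, Part.mem_some _, exists_represents_annotatedLanguage hLa h hX hf⟩
  · obtain ⟨hE, F, h1, h2, h3⟩ := exists_represents_language hLa h hφ
    exact ⟨_, Part.mem_some _, _, _, F, h1,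
      fun hF => Nice.aperiodic fun z => h.cong_rep φ.below_code hF z, h2, h3⟩

/-- The given encoding need not decode primitive recursively, but as the alphabet is finite, its
decoding can be replaced without changing the codes of letters; codes of formulas are then unchanged
as well. Aperiodicity comes from the same algorithm as the statement for all sentences. -/
theorem mainTheorem1 (D : Type u) [Infinite D] (A : Type v) [Finite A] [Encodable A] :
    -- annotated languages of formulas, via projectable morphisms
    (∃ f : ℕ × List MSOVar →. FiniteRep, Partrec f ∧
      ∀ (φ : MSO A) (X : List MSOVar), φ.RigidlyGuarded D → X.Nodup →
        (∀ x ∈ φ.freeVars, x ∈ X) →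
        ∃ R ∈ f (φ.code, X), ∃ (M : DataMonoid.{u, max u v} D)
          (h : (freeDataMonoid D (A × (Fin X.length → Bool))).Hom M) (F : Set M),
          M.OrbitFinite ∧ h.Projectable ∧ h.Recognizes F (φ.annotatedLanguage D X) ∧
          R.Represents annotatedLetterCode h F) ∧
    -- languages of sentences
    (∃ f : ℕ →. FiniteRep, Partrec f ∧
      ∀ φ : MSO A, φ.RigidlyGuarded D → φ.freeVars = ∅ →
        ∃ R ∈ f φ.code, ∃ (M : DataMonoid.{u, max u v} D)
          (h : (freeDataMonoid D A).Hom M) (F : Set M),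
          M.OrbitFinite ∧ h.Recognizes F (φ.language D) ∧ R.Represents Encodable.encode h F) ∧
    -- languages of first-order sentences
    (∃ f : ℕ →. FiniteRep, Partrec f ∧
      ∀ φ : MSO A, φ.RigidlyGuarded D → φ.IsFO → φ.freeVars = ∅ →
        ∃ R ∈ f φ.code, ∃ (M : DataMonoid.{u, max u v} D)
          (h : (freeDataMonoid D A).Hom M) (F : Set M),
          M.OrbitFinite ∧ M.Aperiodic ∧ h.Recognizes F (φ.language D) ∧
          R.Represents Encodable.encode h F) := by
  have hc : ∀ φ : MSO A, @MSO.code A (primcodableOfFinite A).toEncodable φ = φ.code :=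
    MSO.code_congr fun _ => rfl
  obtain ⟨⟨f, hf, h1⟩, g, hg, h2⟩ := @effectivelyRecognized D _ A _ (primcodableOfFinite A)
  simp only [hc] at h1 h2
  refine ⟨⟨f, hf, h1⟩, ⟨g, hg, fun φ h hφ => ?_⟩, ⟨g, hg, fun φ h hF hφ => ?_⟩⟩
  · obtain ⟨R, hR, M, m, F, ho, -, h3⟩ := h2 φ h hφ
    exact ⟨R, hR, M, m, F, ho, h3⟩
  · obtain ⟨R, hR, M, m, F, ho, ha, h3⟩ := h2 φ h hφ
    exact ⟨R, hR, M, m, F, ho, ha hF, h3⟩
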